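/- Let $n\ge 0$, let $V\in C([0,1];\mathbb{R}^{n\times n})$ be symmetric-matrix-valued, and let $\alpha_1,\alpha_2,\beta_1,\beta_2\in\mathbb{R}^{n\times n}$ satisfy $\operatorname{rank}[\alpha_1\ \alpha_2]=\operatorname{rank}[\beta_1\ \beta_2]=n$, $\alpha_1\alpha_2^t=\alpha_2\alpha_1^t$, $\beta_1\beta_2^t=\beta_2\beta_1^t$. Let $P_{D_0}$ and $P_{N_0}$ be the orthogonal projections onto $\ker\alpha_2$ and $\ker\alpha_1$, let $P_{R_0}=I-P_{D_0}-P_{N_0}$, and let $\Lambda_0$ be the invertible self-adjoint operator on $\operatorname{ran}P_{R_0}$ for which $\alpha_1y+\alpha_2y'=0$ is equivalent to $P_{D_0}y=0$, $P_{N_0}y'=0$, $P_{R_0}y'=\Lambda_0P_{R_0}y$; let $(P_{D_1},P_{N_1},P_{R_1},\Lambda_1)$ be defined in the same way from $(\beta_1,\beta_2)$. Put $M=P_{R_0}\Lambda_0P_{R_0}-P_{R_1}\Lambda_1P_{R_1}$ and $K=\ker P_{D_0}\cap\ker P_{D_1}$. Let $B$ be the self-adjoint operator on $K$ obtained by restricting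 $M$, i.e. the operator on $K$ with $(Bp,q)=(Mp,q)$ for $p,q\in K$, and let $Q$ be the orthogonal projection onto $\ker B$. Assume that (i) $Mp=0$ for all $p\in\ker B$ (this holds automatically if $M$ maps $K$ into $K$, so that $B$ is literally the restriction $M|_K$; in particular if $P_{D_0}=P_{D_1}$ or $K=\{0\}$; and it holds trivially if $B$ is invertible); (ii) $0\notin\sigma\big(Q(V(0)-(P_{R_0}\Lambda_0P_{R_0})^2)Q\big)$, the operator being considered on $\operatorname{ran}Q=\ker B$. For $s\in(0,1]$ let $H(s)$ be the operator $H(s)u=-u''+s^2V(s\,\cdot)u$ in $L^2((0,1);\mathbb{R}^n)$ with domain $\{u\in H^2(0,1):\alpha_1u(0)+\tfrac1s\alpha_2u'(0)=0,\ \beta_1u(1)+\tfrac1s\beta_2u'(1)=0\}$. For $\lambda\in\mathbb{R}$ let $\ell(s,\lambda)\subset\mathbb{R}^{2n}$ be the Lagrangian subspace of all $(p(s),q(s))$ such that $p'=q$, $q'=(V-\lambda)p$ on $[0,s]$ and $\alpha_1p(0)+\alpha_2q(0)=0$, and let $\ell_1=\{(p,q):\beta_1p+\beta_2q=0\}$.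 Write $\operatorname{Mor}$ for the number of negative eigenvalues, counted with multiplicity. For a continuous path $\Upsilon$ of Lagrangian subspaces, $\operatorname{Mas}(\Upsilon,\ell_1;\cdot)$ is the spectral flow through $-1$ (counterclockwise crossings counted positively) of the unitary $n\times n$ matrices $\tilde W_t$ that correspond to $W_t=U_tU_t^T$, where $U_t$ is a real orthogonal $2n\times 2n$ matrix commuting with $J=\begin{pmatrix}0&-I\\ I&0\end{pmatrix}$ with $U_t(\ell_1^\perp)=\Upsilon(t)$, where $U_t^T=\tau_1U_t^t\tau_1$ with $\tau_1(x+Jy)=x-Jy$ for $x,y\in\ell_1$, and where a real $2n\times2n$ matrix commuting with $J$, with first block column $(A_{11},A_{21})$, corresponds to $A_{11}+iA_{21}$. That is, $\operatorname{Mas}=\sum_j\big(k(t_j,\epsilon_j)-k(t_{j-1},\epsilon_j)\big)$ with $k(t,\epsilon)=\sum_{0\le\theta<\epsilon}\dim\ker(\tilde W_t-e^{i(\pi+\theta)}I)$, for any partition $t_0<\dots<t_N$ of the parameter interval and any $\epsilon_j\in(0,\pi)$ with $e^{i(\pi\pm\epsilon_j)}\notin\sigma(\tilde W_t)$ for $t\in[t_{j-1},t_j]$.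 Then for all sufficiently small $s>0$ $$\operatorname{Mor}(H(s))=\operatorname{Mor}(B)+\operatorname{Mor}\big(Q(V(0)-(P_{R_0}\Lambda_0P_{R_0})^2)Q\big)$$ (in particular $H(s)$ has only finitely many negative eigenvalues, each of finite multiplicity), and for each such $s$ and all sufficiently large $\lambda_\infty>0$ (depending on $s$), with $\Gamma_1$ the path on which $s$ is fixed and $\lambda$ increases from $-\lambda_\infty$ to $0$, $$\operatorname{Mas}(\ell,\ell_1;\Gamma_1)=-\operatorname{Mor}(B)-\operatorname{Mor}\big(Q(V(0)-(P_{R_0}\Lambda_0P_{R_0})^2)Q\big).$$ -/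

import Mathlib

open MeasureTheory
open scoped Matrix

namespace MaslovMorse

noncomputable section

/-! ### Projections and the Robin operator of a boundary condition

The pair `(α₁, α₂)` encodes the boundary condition `α₁ y + α₂ y' = 0`. -/

/-- The matrix of the orthogonal projection of `ℝⁿ` onto the null space of `A`. -/
def kerProj {n : ℕ} (A : Matrix (Fin n) (Fin n) ℝ) : Matrix (Fin n) (Fin n) ℝ :=
  (Matrix.toEuclideanLin).symm (LinearMap.ker (Matrix.toEuclideanLin A)).starProjection.toLinearMap

/-- The Dirichlet projection `P_D`: the orthogonal projection onto `ker α₂`. -/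
def projD {n : ℕ} (_α₁ α₂ : Matrix (Fin n) (Fin n) ℝ) : Matrix (Fin n) (Fin n) ℝ := kerProj α₂

/-- The Neumann projection `P_N`: the orthogonal projection onto `ker α₁`. -/
def projN {n : ℕ} (α₁ _α₂ : Matrix (Fin n) (Fin n) ℝ) : Matrix (Fin n) (Fin n) ℝ := kerProj α₁

/-- The Robin projection `P_R = I - P_D - P_N`. -/
def projR {n : ℕ} (α₁ α₂ : Matrix (Fin n) (Fin n) ℝ) : Matrix (Fin n) (Fin n) ℝ :=
  1 - projD α₁ α₂ - projN α₁ α₂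

/-- The matrix of `P_R Λ P_R`. The matrix `(α₂ᵀ α₂ + P_D)⁻¹ α₂ᵀ` is the pseudo-inverse of `α₂`, so
that this is `-α₂⁻¹ α₁ P_R`, where `α₂⁻¹` takes values in the orthogonal complement of `ker α₂`.
The lemmas on `IsSelfAdjointBC` below show that it is the symmetric operator, invertible on `ran P_R`, for which the boundary condition
`α₁ y + α₂ y' = 0` reads `P_D y = 0`, `P_N y' = 0`, `P_R y' = Λ P_R y`. -/
def robin {n : ℕ} (α₁ α₂ : Matrix (Fin n) (Fin n) ℝ) : Matrix (Fin n) (Fin n) ℝ :=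
  -((α₂ᵀ * α₂ + projD α₁ α₂)⁻¹ * α₂ᵀ * α₁ * projR α₁ α₂)

/-- `(α₁, α₂)` encodes a self-adjoint boundary condition:
`rank [α₁ α₂] = n` and `α₁ α₂ᵀ - α₂ α₁ᵀ = 0`. -/
structure IsSelfAdjointBC {n : ℕ} (α₁ α₂ : Matrix (Fin n) (Fin n) ℝ) : Prop where
  rank_eq : (Matrix.fromCols α₁ α₂).rank = n
  symm : α₁ * α₂ᵀ - α₂ * α₁ᵀ = 0

/-! ### The boundary condition in terms of the projections -/

lemma kerProj_mulVec {n : ℕ} (A : Matrix (Fin n) (Fin n) ℝ) (v : Fin n → ℝ) :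
    kerProj A *ᵥ v = WithLp.ofLp
      ((LinearMap.ker (Matrix.toEuclideanLin A)).starProjection (WithLp.toLp 2 v)) := by
  change WithLp.ofLp (Matrix.toEuclideanLin (kerProj A) (WithLp.toLp 2 v)) = _
  rw [kerProj, LinearEquiv.apply_symm_apply]
  rfl

lemma kerProj_mulVec_of_mem {n : ℕ} {A : Matrix (Fin n) (Fin n) ℝ} {v : Fin n → ℝ}
    (h : A *ᵥ v = 0) : kerProj A *ᵥ v = v := by
  rw [kerProj_mulVec, Submodule.starProjection_eq_self_iff.2]
  change WithLp.toLp 2 (A *ᵥ v) = 0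
  rw [h]; rfl

lemma mul_kerProj {n : ℕ} (A : Matrix (Fin n) (Fin n) ℝ) : A * kerProj A = 0 := by
  refine Matrix.ext_of_mulVec_single fun i => ?_
  rw [← Matrix.mulVec_mulVec, kerProj_mulVec, Matrix.zero_mulVec]
  exact congrArg WithLp.ofLp (LinearMap.mem_ker.1 (Submodule.starProjection_apply_mem
    (LinearMap.ker (Matrix.toEuclideanLin A)) (WithLp.toLp 2 (Pi.single i 1))))

lemma kerProj_transpose {n : ℕ} (A : Matrix (Fin n) (Fin n) ℝ) : (kerProj A)ᵀ = kerProj A := by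
  have h : (kerProj A).IsHermitian := by
    rw [Matrix.isSymmetric_toEuclideanLin_iff.symm, kerProj, LinearEquiv.apply_symm_apply]
    exact Submodule.starProjection_isSymmetric _
  simpa [Matrix.IsHermitian, Matrix.conjTranspose_eq_transpose_of_trivial] using h

lemma kerProj_mul_self {n : ℕ} (A : Matrix (Fin n) (Fin n) ℝ) :
    kerProj A * kerProj A = kerProj A := by
  refine Matrix.ext_of_mulVec_single fun i => ?_
  rw [← Matrix.mulVec_mulVec, kerProj_mulVec_of_mem]
  rw [Matrix.mulVec_mulVec, mul_kerProj, Matrix.zero_mulVec]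

lemma kerProj_mul_transpose {n : ℕ} (A : Matrix (Fin n) (Fin n) ℝ) : kerProj A * Aᵀ = 0 := by
  have := congrArg Matrix.transpose (mul_kerProj A)
  simpa [Matrix.transpose_mul, kerProj_transpose] using this

/-- The vectors satisfying the boundary condition are the `(α₂ᵀ c, -α₁ᵀ c)`. -/
lemma IsSelfAdjointBC.exists_param {n : ℕ} {α₁ α₂ : Matrix (Fin n) (Fin n) ℝ}
    (H : IsSelfAdjointBC α₁ α₂) {y y' : Fin n → ℝ} (h : α₁ *ᵥ y + α₂ *ᵥ y' = 0) :
    ∃ c, y = α₂ᵀ *ᵥ c ∧ y' = -(α₁ᵀ *ᵥ c) := by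
  set T := Matrix.fromRows α₂ᵀ (-α₁ᵀ) with hT
  set C := Matrix.fromCols α₁ α₂ with hC
  have hle : LinearMap.range T.mulVecLin ≤ LinearMap.ker C.mulVecLin := by
    rintro _ ⟨c, rfl⟩
    rw [LinearMap.mem_ker, Matrix.mulVecLin_apply, Matrix.mulVecLin_apply, hT,
      Matrix.fromRows_mulVec, hC, Matrix.fromCols_mulVec_sumElim, Matrix.neg_mulVec,
      Matrix.mulVec_neg, Matrix.mulVec_mulVec, Matrix.mulVec_mulVec, ← sub_eq_add_neg,
      ← Matrix.sub_mulVec, H.symm, Matrix.zero_mulVec]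
  have hCt : Function.Injective Cᵀ.mulVecLin := by
    rw [← LinearMap.ker_eq_bot, ← Submodule.finrank_eq_zero]
    have h1 := LinearMap.finrank_range_add_finrank_ker Cᵀ.mulVecLin
    have h2 : Module.finrank ℝ (LinearMap.range Cᵀ.mulVecLin) = n := by
      have := Matrix.rank_transpose C
      rw [hC, H.rank_eq] at this
      exact this
    rw [h2, Module.finrank_fin_fun] at h1
    omega
  have hTi : Function.Injective T.mulVecLin := by
    rw [injective_iff_map_eq_zero]
    intro c hc
    rw [Matrix.mulVecLin_apply, hT, Matrix.fromRows_mulVec] at hc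
    have e1 : α₂ᵀ *ᵥ c = 0 := funext fun i => congrFun hc (Sum.inl i)
    have e2 : α₁ᵀ *ᵥ c = 0 := funext fun i => by
      have := congrFun hc (Sum.inr i)
      simpa [Matrix.neg_mulVec] using this
    apply (injective_iff_map_eq_zero Cᵀ.mulVecLin).1 hCt
    rw [Matrix.mulVecLin_apply, hC, Matrix.transpose_fromCols, Matrix.fromRows_mulVec, e1, e2]
    ext i; rcases i with i | i <;> rfl
  have heq : LinearMap.range T.mulVecLin = LinearMap.ker C.mulVecLin := by
    apply Submodule.eq_of_le_of_finrank_eq hle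
    rw [LinearMap.finrank_range_of_inj hTi, Module.finrank_fin_fun]
    have h1 := LinearMap.finrank_range_add_finrank_ker C.mulVecLin
    have h2 : Module.finrank ℝ (LinearMap.range C.mulVecLin) = n := H.rank_eq
    rw [h2, Module.finrank_fintype_fun_eq_card, Fintype.card_sum, Fintype.card_fin] at h1
    omega
  have hmem : Sum.elim y y' ∈ LinearMap.ker C.mulVecLin := by
    rw [LinearMap.mem_ker, Matrix.mulVecLin_apply, hC, Matrix.fromCols_mulVec_sumElim, h]
  rw [← heq] at hmem
  obtain ⟨c, hc⟩ := hmem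
  rw [Matrix.mulVecLin_apply, hT, Matrix.fromRows_mulVec] at hc
  refine ⟨c, funext fun i => (congrFun hc (Sum.inl i)).symm, funext fun i => ?_⟩
  have := (congrFun hc (Sum.inr i)).symm
  simpa [Matrix.neg_mulVec] using this

lemma IsSelfAdjointBC.projD_mul_projN {n : ℕ} {α₁ α₂ : Matrix (Fin n) (Fin n) ℝ}
    (H : IsSelfAdjointBC α₁ α₂) : projD α₁ α₂ * projN α₁ α₂ = 0 := by
  refine Matrix.ext_of_mulVec_single fun i => ?_
  rw [← Matrix.mulVec_mulVec, Matrix.zero_mulVec]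
  obtain ⟨c, hc, -⟩ := H.exists_param (y := projN α₁ α₂ *ᵥ Pi.single i 1) (y' := 0) (by
    rw [Matrix.mulVec_mulVec, projN, mul_kerProj, Matrix.zero_mulVec, Matrix.mulVec_zero, add_zero])
  rw [hc, Matrix.mulVec_mulVec, projD, kerProj_mul_transpose, Matrix.zero_mulVec]

lemma IsSelfAdjointBC.projN_mul_projD {n : ℕ} {α₁ α₂ : Matrix (Fin n) (Fin n) ℝ}
    (H : IsSelfAdjointBC α₁ α₂) : projN α₁ α₂ * projD α₁ α₂ = 0 := by
  have := congrArg Matrix.transpose H.projD_mul_projN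
  simpa [Matrix.transpose_mul, projD, projN, kerProj_transpose] using this

lemma isUnit_pinvAux {n : ℕ} (α₁ α₂ : Matrix (Fin n) (Fin n) ℝ) :
    IsUnit (α₂ᵀ * α₂ + projD α₁ α₂) := by
  rw [← Matrix.mulVec_injective_iff_isUnit]
  refine (injective_iff_map_eq_zero (Matrix.mulVecLin (α₂ᵀ * α₂ + projD α₁ α₂))).2 fun v hv => ?_
  rw [Matrix.mulVecLin_apply, Matrix.add_mulVec] at hv
  have h1 := congrArg (projD α₁ α₂ *ᵥ ·) hv
  simp only [Matrix.mulVec_add, Matrix.mulVec_zero, Matrix.mulVec_mulVec, ← Matrix.mul_assoc] at h1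
  rw [projD, kerProj_mul_transpose, Matrix.zero_mul, Matrix.zero_mulVec, zero_add,
    kerProj_mul_self] at h1
  rw [projD, h1, add_zero] at hv
  have h2 : v ∈ LinearMap.ker (α₂ᵀ * α₂).mulVecLin := hv
  rw [Matrix.ker_mulVecLin_transpose_mul_self] at h2
  rw [← kerProj_mulVec_of_mem (A := α₂) h2, h1]

/-- If `(y, y')` satisfies the boundary condition, then `P_R y' = (P_R Λ P_R) y`. -/
lemma IsSelfAdjointBC.robin_of_bc {n : ℕ} {α₁ α₂ : Matrix (Fin n) (Fin n) ℝ}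
    (H : IsSelfAdjointBC α₁ α₂) {y y' : Fin n → ℝ} (h : α₁ *ᵥ y + α₂ *ᵥ y' = 0) :
    projD α₁ α₂ *ᵥ y = 0 ∧ projN α₁ α₂ *ᵥ y' = 0 ∧
      projR α₁ α₂ *ᵥ y' = robin α₁ α₂ *ᵥ y := by
  obtain ⟨c, hy, hy'⟩ := H.exists_param h
  have hD : projD α₁ α₂ *ᵥ y = 0 := by
    rw [hy, Matrix.mulVec_mulVec, projD, kerProj_mul_transpose, Matrix.zero_mulVec]
  have hN : projN α₁ α₂ *ᵥ y' = 0 := by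
    rw [hy', Matrix.mulVec_neg, Matrix.mulVec_mulVec, projN, kerProj_mul_transpose,
      Matrix.zero_mulVec, neg_zero]
  refine ⟨hD, hN, ?_⟩
  have hG : (α₂ᵀ * α₂ + projD α₁ α₂) *ᵥ (projR α₁ α₂ *ᵥ y') =
      -(α₂ᵀ *ᵥ (α₁ *ᵥ (projR α₁ α₂ *ᵥ y))) := by
    have e1 : α₁ *ᵥ (projR α₁ α₂ *ᵥ y) = α₁ *ᵥ y := by
      rw [projR, Matrix.sub_mulVec, Matrix.sub_mulVec, hD, Matrix.mulVec_sub, Matrix.mulVec_mulVec,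
        projN, mul_kerProj]
      simp
    have e2 : α₂ *ᵥ (projR α₁ α₂ *ᵥ y') = α₂ *ᵥ y' := by
      rw [projR, Matrix.sub_mulVec, Matrix.sub_mulVec, hN, sub_zero, Matrix.mulVec_sub,
        Matrix.one_mulVec, Matrix.mulVec_mulVec, projD, mul_kerProj]
      simp
    have e3 : projD α₁ α₂ * projR α₁ α₂ = 0 := by
      rw [projR, mul_sub, mul_sub, H.projD_mul_projN, projD, kerProj_mul_self]
      simp
    rw [Matrix.add_mulVec, ← Matrix.mulVec_mulVec (projR α₁ α₂ *ᵥ y') α₂ᵀ α₂, e2,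
      Matrix.mulVec_mulVec y' (projD α₁ α₂), e3, e1, Matrix.zero_mulVec, add_zero,
      ← Matrix.mulVec_neg]
    congr 1
    exact eq_neg_of_add_eq_zero_right h
  have hu := (Matrix.isUnit_iff_isUnit_det _).1 (isUnit_pinvAux α₁ α₂)
  have := congrArg ((α₂ᵀ * α₂ + projD α₁ α₂)⁻¹ *ᵥ ·) hG
  simp only [Matrix.mulVec_mulVec, Matrix.nonsing_inv_mul_cancel_left _ _ hu,
    Matrix.mulVec_neg] at this
  rw [this, robin, Matrix.neg_mulVec]
  simp only [Matrix.mul_assoc]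

/-- Every vector `y` with `P_D y = 0` is the first component of a vector satisfying the boundary
condition. -/
lemma IsSelfAdjointBC.exists_snd {n : ℕ} {α₁ α₂ : Matrix (Fin n) (Fin n) ℝ}
    (H : IsSelfAdjointBC α₁ α₂) {y : Fin n → ℝ} (hy : projD α₁ α₂ *ᵥ y = 0) :
    ∃ y', α₁ *ᵥ y + α₂ *ᵥ y' = 0 := by
  have hu := (Matrix.isUnit_iff_isUnit_det _).1 (isUnit_pinvAux α₁ α₂)
  set v := (α₂ᵀ * α₂ + projD α₁ α₂)⁻¹ *ᵥ y with hv
  have h1 : α₂ᵀ *ᵥ (α₂ *ᵥ v) + projD α₁ α₂ *ᵥ v = y := by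
    rw [Matrix.mulVec_mulVec, ← Matrix.add_mulVec, hv, Matrix.mulVec_mulVec,
      Matrix.mul_nonsing_inv _ hu, Matrix.one_mulVec]
  have h2 : projD α₁ α₂ *ᵥ v = 0 := by
    have := congrArg (projD α₁ α₂ *ᵥ ·) h1
    simp only [Matrix.mulVec_add, hy, Matrix.mulVec_mulVec, ← Matrix.mul_assoc] at this
    rw [projD, kerProj_mul_transpose, kerProj_mul_self] at this
    simpa [projD] using this
  refine ⟨-(α₁ᵀ *ᵥ (α₂ *ᵥ v)), ?_⟩
  rw [← h1, h2, add_zero, Matrix.mulVec_neg, Matrix.mulVec_mulVec (α₂ *ᵥ v) α₁,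
    Matrix.mulVec_mulVec (α₂ *ᵥ v) α₂, ← sub_eq_add_neg, ← Matrix.sub_mulVec, H.symm,
    Matrix.zero_mulVec]

/-- The boundary condition in terms of `P_D`, `P_N`, `P_R` and `P_R Λ P_R`. -/
lemma IsSelfAdjointBC.boundary_iff {n : ℕ} {α₁ α₂ : Matrix (Fin n) (Fin n) ℝ}
    (H : IsSelfAdjointBC α₁ α₂) (y y' : Fin n → ℝ) :
    α₁ *ᵥ y + α₂ *ᵥ y' = 0 ↔ projD α₁ α₂ *ᵥ y = 0 ∧ projN α₁ α₂ *ᵥ y' = 0 ∧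
      projR α₁ α₂ *ᵥ y' = robin α₁ α₂ *ᵥ y := by
  refine ⟨H.robin_of_bc, fun ⟨hD, hN, hR⟩ => ?_⟩
  obtain ⟨z, hz⟩ := H.exists_snd hD
  obtain ⟨-, hN', hR'⟩ := H.robin_of_bc hz
  have h1 : y' - z = projD α₁ α₂ *ᵥ (y' - z) := by
    have h2 : projR α₁ α₂ *ᵥ (y' - z) = 0 := by rw [Matrix.mulVec_sub, hR, hR', sub_self]
    have h3 : projN α₁ α₂ *ᵥ (y' - z) = 0 := by rw [Matrix.mulVec_sub, hN, hN', sub_self]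
    rw [projR, Matrix.sub_mulVec, Matrix.sub_mulVec, Matrix.one_mulVec, h3, sub_zero] at h2
    exact sub_eq_zero.1 h2
  have h4 : α₂ *ᵥ (y' - z) = 0 := by
    rw [h1, Matrix.mulVec_mulVec, projD, mul_kerProj, Matrix.zero_mulVec]
  rw [Matrix.mulVec_sub, sub_eq_zero] at h4
  rw [h4, hz]

lemma projR_transpose {n : ℕ} (α₁ α₂ : Matrix (Fin n) (Fin n) ℝ) :
    (projR α₁ α₂)ᵀ = projR α₁ α₂ := by
  simp [projR, projD, projN, kerProj_transpose]

lemma IsSelfAdjointBC.projR_mul_self {n : ℕ} {α₁ α₂ : Matrix (Fin n) (Fin n) ℝ}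
    (H : IsSelfAdjointBC α₁ α₂) : projR α₁ α₂ * projR α₁ α₂ = projR α₁ α₂ := by
  have h1 : projD α₁ α₂ * projD α₁ α₂ = projD α₁ α₂ := kerProj_mul_self _
  have h2 : projN α₁ α₂ * projN α₁ α₂ = projN α₁ α₂ := kerProj_mul_self _
  simp only [projR, mul_sub, sub_mul, one_mul, mul_one, h1, h2, H.projD_mul_projN,
    H.projN_mul_projD]
  abel

/-- `P_R Λ P_R` acts on `ran P_R`. -/
lemma IsSelfAdjointBC.projR_mul_robin_mul_projR {n : ℕ} {α₁ α₂ : Matrix (Fin n) (Fin n) ℝ}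
    (H : IsSelfAdjointBC α₁ α₂) :
    projR α₁ α₂ * robin α₁ α₂ * projR α₁ α₂ = robin α₁ α₂ := by
  have hr : robin α₁ α₂ * projR α₁ α₂ = robin α₁ α₂ := by
    rw [robin, neg_mul, Matrix.mul_assoc _ (projR α₁ α₂), H.projR_mul_self]
  refine Matrix.ext_of_mulVec_single fun i => ?_
  rw [Matrix.mul_assoc, hr]
  set v : Fin n → ℝ := Pi.single i 1
  have hD : projD α₁ α₂ *ᵥ (projR α₁ α₂ *ᵥ v) = 0 := by
    have h1 : projD α₁ α₂ * projD α₁ α₂ = projD α₁ α₂ := kerProj_mul_self _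
    rw [Matrix.mulVec_mulVec, projR, mul_sub, mul_sub, mul_one, h1, H.projD_mul_projN]
    simp
  obtain ⟨z, hz⟩ := H.exists_snd hD
  have h2 := (H.robin_of_bc hz).2.2
  rw [Matrix.mulVec_mulVec, hr] at h2
  rw [← Matrix.mulVec_mulVec, ← h2, Matrix.mulVec_mulVec, H.projR_mul_self]

/-- `P_R Λ P_R` is symmetric. -/
lemma IsSelfAdjointBC.robin_isSymm {n : ℕ} {α₁ α₂ : Matrix (Fin n) (Fin n) ℝ}
    (H : IsSelfAdjointBC α₁ α₂) : (robin α₁ α₂).IsSymm := by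
  have hPR := H.projR_mul_robin_mul_projR
  have hPR1 : projR α₁ α₂ * robin α₁ α₂ = robin α₁ α₂ := by
    conv_rhs => rw [← hPR]
    conv_lhs => rw [← hPR]
    rw [← Matrix.mul_assoc, ← Matrix.mul_assoc, H.projR_mul_self]
  have hPR2 : robin α₁ α₂ * projR α₁ α₂ = robin α₁ α₂ := by
    conv_rhs => rw [← hPR]
    conv_lhs => rw [← hPR]
    rw [Matrix.mul_assoc, H.projR_mul_self]
  have hD : ∀ v : Fin n → ℝ, projD α₁ α₂ *ᵥ (projR α₁ α₂ *ᵥ v) = 0 := fun v => by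
    have h1 : projD α₁ α₂ * projD α₁ α₂ = projD α₁ α₂ := kerProj_mul_self _
    rw [Matrix.mulVec_mulVec, projR, mul_sub, mul_sub, mul_one, h1, H.projD_mul_projN]
    simp
  have key : ∀ v w : Fin n → ℝ, v ⬝ᵥ (robin α₁ α₂ *ᵥ w) = (robin α₁ α₂ *ᵥ v) ⬝ᵥ w := by
    intro v w
    obtain ⟨v', hv⟩ := H.exists_snd (hD v)
    obtain ⟨w', hw⟩ := H.exists_snd (hD w)
    have rv := (H.robin_of_bc hv).2.2
    have rw' := (H.robin_of_bc hw).2.2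
    rw [Matrix.mulVec_mulVec, hPR2] at rv rw'
    obtain ⟨c, hc, hc'⟩ := H.exists_param hv
    obtain ⟨d, hd, hd'⟩ := H.exists_param hw
    have e1 : v ⬝ᵥ (robin α₁ α₂ *ᵥ w) = (projR α₁ α₂ *ᵥ v) ⬝ᵥ w' := by
      rw [← rw', Matrix.dotProduct_mulVec, ← Matrix.mulVec_transpose, projR_transpose]
    have e2 : (robin α₁ α₂ *ᵥ v) ⬝ᵥ w = v' ⬝ᵥ (projR α₁ α₂ *ᵥ w) := by
      rw [← rv, Matrix.dotProduct_mulVec, ← Matrix.mulVec_transpose, projR_transpose]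
    rw [e1, e2, hc, hd, hc', hd', dotProduct_neg, neg_dotProduct, neg_inj]
    rw [Matrix.dotProduct_mulVec, ← Matrix.mulVec_transpose, Matrix.transpose_transpose,
      Matrix.dotProduct_mulVec, ← Matrix.mulVec_transpose, Matrix.transpose_transpose,
      Matrix.mulVec_mulVec, Matrix.mulVec_mulVec, sub_eq_zero.1 H.symm]
  refine Matrix.ext fun i j => ?_
  have := key (Pi.single j 1) (Pi.single i 1)
  simpa [Matrix.transpose_apply] using this

/-- `Λ` is invertible on `ran P_R`. -/
lemma IsSelfAdjointBC.robin_injective {n : ℕ} {α₁ α₂ : Matrix (Fin n) (Fin n) ℝ}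
    (H : IsSelfAdjointBC α₁ α₂) {y : Fin n → ℝ} (hy : projR α₁ α₂ *ᵥ y = y)
    (h : robin α₁ α₂ *ᵥ y = 0) : y = 0 := by
  have h1 : projD α₁ α₂ * projR α₁ α₂ = 0 := by
    have h1 : projD α₁ α₂ * projD α₁ α₂ = projD α₁ α₂ := kerProj_mul_self _
    rw [projR, mul_sub, mul_sub, mul_one, h1, H.projD_mul_projN]
    simp
  have h2 : projN α₁ α₂ * projR α₁ α₂ = 0 := by
    have h1 : projN α₁ α₂ * projN α₁ α₂ = projN α₁ α₂ := kerProj_mul_self _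
    rw [projR, mul_sub, mul_sub, mul_one, h1, H.projN_mul_projD]
    simp
  have h3 : α₁ *ᵥ y = 0 := by
    have := (H.boundary_iff y 0).2 ⟨by rw [← hy, Matrix.mulVec_mulVec, h1, Matrix.zero_mulVec],
      Matrix.mulVec_zero _, by rw [h, Matrix.mulVec_zero]⟩
    rwa [Matrix.mulVec_zero, add_zero] at this
  rw [← kerProj_mulVec_of_mem h3, ← hy, Matrix.mulVec_mulVec]
  change (projN α₁ α₂ * projR α₁ α₂) *ᵥ y = 0
  rw [h2, Matrix.zero_mulVec]

/-! ### Morse indices -/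

/-- The Morse index of a linear operator on a finite-dimensional space: the number of its negative
eigenvalues, counted with (geometric) multiplicity. -/
def mor {F : Type*} [AddCommGroup F] [Module ℝ F] (T : Module.End ℝ F) : ℕ :=
  ∑ᶠ μ ∈ Set.Iio (0 : ℝ), Module.finrank ℝ (T.eigenspace μ)

/-- The eigenspace `ker (T - μ)` of a partially defined operator, as a subspace of its domain. -/
def pmapEigenspace {F : Type*} [AddCommGroup F] [Module ℝ F] (T : F →ₗ.[ℝ] F) (μ : ℝ) :
    Submodule ℝ T.domain :=
  LinearMap.ker (T.toFun - μ • T.domain.subtype)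

/-- The partially defined operator `T` has Morse index `m`: it has only finitely many negative
eigenvalues, each of finite multiplicity, and the multiplicities add up to `m`. -/
structure HasMorseIndex {F : Type*} [AddCommGroup F] [Module ℝ F] (T : F →ₗ.[ℝ] F) (m : ℕ) :
    Prop where
  finite_eigenvalues : {μ : ℝ | μ < 0 ∧ pmapEigenspace T μ ≠ ⊥}.Finite
  finiteDimensional : ∀ μ < 0, FiniteDimensional ℝ (pmapEigenspace T μ)
  sum_eq : ∑ᶠ μ ∈ Set.Iio (0 : ℝ), Module.finrank ℝ (pmapEigenspace T μ) = m

/-! ### The matrices `B` and `Q (V(0) - (P_{R₀} Λ₀ P_{R₀})²) Q` -/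

/-- The operator on the subspace `S` induced by `M`, i.e. `p ↦ Π_S M p` with `Π_S` the orthogonal
projection onto `S`; it represents the restriction to `S` of the quadratic form of `M`. -/
def compress {n : ℕ} (S : Submodule ℝ (EuclideanSpace ℝ (Fin n)))
    (M : Matrix (Fin n) (Fin n) ℝ) : Module.End ℝ S :=
  S.orthogonalProjectionOnto.toLinearMap ∘ₗ Matrix.toEuclideanLin M ∘ₗ S.subtype

/-- `(ker P_{D₀}) ∩ (ker P_{D₁})`. -/
def kerD {n : ℕ} (α₁ α₂ β₁ β₂ : Matrix (Fin n) (Fin n) ℝ) :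
    Submodule ℝ (EuclideanSpace ℝ (Fin n)) :=
  LinearMap.ker (Matrix.toEuclideanLin (projD α₁ α₂)) ⊓
    LinearMap.ker (Matrix.toEuclideanLin (projD β₁ β₂))

/-- `B`: the self-adjoint operator on `(ker P_{D₀}) ∩ (ker P_{D₁})` given there by
`P_{R₀} Λ₀ P_{R₀} - P_{R₁} Λ₁ P_{R₁}`. -/
def opB {n : ℕ} (α₁ α₂ β₁ β₂ : Matrix (Fin n) (Fin n) ℝ) :
    Module.End ℝ (kerD α₁ α₂ β₁ β₂) :=
  compress (kerD α₁ α₂ β₁ β₂) (robin α₁ α₂ - robin β₁ β₂)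

/-- The null space of `B`, as a subspace of `ℝⁿ`. -/
def kerB {n : ℕ} (α₁ α₂ β₁ β₂ : Matrix (Fin n) (Fin n) ℝ) :
    Submodule ℝ (EuclideanSpace ℝ (Fin n)) :=
  (LinearMap.ker (opB α₁ α₂ β₁ β₂)).map (kerD α₁ α₂ β₁ β₂).subtype

/-- `Q (V(0) - (P_{R₀} Λ₀ P_{R₀})²) Q`, as an operator on `ran Q = ker B`; `V0` stands for `V(0)`. -/
def opQ {n : ℕ} (α₁ α₂ β₁ β₂ V0 : Matrix (Fin n) (Fin n) ℝ) :
    Module.End ℝ (kerB α₁ α₂ β₁ β₂) :=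
  compress (kerB α₁ α₂ β₁ β₂) (V0 - robin α₁ α₂ ^ 2)

/-! ### The Schrödinger operators `H(s)` -/

/-- The space `L²((0,1); ℝⁿ)`. -/
abbrev L2 (n : ℕ) : Type :=
  Lp (EuclideanSpace ℝ (Fin n)) 2 (volume.restrict (Set.Icc (0 : ℝ) 1))

/-- `f` is (the continuously differentiable representative of) an element of `H²((0,1); ℝⁿ)`, with
derivative `g`, absolutely continuous on `[0,1]`, and second derivative `h` in `L²`. -/
structure IsH2 {n : ℕ} (f g h : ℝ → EuclideanSpace ℝ (Fin n)) : Prop where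
  memLp : MemLp h 2 (volume.restrict (Set.Icc (0 : ℝ) 1))
  deriv_eq : ∀ x ∈ Set.Icc (0 : ℝ) 1, g x = g 0 + ∫ t in (0 : ℝ)..x, h t
  eq : ∀ x ∈ Set.Icc (0 : ℝ) 1, f x = f 0 + ∫ t in (0 : ℝ)..x, g t

/-- `(u, w)` belongs to the graph of `H(s)`: `u` is in `H²`, it satisfies
`α₁ u(0) + s⁻¹ α₂ u'(0) = 0` and `β₁ u(1) + s⁻¹ β₂ u'(1) = 0`, and `w = -u'' + s² V(s ·) u`. -/
def InGraphH {n : ℕ} (V : ℝ → Matrix (Fin n) (Fin n) ℝ) (α₁ α₂ β₁ β₂ : Matrix (Fin n) (Fin n) ℝ)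
    (s : ℝ) (u w : L2 n) : Prop :=
  ∃ f g h : ℝ → EuclideanSpace ℝ (Fin n), IsH2 f g h ∧
    Matrix.toEuclideanLin α₁ (f 0) + (1 / s) • Matrix.toEuclideanLin α₂ (g 0) = 0 ∧
    Matrix.toEuclideanLin β₁ (f 1) + (1 / s) • Matrix.toEuclideanLin β₂ (g 1) = 0 ∧
    u =ᵐ[volume.restrict (Set.Icc (0 : ℝ) 1)] f ∧
    w =ᵐ[volume.restrict (Set.Icc (0 : ℝ) 1)]
      fun x => -h x + s ^ 2 • Matrix.toEuclideanLin (V (s * x)) (f x)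

lemma IsH2.intervalIntegrable {n : ℕ} {f g h : ℝ → EuclideanSpace ℝ (Fin n)} (H : IsH2 f g h)
    {x : ℝ} (hx : x ∈ Set.Icc (0 : ℝ) 1) : IntervalIntegrable h volume 0 x := by
  have h1 : IntegrableOn h (Set.Icc (0 : ℝ) 1) := H.memLp.integrable (by norm_num)
  rw [intervalIntegrable_iff_integrableOn_Icc_of_le hx.1]
  exact h1.mono_set (Set.Icc_subset_Icc_right hx.2)

lemma IsH2.continuousOn_deriv {n : ℕ} {f g h : ℝ → EuclideanSpace ℝ (Fin n)} (H : IsH2 f g h) :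
    ContinuousOn g (Set.Icc (0 : ℝ) 1) := by
  have h1 : IntegrableOn h (Set.uIcc (0 : ℝ) 1) := by
    rw [Set.uIcc_of_le zero_le_one]; exact H.memLp.integrable (by norm_num)
  have h2 := (intervalIntegral.continuousOn_primitive_interval h1)
  rw [Set.uIcc_of_le zero_le_one] at h2
  exact (continuousOn_const.add h2).congr fun x hx => H.deriv_eq x hx

lemma IsH2.intervalIntegrable_deriv {n : ℕ} {f g h : ℝ → EuclideanSpace ℝ (Fin n)}
    (H : IsH2 f g h) {x : ℝ} (hx : x ∈ Set.Icc (0 : ℝ) 1) : IntervalIntegrable g volume 0 x := by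
  apply ContinuousOn.intervalIntegrable
  rw [Set.uIcc_of_le hx.1]
  exact H.continuousOn_deriv.mono (Set.Icc_subset_Icc_right hx.2)

lemma IsH2.continuousOn {n : ℕ} {f g h : ℝ → EuclideanSpace ℝ (Fin n)} (H : IsH2 f g h) :
    ContinuousOn f (Set.Icc (0 : ℝ) 1) := by
  have h1 : IntegrableOn g (Set.uIcc (0 : ℝ) 1) := by
    rw [Set.uIcc_of_le zero_le_one]; exact H.continuousOn_deriv.integrableOn_Icc
  have h2 := (intervalIntegral.continuousOn_primitive_interval h1)
  rw [Set.uIcc_of_le zero_le_one] at h2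
  exact (continuousOn_const.add h2).congr fun x hx => H.eq x hx

lemma IsH2.add {n : ℕ} {f g h f' g' h' : ℝ → EuclideanSpace ℝ (Fin n)} (H : IsH2 f g h)
    (H' : IsH2 f' g' h') : IsH2 (f + f') (g + g') (h + h') where
  memLp := H.memLp.add H'.memLp
  deriv_eq x hx := by
    simp only [Pi.add_apply]
    rw [intervalIntegral.integral_add (H.intervalIntegrable hx) (H'.intervalIntegrable hx),
      H.deriv_eq x hx, H'.deriv_eq x hx]
    abel
  eq x hx := by
    simp only [Pi.add_apply]
    rw [intervalIntegral.integral_add (H.intervalIntegrable_deriv hx)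
      (H'.intervalIntegrable_deriv hx), H.eq x hx, H'.eq x hx]
    abel

lemma IsH2.smul {n : ℕ} {f g h : ℝ → EuclideanSpace ℝ (Fin n)} (c : ℝ) (H : IsH2 f g h) :
    IsH2 (c • f) (c • g) (c • h) where
  memLp := H.memLp.const_smul c
  deriv_eq x hx := by
    simp only [Pi.smul_apply]
    rw [intervalIntegral.integral_smul, H.deriv_eq x hx, smul_add]
  eq x hx := by
    simp only [Pi.smul_apply]
    rw [intervalIntegral.integral_smul, H.eq x hx, smul_add]

lemma isH2_zero {n : ℕ} : IsH2 (n := n) 0 0 0 where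
  memLp := MemLp.zero
  deriv_eq x hx := by simp
  eq x hx := by simp

/-- The graph of `H(s)`. -/
def graphH {n : ℕ} (V : ℝ → Matrix (Fin n) (Fin n) ℝ) (α₁ α₂ β₁ β₂ : Matrix (Fin n) (Fin n) ℝ)
    (s : ℝ) : Submodule ℝ (L2 n × L2 n) where
  carrier := {p | InGraphH V α₁ α₂ β₁ β₂ s p.1 p.2}
  add_mem' := by
    rintro ⟨u, w⟩ ⟨u', w'⟩ ⟨f, g, h, H, h0, h1, hu, hw⟩ ⟨f', g', h', H', h0', h1', hu', hw'⟩
    refine ⟨f + f', g + g', h + h', H.add H', ?_, ?_, ?_, ?_⟩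
    · simp only [Pi.add_apply, map_add, smul_add]
      rw [add_add_add_comm, h0, h0', add_zero]
    · simp only [Pi.add_apply, map_add, smul_add]
      rw [add_add_add_comm, h1, h1', add_zero]
    · exact (Lp.coeFn_add u u').trans (hu.add hu')
    · refine (Lp.coeFn_add w w').trans ((hw.add hw').trans (Filter.Eventually.of_forall fun x => ?_))
      simp only [Pi.add_apply, map_add, smul_add]
      abel
  zero_mem' := by
    refine ⟨0, 0, 0, isH2_zero, by simp, by simp, Lp.coeFn_zero _ _ _, ?_⟩
    refine (Lp.coeFn_zero _ _ _).trans (Filter.Eventually.of_forall fun x => ?_)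
    simp
  smul_mem' := by
    rintro c ⟨u, w⟩ ⟨f, g, h, H, h0, h1, hu, hw⟩
    refine ⟨c • f, c • g, c • h, H.smul c, ?_, ?_, ?_, ?_⟩
    · simp only [Pi.smul_apply, map_smul]
      rw [smul_comm (1 / s) c, ← smul_add, h0, smul_zero]
    · simp only [Pi.smul_apply, map_smul]
      rw [smul_comm (1 / s) c, ← smul_add, h1, smul_zero]
    · exact (Lp.coeFn_smul c u).trans (hu.const_smul c)
    · refine (Lp.coeFn_smul c w).trans ((hw.const_smul c).trans
        (Filter.Eventually.of_forall fun x => ?_))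
      simp only [Pi.smul_apply, map_smul, smul_add, smul_neg]
      rw [smul_comm c (s ^ 2)]

/-- `graphH` is the graph of an operator. -/
lemma graphH_functional {n : ℕ} (V : ℝ → Matrix (Fin n) (Fin n) ℝ)
    (α₁ α₂ β₁ β₂ : Matrix (Fin n) (Fin n) ℝ) (s : ℝ) :
    ∀ p ∈ graphH V α₁ α₂ β₁ β₂ s, p.1 = 0 → p.2 = 0 := by
  rintro ⟨u, w⟩ ⟨f, g, h, H, -, -, hu, hw⟩ rfl
  have key : ∀ k : ℝ → EuclideanSpace ℝ (Fin n), IntegrableOn k (Set.Icc (0 : ℝ) 1) →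
      (∀ x ∈ Set.Icc (0 : ℝ) 1, ∫ t in (0 : ℝ)..x, k t = 0) →
      k =ᵐ[volume.restrict (Set.Icc (0 : ℝ) 1)] 0 := by
    intro k hk hk0
    rw [Measure.restrict_congr_set (Ioc_ae_eq_Icc (a := (0 : ℝ)) (b := 1)).symm]
    have hk' : IntervalIntegrable k volume 0 1 := by
      rwa [intervalIntegrable_iff_integrableOn_Icc_of_le zero_le_one]
    have h3 := hk'.ae_hasDerivAt_integral
    rw [Filter.EventuallyEq, ae_restrict_iff' measurableSet_Ioc]
    have hne : ∀ᵐ x : ℝ, x ≠ 1 := by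
      simp [ae_iff, measure_singleton]
    filter_upwards [h3, hne] with x hx hx1 hxm
    have hxm' : x ∈ Set.Ioo (0 : ℝ) 1 := ⟨hxm.1, lt_of_le_of_ne hxm.2 hx1⟩
    have h4 := hx (by rw [Set.uIcc_of_le zero_le_one]; exact Set.Ioo_subset_Icc_self hxm') 0
      (by simp)
    have h5 : (fun b => ∫ t in (0 : ℝ)..b, k t) =ᶠ[nhds x] fun _ => 0 := by
      filter_upwards [Ioo_mem_nhds hxm'.1 hxm'.2] with y hy
      exact hk0 y (Set.Ioo_subset_Icc_self hy)
    exact (h4.congr_of_eventuallyEq h5.symm).unique (hasDerivAt_const x _)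
  have hae : ∀ k : ℝ → EuclideanSpace ℝ (Fin n), ContinuousOn k (Set.Icc (0 : ℝ) 1) →
      k =ᵐ[volume.restrict (Set.Icc (0 : ℝ) 1)] 0 → ∀ x ∈ Set.Icc (0 : ℝ) 1, k x = 0 := by
    intro k hk hk0 x hx
    exact Measure.eqOn_Icc_of_ae_eq volume zero_ne_one hk0 hk continuousOn_const hx
  have hf := hae f H.continuousOn (hu.symm.trans (Lp.coeFn_zero _ _ _))
  have h00 : (0 : ℝ) ∈ Set.Icc (0 : ℝ) 1 := by simp
  have hg := hae g H.continuousOn_deriv (key g H.continuousOn_deriv.integrableOn_Icc fun x hx => by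
    have := H.eq x hx
    rw [hf x hx, hf 0 h00, zero_add] at this
    exact this.symm)
  have hh := key h (H.memLp.integrable (by norm_num)) fun x hx => by
    have := H.deriv_eq x hx
    rw [hg x hx, hg 0 h00, zero_add] at this
    exact this.symm
  change w = 0
  rw [Lp.eq_zero_iff_ae_eq_zero]
  filter_upwards [hw, hh, ae_restrict_mem measurableSet_Icc] with x hx hx' hxm
  rw [hx, hx', hf x hxm]
  simp

/-- The operator `H(s)` in `L²((0,1); ℝⁿ)`: `H(s) u = -u'' + s² V(s ·) u`, with domain
`{u ∈ H² : α₁ u(0) + s⁻¹ α₂ u'(0) = 0, β₁ u(1) + s⁻¹ β₂ u'(1) = 0}`. -/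
def opH {n : ℕ} (V : ℝ → Matrix (Fin n) (Fin n) ℝ) (α₁ α₂ β₁ β₂ : Matrix (Fin n) (Fin n) ℝ)
    (s : ℝ) : L2 n →ₗ.[ℝ] L2 n :=
  (graphH V α₁ α₂ β₁ β₂ s).toLinearPMap

/-- The operator `H(s)` has the graph given above. -/
lemma opH_graph {n : ℕ} (V : ℝ → Matrix (Fin n) (Fin n) ℝ)
    (α₁ α₂ β₁ β₂ : Matrix (Fin n) (Fin n) ℝ) (s : ℝ) :
    (opH V α₁ α₂ β₁ β₂ s).graph = graphH V α₁ α₂ β₁ β₂ s :=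
  Submodule.toLinearPMap_graph_eq _ (graphH_functional V α₁ α₂ β₁ β₂ s)

/-! ### Lagrangian subspaces and the Maslov index

Vectors `(p, q)` of `ℝ²ⁿ` are functions on `Fin n ⊕ Fin n`, and `Matrix.J` is the matrix with rows
`(0, -I)` and `(I, 0)`. -/

/-- `ℓ` is a Lagrangian subspace of `ℝ²ⁿ`. -/
structure IsLagrangian {n : ℕ} (ℓ : Submodule ℝ (Fin n ⊕ Fin n → ℝ)) : Prop where
  finrank_eq : Module.finrank ℝ ℓ = n
  isotropic : ∀ x ∈ ℓ, ∀ y ∈ ℓ, (Matrix.J (Fin n) ℝ *ᵥ x) ⬝ᵥ y = 0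

/-- `U` is a unitary operator on the complex Hilbert space `ℝ²ⁿ_J`. -/
def IsUnitaryJ {n : ℕ} (U : Matrix (Fin n ⊕ Fin n) (Fin n ⊕ Fin n) ℝ) : Prop :=
  Uᵀ * U = 1 ∧ U * Uᵀ = 1 ∧ U * Matrix.J (Fin n) ℝ = Matrix.J (Fin n) ℝ * U

/-- `τ` is the conjugation `x + J y ↦ x - J y` (`x, y ∈ ℓ₁`). -/
def IsConjugation {n : ℕ} (ℓ₁ : Submodule ℝ (Fin n ⊕ Fin n → ℝ))
    (τ : Matrix (Fin n ⊕ Fin n) (Fin n ⊕ Fin n) ℝ) : Prop :=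
  ∀ x ∈ ℓ₁, ∀ y ∈ ℓ₁,
    τ *ᵥ (x + Matrix.J (Fin n) ℝ *ᵥ y) = x - Matrix.J (Fin n) ℝ *ᵥ y

/-- The complex `n × n` matrix `A₁₁ + i A₂₁` corresponding to a real `2n × 2n` matrix `A` that
commutes with `J`. -/
def toComplex {n : ℕ} (A : Matrix (Fin n ⊕ Fin n) (Fin n ⊕ Fin n) ℝ) :
    Matrix (Fin n) (Fin n) ℂ :=
  A.toBlocks₁₁.map (fun r => (r : ℂ)) + Complex.I • A.toBlocks₂₁.map (fun r => (r : ℂ))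

/-- `W` is the complex unitary matrix associated with the Lagrangian subspace `ℓ` and the target
`ℓ₁`: it corresponds to `U Uᵀ'`, where `U` is unitary on `ℝ²ⁿ_J`, `U (ℓ₁^⊥) = ℓ`, and
`Uᵀ' = τ Uᵀ τ` with the conjugation `τ` of `ℓ₁`. It does not depend on the choice of `U`. -/
def IsSouriau {n : ℕ} (ℓ ℓ₁ : Submodule ℝ (Fin n ⊕ Fin n → ℝ)) (W : Matrix (Fin n) (Fin n) ℂ) :
    Prop :=
  ∃ U τ : Matrix (Fin n ⊕ Fin n) (Fin n ⊕ Fin n) ℝ,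
    IsUnitaryJ U ∧ IsConjugation ℓ₁ τ ∧
    (∀ z, z ∈ ℓ ↔ ∃ v, (∀ x ∈ ℓ₁, x ⬝ᵥ v = 0) ∧ U *ᵥ v = z) ∧
    W = toComplex (U * (τ * Uᵀ * τ))

/-- The sum over `0 ≤ θ < ε` of `dim ker (W - e^{i(π + θ)})`. -/
def arcCount {n : ℕ} (W : Matrix (Fin n) (Fin n) ℂ) (ε : ℝ) : ℕ :=
  ∑ᶠ θ ∈ Set.Ico (0 : ℝ) ε,
    Module.finrank ℂ (Module.End.eigenspace (Matrix.toLin' W)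
      (Complex.exp (Complex.I * ((Real.pi + θ : ℝ) : ℂ))))

/-- `a = t₀ < t₁ < ⋯ < t_N = b` is a partition, and `ε₀, …, ε_{N-1} ∈ (0, π)` are numbers, such that
`e^{i(π ± ε_j)}` is not an eigenvalue of `W t` for `t ∈ [t_j, t_{j+1}]`. -/
structure IsAdmissible {n : ℕ} (W : ℝ → Matrix (Fin n) (Fin n) ℂ) (a b : ℝ) (N : ℕ)
    (t ε : ℕ → ℝ) : Prop where
  left : t 0 = a
  right : t N = b
  lt : ∀ j < N, t j < t (j + 1)
  pos : ∀ j < N, 0 < ε j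
  lt_pi : ∀ j < N, ε j < Real.pi
  gap_add : ∀ j < N, ∀ r ∈ Set.Icc (t j) (t (j + 1)),
    Complex.exp (Complex.I * ((Real.pi + ε j : ℝ) : ℂ)) ∉ spectrum ℂ (W r)
  gap_sub : ∀ j < N, ∀ r ∈ Set.Icc (t j) (t (j + 1)),
    Complex.exp (Complex.I * ((Real.pi - ε j : ℝ) : ℂ)) ∉ spectrum ℂ (W r)

/-- The continuous path `t ↦ Υ t`, `t ∈ [a, b]`, of Lagrangian subspaces has Maslov index `m` with
respect to the target `ℓ₁`: the net number of eigenvalues of the associated unitary matrices that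
cross `-1` counterclockwise is `m`, computed from any admissible partition (and there is one).
Continuity of the path is continuity of the associated unitary matrices, which are the blocks of
`(1 - 2 Π_{Υ t}) (2 Π_{ℓ₁} - 1)` with orthogonal projections `Π`. -/
def HasMaslovIndex {n : ℕ} (Υ : ℝ → Submodule ℝ (Fin n ⊕ Fin n → ℝ))
    (ℓ₁ : Submodule ℝ (Fin n ⊕ Fin n → ℝ)) (a b : ℝ) (m : ℤ) : Prop :=
  IsLagrangian ℓ₁ ∧ (∀ t ∈ Set.Icc a b, IsLagrangian (Υ t)) ∧
  ∃ W : ℝ → Matrix (Fin n) (Fin n) ℂ,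
    (∀ t ∈ Set.Icc a b, IsSouriau (Υ t) ℓ₁ (W t)) ∧ ContinuousOn W (Set.Icc a b) ∧
    (∃ N t ε, IsAdmissible W a b N t ε) ∧
    ∀ N t ε, IsAdmissible W a b N t ε →
      ∑ j ∈ Finset.range N,
        ((arcCount (W (t (j + 1))) (ε j) : ℤ) - (arcCount (W (t j)) (ε j) : ℤ)) = m

/-- The pair `(p, q)` solves on `[0, s]` the system `p' = q`, `q' = (V - λ) p` with
`α₁ p(0) + α₂ q(0) = 0`. -/
structure IsShot {n : ℕ} (V : ℝ → Matrix (Fin n) (Fin n) ℝ) (α₁ α₂ : Matrix (Fin n) (Fin n) ℝ)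
    (s lam : ℝ) (p q : ℝ → Fin n → ℝ) : Prop where
  deriv_p : ∀ x ∈ Set.Icc 0 s, HasDerivWithinAt p (q x) (Set.Icc 0 s) x
  deriv_q : ∀ x ∈ Set.Icc 0 s,
    HasDerivWithinAt q ((V x - lam • (1 : Matrix (Fin n) (Fin n) ℝ)) *ᵥ p x) (Set.Icc 0 s) x
  init : α₁ *ᵥ p 0 + α₂ *ᵥ q 0 = 0

/-- The subspace `ℓ(s, λ)` of the traces `(p(s), q(s))` at `s` of the solutions of
`p' = q`, `q' = (V - λ) p` on `[0, s]` with `α₁ p(0) + α₂ q(0) = 0`. -/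
def shootingPlane {n : ℕ} (V : ℝ → Matrix (Fin n) (Fin n) ℝ)
    (α₁ α₂ : Matrix (Fin n) (Fin n) ℝ) (s lam : ℝ) : Submodule ℝ (Fin n ⊕ Fin n → ℝ) where
  carrier := {z | ∃ p q, IsShot V α₁ α₂ s lam p q ∧ z = Sum.elim (p s) (q s)}
  add_mem' := by
    rintro _ _ ⟨p, q, h, rfl⟩ ⟨p', q', h', rfl⟩
    refine ⟨p + p', q + q', ⟨fun x hx => (h.deriv_p x hx).add (h'.deriv_p x hx), fun x hx => ?_, ?_⟩,
      ?_⟩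
    · simpa [Matrix.mulVec_add] using (h.deriv_q x hx).add (h'.deriv_q x hx)
    · simp only [Pi.add_apply, Matrix.mulVec_add]
      rw [add_add_add_comm, h.init, h'.init, add_zero]
    · ext i; rcases i with i | i <;> simp
  zero_mem' := by
    refine ⟨0, 0, ⟨fun x _ => ?_, fun x _ => ?_, by simp⟩, ?_⟩
    · exact hasDerivWithinAt_const x (Set.Icc 0 s) (0 : Fin n → ℝ)
    · rw [Pi.zero_apply, Matrix.mulVec_zero]
      exact hasDerivWithinAt_const x (Set.Icc 0 s) (0 : Fin n → ℝ)
    · ext i; rcases i with i | i <;> simp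
  smul_mem' := by
    rintro c _ ⟨p, q, h, rfl⟩
    refine ⟨c • p, c • q, ⟨fun x hx => (h.deriv_p x hx).const_smul c, fun x hx => ?_, ?_⟩, ?_⟩
    · simpa [Matrix.mulVec_smul] using (h.deriv_q x hx).const_smul c
    · simp only [Pi.smul_apply, Matrix.mulVec_smul]
      rw [← smul_add, h.init, smul_zero]
    · ext i; rcases i with i | i <;> simp

/-- The target `ℓ₁ = {(p, q) : β₁ p + β₂ q = 0}`. -/
def targetPlane {n : ℕ} (β₁ β₂ : Matrix (Fin n) (Fin n) ℝ) :
    Submodule ℝ (Fin n ⊕ Fin n → ℝ) :=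
  LinearMap.ker (Matrix.fromCols β₁ β₂).mulVecLin

end

end MaslovMorse

open MaslovMorse

set_option linter.unusedSectionVars false

/-! Write `L₀`, `L₁` for the two Robin operators and `K₀`, `K₁` for the kernels of the two Dirichlet
projections, so that the space called K in the theorem is `K₀ ⊓ K₁`.

Morse index as an inertia index. For small s and λ ≤ 0 a solution on [0, s] with the boundary
condition at 0 is determined by its value y = p(s) (`isUnit_solP`). Hence ⟪q(s), y⟫ - ⟪L₁ y, y⟫ is a
quadratic form of y ∈ K₁, a Dirichlet-to-Neumann form (`shotForm`). Its radical corresponds to the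
solutions that also satisfy the condition at s, which after rescaling are the eigenfunctions of H(s)
for s²λ (`eigenspaceEquiv`). By the Lagrange identity the form is strictly decreasing in λ, so its
negative index jumps just to the right of each λ by the dimension of the radical there
(`eventually_sigNeg_eq`, `step_function_sum`). For very negative λ the form is positive
(`form_pos_of_le`). Therefore the Morse index of H(s) is the negative index of the form at λ = 0
(`exists_forall_finsum_shotCross`, `hasMorseIndex_opH`).

Small s. At λ = 0 solutions minimize the energy ∫ (|p'|² + ⟪V p, p⟫) + ⟪L₀ p(0), p(0)⟫ among
functions with p(0) ∈ K₀ and given p(s) (`energy_sol_le`). The form therefore has three scales: on a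
complement of K in K₁ the solution must bend to reach K₀ and the Dirichlet integral costs order 1/s;
on K the leading term is ⟪B y, y⟫; on ker B the next term is s ⟪(V(0) - L₀²) z, z⟫. Trial functions
bound the form from above on the negative directions (`eventually_form_neg`), energy estimates bound
it from below on the positive ones (`eventually_form_pos`), and since the dimensions add up to that
of K₁ the negative index is Mor(B) plus the second Morse index (`exists_forall_sigNeg_shotForm`).

Maslov index. Eigenvalues of the unitary matrices on the arc from -1 to -e^{iε} correspond to the
nonnegative eigenvalues of a symmetric operator, as long as -e^{iε} is not an eigenvalue
(`arcCount_add_sigNeg`). Its form is again strictly decreasing in λ and has the same jumps as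
`shotForm`. On each piece of an admissible partition the arc count thus drops by exactly the
increase of the negative index of `shotForm`, and the sum telescopes (`hasMaslovIndex_of_step`). -/

namespace MaslovMorse

noncomputable section

open Module Module.End Topology Filter QuadraticMap

/-! ### Inertia of quadratic forms and its jumps along monotone paths. -/

section Inertia

variable {F : Type*} [NormedAddCommGroup F] [InnerProductSpace ℝ F]

/-- The quadratic form `x ↦ ⟪T x, x⟫` of an operator `T`. -/
def opForm (T : F →ₗ[ℝ] F) : QuadraticForm ℝ F :=
  LinearMap.BilinMap.toQuadraticMap ((innerₗ F) ∘ₗ T)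

@[simp]
lemma opForm_apply (T : F →ₗ[ℝ] F) (x : F) : opForm T x = inner ℝ (T x) x := rfl

variable [FiniteDimensional ℝ F]

/-- The number of eigenvalues of a symmetric operator in a set, counted with multiplicity. -/
lemma finsum_finrank_eigenspace {T : F →ₗ[ℝ] F} (hT : T.IsSymmetric) (S : Set ℝ) :
    ∑ᶠ μ ∈ S, finrank ℝ (eigenspace T μ) = {i | hT.eigenvalues rfl i ∈ S}.ncard := by
  classical
  have h1 : ∀ μ, finrank ℝ (eigenspace T μ) = Finset.card {i | hT.eigenvalues rfl i = μ} :=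
    fun μ => (hT.card_filter_eigenvalues_eq rfl μ).symm
  simp_rw [h1]
  rw [finsum_mem_eq_sum_of_inter_support_eq (t := (Finset.univ.image (hT.eigenvalues rfl)).filter (· ∈ S))]
  · rw [Set.ncard_eq_toFinset_card', Finset.card_eq_sum_card_fiberwise (f := hT.eigenvalues rfl)
      (t := (Finset.univ.image (hT.eigenvalues rfl)).filter (· ∈ S))]
    · refine Finset.sum_congr rfl fun μ hμ => ?_
      congr 1
      ext i
      simp only [Finset.mem_filter, Finset.mem_univ, true_and, Set.mem_toFinset, Set.mem_ofPred_eq]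
      constructor
      · rintro rfl
        exact ⟨(Finset.mem_filter.1 hμ).2, rfl⟩
      · exact fun h => h.2
    · intro i hi
      simpa using hi
  · ext μ
    simp only [Set.mem_inter_iff, Function.mem_support, ne_eq, Finset.card_eq_zero, Finset.coe_filter,
      Finset.mem_image, Finset.mem_univ, true_and, Set.mem_ofPred_eq, Finset.filter_eq_empty_iff,
      not_forall, not_not]
    grind

lemma equivalent_opForm {T : F →ₗ[ℝ] F} (hT : T.IsSymmetric) :
    (opForm T).Equivalent (weightedSumSquares ℝ (hT.eigenvalues rfl)) := by
  refine ⟨⟨(hT.eigenvectorBasis rfl).repr.toLinearEquiv ≪≫ₗ WithLp.linearEquiv 2 ℝ _, fun x => ?_⟩⟩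
  change weightedSumSquares ℝ (hT.eigenvalues rfl)
    (fun i => (hT.eigenvectorBasis rfl).repr x i) = inner ℝ (T x) x
  rw [weightedSumSquares_apply, ← (hT.eigenvectorBasis rfl).sum_inner_mul_inner]
  refine Finset.sum_congr rfl fun i _ => ?_
  rw [← OrthonormalBasis.repr_apply_apply, real_inner_comm, ← OrthonormalBasis.repr_apply_apply,
    hT.eigenvectorBasis_apply_self_apply]
  simp [mul_assoc]

lemma mor_eq_sigNeg {T : F →ₗ[ℝ] F} (hT : T.IsSymmetric) : mor T = sigNeg (opForm T) := by
  rw [mor, finsum_finrank_eigenspace hT,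
    QuadraticForm.sigNeg_of_equiv_weightedSumSquares (equivalent_opForm hT)]
  rfl

lemma finsum_finrank_eigenspace_nonneg {T : F →ₗ[ℝ] F} (hT : T.IsSymmetric) :
    ∑ᶠ μ ∈ Set.Ici (0 : ℝ), finrank ℝ (eigenspace T μ) + sigNeg (opForm T) = finrank ℝ F := by
  rw [← mor_eq_sigNeg hT, mor, finsum_finrank_eigenspace hT, finsum_finrank_eigenspace hT]
  have h := Set.ncard_add_ncard_compl {i | hT.eigenvalues rfl i ∈ Set.Ici (0 : ℝ)}
  rw [Nat.card_fin] at h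
  refine Eq.trans ?_ h
  congr 2
  ext i
  simp

lemma sigNeg_add_finrank_le_of_nonneg {Q : QuadraticForm ℝ F} {S : Submodule ℝ F}
    (hS : ∀ x ∈ S, 0 ≤ Q x) : sigNeg Q + finrank ℝ S ≤ finrank ℝ F :=
  QuadraticForm.sigPos_add_finrank_le_of_nonpos (Q := -Q) fun x hx => by simpa using hS x hx

lemma finrank_le_sigNeg {Q : QuadraticForm ℝ F} {S : Submodule ℝ F}
    (hS : ∀ x ∈ S, x ≠ 0 → Q x < 0) : finrank ℝ S ≤ sigNeg Q :=
  le_sigNeg_of_negDef Q fun x hx => by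
    simpa using hS x x.2 (by simpa using hx)

lemma finrank_le_sigPos {Q : QuadraticForm ℝ F} {S : Submodule ℝ F}
    (hS : ∀ x ∈ S, x ≠ 0 → 0 < Q x) : finrank ℝ S ≤ sigPos Q :=
  le_sigPos_of_posDef Q fun x hx => by
    simpa using hS x x.2 (by simpa using hx)

lemma exists_submodule_neg (Q : QuadraticForm ℝ F) :
    ∃ S : Submodule ℝ F, finrank ℝ S = sigNeg Q ∧ ∀ x ∈ S, x ≠ 0 → Q x < 0 := by
  obtain ⟨S, h1, h2⟩ := exists_finrank_eq_sigNeg_and_negDef Q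
  exact ⟨S, h1, fun x hx hx0 => by simpa using h2 ⟨x, hx⟩ (by simpa using hx0)⟩

lemma exists_submodule_pos (Q : QuadraticForm ℝ F) :
    ∃ S : Submodule ℝ F, finrank ℝ S = sigPos Q ∧ ∀ x ∈ S, x ≠ 0 → 0 < Q x := by
  obtain ⟨S, h1, h2⟩ := exists_finrank_eq_sigPos_and_posDef Q
  exact ⟨S, h1, fun x hx hx0 => by simpa using h2 ⟨x, hx⟩ (by simpa using hx0)⟩

/-- A maximal positive definite subspace is enlarged by the radical. A small strictly positive
perturbation makes the form positive definite on the enlarged subspace, which is what forces the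
jump of the index. -/
lemma exists_submodule_nonneg (Q : QuadraticForm ℝ F) :
    ∃ S : Submodule ℝ F, finrank ℝ S = sigPos Q + finrank ℝ Q.radical ∧ ∀ x ∈ S, 0 ≤ Q x := by
  obtain ⟨S, h1, h2⟩ := exists_submodule_pos Q
  have hd : Disjoint S Q.radical := by
    rw [Submodule.disjoint_def]
    intro x hx hr
    by_contra h
    exact (h2 x hx h).ne' (mem_radical_iff'.1 hr).1
  refine ⟨S ⊔ Q.radical, ?_, fun x hx => ?_⟩
  · have := Submodule.finrank_sup_add_finrank_inf_eq S Q.radical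
    rw [hd.eq_bot, finrank_bot, add_zero] at this
    rw [this, h1]
  · obtain ⟨y, hy, z, hz, rfl⟩ := Submodule.mem_sup.1 hx
    rw [add_comm, (mem_radical_iff'.1 hz).2]
    by_cases h : y = 0
    · simp [h]
    · exact (h2 y hy h).le

lemma radical_neg' (Q : QuadraticForm ℝ F) : (-Q).radical = Q.radical := by
  ext x
  simp [mem_radical_iff']

lemma exists_submodule_nonpos (Q : QuadraticForm ℝ F) :
    ∃ S : Submodule ℝ F, finrank ℝ S = sigNeg Q + finrank ℝ Q.radical ∧ ∀ x ∈ S, Q x ≤ 0 := by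
  obtain ⟨S, h1, h2⟩ := exists_submodule_nonneg (-Q)
  refine ⟨S, by rw [h1, radical_neg', sigPos_neg], fun x hx => by simpa using h2 x hx⟩

lemma bilinForm_self_eq_sum (b : OrthonormalBasis (Fin (finrank ℝ F)) ℝ F)
    (B : LinearMap.BilinForm ℝ F) (x : F) :
    B x x = ∑ i, ∑ j, b.repr x i * b.repr x j * B (b i) (b j) := by
  conv_lhs => rw [← b.sum_repr x]
  simp only [map_sum, LinearMap.sum_apply, map_smul, LinearMap.smul_apply, smul_eq_mul,
    Finset.mul_sum]
  rw [Finset.sum_comm]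
  refine Finset.sum_congr rfl fun i _ => Finset.sum_congr rfl fun j _ => ?_
  ring

/-- A form that is positive definite on a subspace is coercive there. -/
lemma exists_pos_mul_norm_sq_le {B₀ : LinearMap.BilinForm ℝ F} {S : Submodule ℝ F}
    (hS : ∀ x ∈ S, x ≠ 0 → 0 < B₀ x x) : ∃ c > 0, ∀ x ∈ S, c * ‖x‖ ^ 2 ≤ B₀ x x := by
  let b := stdOrthonormalBasis ℝ F
  have hcont : Continuous fun x : F => B₀ x x := by
    have h1 : Continuous fun x : F => B₀.toQuadraticMap x := by
      have h2 : ∀ x : F, B₀.toQuadraticMap x = ∑ i, ∑ j, b.repr x i * b.repr x j * B₀ (b i) (b j) := by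
        exact fun x => bilinForm_self_eq_sum b B₀ x
      simp_rw [h2]
      have h3 : ∀ i, Continuous fun x => b.repr x i := fun i => by
        simp_rw [b.repr_apply_apply]; fun_prop
      fun_prop
    exact h1
  have hK : IsCompact (Metric.sphere (0 : F) 1 ∩ S) :=
    (isCompact_sphere 0 1).inter_right S.closed_of_finiteDimensional
  by_cases hne : (Metric.sphere (0 : F) 1 ∩ S).Nonempty
  · obtain ⟨x₀, hx₀, hmin⟩ := hK.exists_isMinOn hne hcont.continuousOn
    have hx0 : x₀ ≠ 0 := by
      rintro rfl
      simpa using hx₀.1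
    refine ⟨B₀ x₀ x₀, hS x₀ hx₀.2 hx0, fun x hx => ?_⟩
    by_cases hx' : x = 0
    · simp [hx']
    · have hn : ‖x‖ ≠ 0 := norm_ne_zero_iff.2 hx'
      have := hmin (show ‖x‖⁻¹ • x ∈ _ from ⟨by simp [norm_smul, hn], S.smul_mem _ hx⟩)
      simp only [map_smul, LinearMap.smul_apply, smul_eq_mul, Set.mem_ofPred_eq] at this
      calc B₀ x₀ x₀ * ‖x‖ ^ 2 ≤ (‖x‖⁻¹ * (‖x‖⁻¹ * B₀ x x)) * ‖x‖ ^ 2 := by gcongr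
        _ = B₀ x x := by field_simp
  -- Here `S` is zero, and any positive constant serves.
  · refine ⟨1, one_pos, fun x hx => ?_⟩
    by_cases hx' : x = 0
    · simp [hx']
    · have hn : ‖x‖ ≠ 0 := norm_ne_zero_iff.2 hx'
      exact absurd ⟨‖x‖⁻¹ • x, by simp [norm_smul, hn], S.smul_mem _ hx⟩ hne

/-- Positive definiteness on a subspace is an open condition. -/
lemma eventually_pos_of_tendsto {ι : Type*} {l : Filter ι} {B : ι → LinearMap.BilinForm ℝ F}
    {B₀ : LinearMap.BilinForm ℝ F} (h : ∀ x y, Tendsto (fun t => B t x y) l (𝓝 (B₀ x y)))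
    {S : Submodule ℝ F} (hS : ∀ x ∈ S, x ≠ 0 → 0 < B₀ x x) :
    ∀ᶠ t in l, ∀ x ∈ S, x ≠ 0 → 0 < B t x x := by
  let b := stdOrthonormalBasis ℝ F
  obtain ⟨c, hc0, hc⟩ := exists_pos_mul_norm_sq_le hS
  -- Convergence is given entry by entry. In an orthonormal basis the sum of the entrywise errors
  -- times `‖x‖ ^ 2` bounds the error of the form, and coercivity of `B₀` on `S` absorbs it.
  have hlim : Tendsto (fun t => ∑ i, ∑ j, |B t (b i) (b j) - B₀ (b i) (b j)|) l (𝓝 0) := by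
    have : (0 : ℝ) = ∑ i : Fin (finrank ℝ F), ∑ j : Fin (finrank ℝ F),
        |B₀ (b i) (b j) - B₀ (b i) (b j)| := by simp
    rw [this]
    exact tendsto_finsetSum _ fun i _ => tendsto_finsetSum _ fun j _ =>
      ((h _ _).sub_const _).abs
  filter_upwards [hlim.eventually (gt_mem_nhds hc0)] with t ht x hx hx0
  have hn : 0 < ‖x‖ := norm_pos_iff.2 hx0
  have hle : |B t x x - B₀ x x| ≤ (∑ i, ∑ j, |B t (b i) (b j) - B₀ (b i) (b j)|) * ‖x‖ ^ 2 := by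
    have e : B t x x - B₀ x x =
        ∑ i, ∑ j, b.repr x i * b.repr x j * (B t (b i) (b j) - B₀ (b i) (b j)) := by
      rw [bilinForm_self_eq_sum b, bilinForm_self_eq_sum b B₀]
      simp only [← Finset.sum_sub_distrib, mul_sub]
    rw [e, Finset.sum_mul]
    refine (Finset.abs_sum_le_sum_abs _ _).trans (Finset.sum_le_sum fun i _ => ?_)
    rw [Finset.sum_mul]
    refine (Finset.abs_sum_le_sum_abs _ _).trans (Finset.sum_le_sum fun j _ => ?_)
    have hb : ∀ i, |b.repr x i| ≤ ‖x‖ := fun i => by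
      rw [b.repr_apply_apply]
      exact (abs_real_inner_le_norm _ _).trans (by simp)
    rw [abs_mul, abs_mul, mul_comm, pow_two]
    gcongr
    · exact hb i
    · exact hb j
  have := (abs_le.1 hle).1
  have h2 := hc x hx
  nlinarith [mul_pos hn hn]

/-- The negative index along a strictly decreasing path of quadratic forms jumps, immediately to the
right of `t₀`, by the dimension of the radical at `t₀`. -/
lemma eventually_sigNeg_eq {I : Set ℝ} {t₀ : ℝ} {Q : ℝ → QuadraticForm ℝ F}
    {G : ℝ → LinearMap.BilinForm ℝ F} {G₀ : LinearMap.BilinForm ℝ F}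
    (hG : ∀ x y, Tendsto (fun t => G t x y) (𝓝[I] t₀) (𝓝 (G₀ x y)))
    (hpos : ∀ x, x ≠ 0 → 0 < G₀ x x)
    (hQ : ∀ t ∈ I, ∀ x, Q t x = Q t₀ x - (t - t₀) * G t x x) :
    ∀ᶠ t in 𝓝[I] t₀, (t ≤ t₀ → sigNeg (Q t) = sigNeg (Q t₀)) ∧
      (t₀ < t → sigNeg (Q t) = sigNeg (Q t₀) + finrank ℝ (Q t₀).radical) := by
  have hGpos : ∀ᶠ t in 𝓝[I] t₀, ∀ x, x ≠ 0 → 0 < G t x x := by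
    simpa using eventually_pos_of_tendsto hG (S := ⊤) (fun x _ => hpos x)
  -- `G t` need not be symmetric and enters only through its diagonal; `B t` agrees with `Q t` on
  -- the diagonal, which is all that definiteness sees.
  let B : ℝ → LinearMap.BilinForm ℝ F := fun t => associated (Q t₀) - (t - t₀) • G t
  have hBQ : ∀ t ∈ I, ∀ x, B t x x = Q t x := by
    intro t ht x
    simp only [B, LinearMap.sub_apply, LinearMap.smul_apply, smul_eq_mul, associated_eq_self_apply]
    rw [hQ t ht x]
  have hB : ∀ x y, Tendsto (fun t => B t x y) (𝓝[I] t₀) (𝓝 (associated (Q t₀) x y)) := by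
    intro x y
    have h0 : Tendsto (fun t => t - t₀) (𝓝[I] t₀) (𝓝 0) := by
      have : Tendsto (fun t => t - t₀) (𝓝 t₀) (𝓝 (t₀ - t₀)) := (continuous_sub_right t₀).tendsto t₀
      rw [sub_self] at this
      exact this.mono_left nhdsWithin_le_nhds
    have := (tendsto_const_nhds (x := associated (Q t₀) x y)).sub (h0.mul (hG x y))
    simpa [B] using this
  obtain ⟨P, hP1, hP2⟩ := exists_submodule_pos (Q t₀)
  obtain ⟨N, hN1, hN2⟩ := exists_submodule_neg (Q t₀)
  obtain ⟨P', hP1', hP2'⟩ := exists_submodule_nonneg (Q t₀)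
  obtain ⟨N', hN1', hN2'⟩ := exists_submodule_nonpos (Q t₀)
  have hPt := eventually_pos_of_tendsto hB (S := P) (fun x hx h0 => by
    rw [associated_eq_self_apply]; exact hP2 x hx h0)
  have hNt := eventually_pos_of_tendsto (B := fun t => -B t) (B₀ := -associated (Q t₀))
    (fun x y => by simpa using (hB x y).neg) (S := N) (fun x hx h0 => by
      rw [LinearMap.neg_apply, LinearMap.neg_apply, associated_eq_self_apply]
      exact neg_pos.2 (hN2 x hx h0))
  filter_upwards [hGpos, hPt, hNt, self_mem_nhdsWithin] with t hGt hPt hNt htI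
  have e0 := QuadraticForm.sigPos_add_sigNeg_add_radical (Q := Q t₀)
  have e1 := QuadraticForm.sigPos_add_sigNeg_add_radical (Q := Q t)
  have a1 : finrank ℝ P ≤ sigPos (Q t) := finrank_le_sigPos fun x hx h0 => by
    rw [← hBQ t htI]; exact hPt x hx h0
  have a2 : finrank ℝ N ≤ sigNeg (Q t) := finrank_le_sigNeg fun x hx h0 => by
    rw [← hBQ t htI]
    have := hNt x hx h0
    rw [LinearMap.neg_apply, LinearMap.neg_apply] at this
    linarith
  constructor
  · intro hle
    rcases hle.eq_or_lt with rfl | hlt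
    · rfl
    -- To the left of `t₀` the increment is positive, so the radical joins the positive part; with
    -- `a2` and the total dimension the negative index cannot change.
    have a3 : finrank ℝ P' ≤ sigPos (Q t) := finrank_le_sigPos fun x hx h0 => by
      rw [hQ t htI]
      have := hP2' x hx
      have := hGt x h0
      nlinarith
    omega
  · intro hlt
    -- To the right of `t₀` the increment is negative and the radical joins the negative part; `a1`
    -- and the total dimension leave no room for more.
    have a3 : finrank ℝ N' ≤ sigNeg (Q t) := finrank_le_sigNeg fun x hx h0 => by
      rw [hQ t htI]
      have := hN2' x hx
      have := hGt x h0
      nlinarith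
    omega

end Inertia

/-! ### Integer-valued step functions as sums of their jumps. -/

section StepFunction

/-- A function on `[a, b]` that jumps by `d t` immediately to the right of each `t` and is otherwise
locally constant is the sum of its jumps. -/
lemma step_function_sum {f d : ℝ → ℕ} {a b : ℝ} (hab : a ≤ b)
    (h : ∀ t₀ ∈ Set.Icc a b, ∀ᶠ t in 𝓝[Set.Icc a b] t₀,
      (t ≤ t₀ → f t = f t₀) ∧ (t₀ < t → f t = f t₀ + d t₀)) :
    {t | t ∈ Set.Ico a b ∧ d t ≠ 0}.Finite ∧ f a + ∑ᶠ t ∈ Set.Ico a b, d t = f b := by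
  let R : ℝ → Prop := fun x =>
    {t | t ∈ Set.Ico a x ∧ d t ≠ 0}.Finite ∧ f a + ∑ᶠ t ∈ Set.Ico a x, d t = f x
  -- If no jump lies strictly between `x` and `y`, passing from `x` to `y` adds `d x` to both sides
  -- of the identity in `R`.
  have key : ∀ x ∈ Set.Icc a b, ∀ y ∈ Set.Icc a b, x ≤ y → (∀ t ∈ Set.Ioo x y, d t = 0) →
      f y = (if x < y then f x + d x else f x) → (R x ↔ R y) := by
    intro x hx y hy hxy hd hf
    rcases hxy.eq_or_lt with rfl | hlt
    · rfl
    rw [if_pos hlt] at hf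
    have hU : Set.Ico a y = Set.Ico a x ∪ Set.Ico x y :=
      (Set.Ico_union_Ico_eq_Ico hx.1 hxy).symm
    have hdisj : Disjoint (Set.Ico a x) (Set.Ico x y) := Set.Ico_disjoint_Ico_same
    have hfin2 : (Set.Ico x y ∩ Function.support d).Finite :=
      (Set.finite_singleton x).subset fun t ht => by
        by_contra hne
        exact ht.2 (hd t ⟨lt_of_le_of_ne ht.1.1 (Ne.symm hne), ht.1.2⟩)
    have hs2 : ∑ᶠ t ∈ Set.Ico x y, d t = d x := by
      rw [finsum_mem_eq_sum_of_inter_support_eq (t := if d x = 0 then ∅ else {x})]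
      · split_ifs with h0
        · simp [h0]
        · simp
      · ext t
        constructor
        · intro ht
          have : t = x := by
            by_contra hne
            exact ht.2 (hd t ⟨lt_of_le_of_ne ht.1.1 (Ne.symm hne), ht.1.2⟩)
          subst this
          have h2 : d t ≠ 0 := ht.2
          simp [h2]
        · split_ifs with h0
          · simp
          · simp only [Finset.coe_singleton, Set.mem_inter_iff, Set.mem_singleton_iff,
              Function.mem_support, and_imp]
            rintro rfl -
            exact ⟨⟨le_rfl, hlt⟩, h0⟩
    have hset : ∀ z, {t | t ∈ Set.Ico a z ∧ d t ≠ 0} = Set.Ico a z ∩ Function.support d :=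
      fun z => rfl
    have hfin : (Set.Ico a y ∩ Function.support d).Finite ↔
        (Set.Ico a x ∩ Function.support d).Finite := by
      rw [hU, Set.union_inter_distrib_right, Set.finite_union]
      exact ⟨fun h => h.1, fun h => ⟨h, hfin2⟩⟩
    simp only [R, hset, hfin]
    refine and_congr_right fun hfx => ?_
    rw [hU, finsum_mem_union' hdisj hfx hfin2, hs2, hf]
    omega
  -- Compare `t` with a point `u` just to its right and on the same side of `t₀`: the condition at
  -- `t₀` gives `f u = f t`, the condition at `t` gives `f u = f t + d t`. No such `u` exists for `t
  -- = b`, so `d b` stays arbitrary, in accordance with the half-open interval in the sum.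
  have hdz : ∀ t₀ ∈ Set.Icc a b, ∀ᶠ t in 𝓝[Set.Icc a b] t₀, t ≠ t₀ → t ≠ b → d t = 0 := by
    intro t₀ ht₀
    filter_upwards [eventually_eventually_nhdsWithin.2 (h t₀ ht₀), self_mem_nhdsWithin]
      with t ht htI hne hb
    have htb : t < b := lt_of_le_of_ne htI.2 hb
    have h1 := ht.self_of_nhdsWithin htI
    have hev : ∀ᶠ u in 𝓝[>] t, u ∈ Set.Icc a b := by
      filter_upwards [Ioo_mem_nhdsGT htb] with u hu
      exact ⟨htI.1.trans hu.1.le, hu.2.le⟩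
    have hle : 𝓝[>] t ≤ 𝓝[Set.Icc a b] t :=
      le_inf inf_le_left (le_principal_iff.2 hev)
    have hside : ∀ᶠ u in 𝓝[>] t, (t < t₀ → u < t₀) := by
      by_cases hlt : t < t₀
      · filter_upwards [Ioo_mem_nhdsGT hlt] with u hu _ using hu.2
      · exact Eventually.of_forall fun u hu => absurd hu hlt
    obtain ⟨u, h2, h3, hu, hs⟩ := ((ht.filter_mono hle).and (((h t htI).filter_mono hle).and
      ((eventually_mem_nhdsWithin (a := t) (s := Set.Ioi t)).and hside))).exists
    have h4 := h3.2 hu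
    rcases lt_or_gt_of_ne hne with hlt | hgt
    · have := h2.1 (hs hlt).le
      have := h1.1 hlt.le
      omega
    · have := h2.2 (hgt.trans hu)
      have := h1.2 hgt
      omega
  have hR : R a ↔ R b := by
    -- `R x ↔ R y` is an equivalence relation that holds locally, hence on the whole connected
    -- interval.
    refine isPreconnected_Icc.induction₂ (fun x y => R x ↔ R y) ?_ (fun x y z _ _ _ h1 h2 => h1.trans h2)
      (fun x y _ _ h => h.symm) (Set.left_mem_Icc.2 hab) (Set.right_mem_Icc.2 hab)
    intro x hx
    obtain ⟨U, hU, hxU, hsub⟩ := mem_nhdsWithin.1 ((h x hx).and (hdz x hx))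
    obtain ⟨δ, hδ, hball⟩ := Metric.isOpen_iff.1 hU x hxU
    have hgood : ∀ t ∈ Set.Icc a b, |t - x| < δ →
        ((t ≤ x → f t = f x) ∧ (x < t → f t = f x + d x)) ∧ (t ≠ x → t ≠ b → d t = 0) :=
      fun t ht hd => hsub ⟨hball (by rwa [Metric.mem_ball, Real.dist_eq]), ht⟩
    filter_upwards [self_mem_nhdsWithin, mem_nhdsWithin_of_mem_nhds (Metric.ball_mem_nhds x hδ)]
      with y hy hyb
    rw [Metric.mem_ball, Real.dist_eq] at hyb
    have hyg := hgood y hy hyb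
    rcases le_or_gt x y with hxy | hxy
    · refine key x hx y hy hxy (fun t ht => ?_) ?_
      · refine (hgood t ⟨hx.1.trans ht.1.le, ht.2.le.trans hy.2⟩ ?_).2 ht.1.ne'
          (ht.2.trans_le hy.2).ne
        rw [abs_lt] at hyb ⊢
        constructor <;> linarith [ht.1, ht.2]
      · split_ifs with hlt
        · exact hyg.1.2 hlt
        · exact hyg.1.1 (not_lt.1 hlt)
    · have hyd : d y = 0 := hyg.2 hxy.ne (hxy.trans_le hx.2).ne
      refine (key y hy x hx hxy.le (fun t ht => ?_) ?_).symm
      · refine (hgood t ⟨hy.1.trans ht.1.le, ht.2.le.trans hx.2⟩ ?_).2 ht.2.ne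
          (ht.2.trans_le hx.2).ne
        rw [abs_lt] at hyb ⊢
        constructor <;> linarith [ht.1, ht.2]
      · rw [if_pos hxy, hyd, add_zero, hyg.1.1 hxy.le]
  have hRa : R a := by simp only [R, Set.Ico_self]; simp
  exact hR.1 hRa

end StepFunction

end

end MaslovMorse

namespace MaslovMorse

noncomputable section

open Topology Filter Set

/-! ### Linear differential equations: existence, uniqueness, dependence on a parameter. -/

section LinearODE

variable {F : Type*} [NormedAddCommGroup F] [NormedSpace ℝ F] [CompleteSpace F]

lemma exists_norm_le_Icc (A : C(ℝ, F →L[ℝ] F)) : ∃ k > 0, ∀ x ∈ Icc (0 : ℝ) 1, ‖A x‖ ≤ k := by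
  obtain ⟨k, hk⟩ := isCompact_Icc.exists_bound_of_continuousOn
    (s := Icc (0 : ℝ) 1) (f := A) A.continuous.continuousOn
  exact ⟨max k 1, by positivity, fun x hx => (hk x hx).trans (le_max_left _ _)⟩

/-- Linear differential equations have solutions on `[0, 1]`. -/
lemma exists_linear_ode_solution (A : C(ℝ, F →L[ℝ] F)) (y₀ : F) :
    ∃ y : ℝ → F, y 0 = y₀ ∧ ∀ x ∈ Icc (0 : ℝ) 1, HasDerivAt y (A x (y x)) x := by
  obtain ⟨k, hk0, hk⟩ := exists_norm_le_Icc A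
  -- The unknown is `z x = exp (-κ x) • y x`. In the sup norm of `z` the integral operator has
  -- Lipschitz constant `k / κ = 1 / 2`, so a single fixed point covers all of `[0, 1]`.
  set κ := 2 * k with hκ
  have hκ0 : 0 < κ := by positivity
  -- The constant extension makes the integrand continuous on the line, so the solution has
  -- two-sided derivatives also at `0` and `1`.
  let ext : C(Icc (0 : ℝ) 1, F) → ℝ → F := fun z => IccExtend zero_le_one z
  let g : C(Icc (0 : ℝ) 1, F) → ℝ → F := fun z t => A t (Real.exp (κ * t) • ext z t)
  have hg : ∀ z, Continuous (g z) := fun z => by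
    have h1 : Continuous (ext z) := z.continuous.Icc_extend'
    have h2 := A.continuous
    fun_prop
  have hint : ∀ z a b, IntervalIntegrable (g z) volume a b := fun z a b =>
    (hg z).intervalIntegrable a b
  have hprim : ∀ z, Continuous fun x => ∫ t in (0 : ℝ)..x, g z t := fun z =>
    intervalIntegral.continuous_primitive (hint z) 0
  let f : C(Icc (0 : ℝ) 1, F) → C(Icc (0 : ℝ) 1, F) := fun z =>
    ⟨fun x => Real.exp (-κ * x) • (y₀ + ∫ t in (0 : ℝ)..x, g z t), by
      have h2 : Continuous fun x : Icc (0 : ℝ) 1 => ∫ t in (0 : ℝ)..x, g z t :=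
        (hprim z).comp continuous_subtype_val
      fun_prop⟩
  have hbound : ∀ z w : C(Icc (0 : ℝ) 1, F), ∀ t ∈ Icc (0 : ℝ) 1,
      ‖g z t - g w t‖ ≤ k * dist z w * Real.exp (κ * t) := by
    intro z w t ht
    simp only [g, ← map_sub, ← smul_sub]
    refine ((A t).le_opNorm _).trans ?_
    rw [norm_smul, Real.norm_of_nonneg (Real.exp_pos _).le]
    have h1 : ‖ext z t - ext w t‖ ≤ dist z w := by
      rw [← dist_eq_norm]
      exact ContinuousMap.dist_apply_le_dist _
    calc ‖A t‖ * (Real.exp (κ * t) * ‖ext z t - ext w t‖)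
        ≤ k * (Real.exp (κ * t) * dist z w) := by
          gcongr
          exact hk t ht
      _ = _ := by ring
  have hf : ContractingWith (1 / 2) f := by
    refine ⟨by norm_num, LipschitzWith.of_dist_le_mul fun z w => ?_⟩
    rw [ContinuousMap.dist_le (by positivity)]
    intro x
    rw [dist_eq_norm]
    simp only [f, ContinuousMap.coe_mk, ← smul_sub, add_sub_add_left_eq_sub]
    rw [← intervalIntegral.integral_sub (hint z _ _) (hint w _ _), norm_smul,
      Real.norm_of_nonneg (Real.exp_pos _).le]
    have h1 : ‖∫ t in (0 : ℝ)..x, g z t - g w t‖ ≤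
        ∫ t in (0 : ℝ)..x, k * dist z w * Real.exp (κ * t) := by
      refine intervalIntegral.norm_integral_le_of_norm_le x.2.1
        (Eventually.of_forall fun t ht => hbound z w t ⟨ht.1.le, ht.2.trans x.2.2⟩) ?_
      exact (by fun_prop : Continuous fun t => k * dist z w * Real.exp (κ * t)).intervalIntegrable _ _
    have h2 : ∫ t in (0 : ℝ)..x, k * dist z w * Real.exp (κ * t) =
        dist z w / 2 * (Real.exp (κ * x) - 1) := by
      rw [intervalIntegral.integral_const_mul,
        intervalIntegral.integral_comp_mul_left (fun t => Real.exp t) hκ0.ne', integral_exp,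
        smul_eq_mul, mul_zero, Real.exp_zero, hκ]
      field_simp
    rw [h2] at h1
    calc Real.exp (-κ * x) * ‖∫ t in (0 : ℝ)..x, g z t - g w t‖
        ≤ Real.exp (-κ * x) * (dist z w / 2 * (Real.exp (κ * x) - 1)) := by gcongr
      _ = dist z w / 2 * (1 - Real.exp (-κ * x)) := by
          have : Real.exp (-κ * x) * Real.exp (κ * x) = 1 := by
            rw [← Real.exp_add]; simp
          linear_combination dist z w / 2 * this
      _ ≤ dist z w / 2 * 1 := by
          gcongr
          linarith [Real.exp_pos (-κ * x)]
      _ = _ := by push_cast; ring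
  obtain ⟨z, hz⟩ : ∃ z, f z = z := ⟨_, hf.fixedPoint_isFixedPt⟩
  refine ⟨fun x => y₀ + ∫ t in (0 : ℝ)..x, g z t, by simp, fun x hx => ?_⟩
  have h1 : HasDerivAt (fun x => y₀ + ∫ t in (0 : ℝ)..x, g z t) (g z x) x :=
    ((hg z).integral_hasStrictDerivAt 0 x).hasDerivAt.const_add y₀
  have h2 : ext z x = Real.exp (-κ * x) • (y₀ + ∫ t in (0 : ℝ)..x, g z t) := by
    have : ext z x = z ⟨x, hx⟩ := IccExtend_of_mem _ _ hx
    rw [this]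
    conv_lhs => rw [← hz]
    rfl
  convert h1 using 1
  simp only [g, h2, smul_smul]
  rw [← Real.exp_add]
  simp

/-- The fundamental solution of the linear differential equation `y' = A y`. -/
lemma exists_fundamental_solution (A : C(ℝ, F →L[ℝ] F)) :
    ∃ Φ : ℝ → F →L[ℝ] F, Φ 0 = 1 ∧ ∀ x ∈ Icc (0 : ℝ) 1, HasDerivAt Φ (A x * Φ x) x := by
  let A' : C(ℝ, (F →L[ℝ] F) →L[ℝ] (F →L[ℝ] F)) :=
    ⟨fun x => ContinuousLinearMap.mul ℝ (F →L[ℝ] F) (A x), by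
      have := A.continuous
      fun_prop⟩
  obtain ⟨Φ, h0, h1⟩ := exists_linear_ode_solution A' 1
  exact ⟨Φ, h0, h1⟩

/-- The fundamental solution of the linear differential equation `y' = A y`. -/
def fundamentalSolution (A : C(ℝ, F →L[ℝ] F)) : ℝ → F →L[ℝ] F :=
  (exists_fundamental_solution A).choose

lemma fundamentalSolution_zero (A : C(ℝ, F →L[ℝ] F)) : fundamentalSolution A 0 = 1 :=
  (exists_fundamental_solution A).choose_spec.1

lemma hasDerivAt_fundamentalSolution (A : C(ℝ, F →L[ℝ] F)) {x : ℝ} (hx : x ∈ Icc (0 : ℝ) 1) :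
    HasDerivAt (fundamentalSolution A) (A x * fundamentalSolution A x) x :=
  (exists_fundamental_solution A).choose_spec.2 x hx

lemma linear_ode_unique (A : C(ℝ, F →L[ℝ] F)) {s : ℝ} (hs : s ≤ 1) {y z : ℝ → F}
    (hy : ∀ x ∈ Icc 0 s, HasDerivWithinAt y (A x (y x)) (Icc 0 s) x)
    (hz : ∀ x ∈ Icc 0 s, HasDerivWithinAt z (A x (z x)) (Icc 0 s) x) (h0 : y 0 = z 0) :
    EqOn y z (Icc 0 s) := by
  obtain ⟨k, hk0, hk⟩ := exists_norm_le_Icc A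
  have hIci : ∀ x ∈ Ico 0 s, 𝓝[≥] x ≤ 𝓝[Icc 0 s] x := fun x hx => by
    refine le_inf inf_le_left (le_principal_iff.2 ?_)
    filter_upwards [Ico_mem_nhdsGE hx.2] with u hu
    exact ⟨hx.1.trans hu.1, hu.2.le⟩
  refine ODE_solution_unique_of_mem_Icc_right (v := fun x y => A x y) (s := fun _ => univ)
    (K := ⟨k, hk0.le⟩) (fun t ht => ?_) (fun x hx => (hy x hx).continuousWithinAt)
    (fun t ht => ?_) (fun _ _ => mem_univ _)
    (fun x hx => (hz x hx).continuousWithinAt) (fun t ht => ?_) (fun _ _ => mem_univ _) h0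
  · refine LipschitzWith.lipschitzOnWith (LipschitzWith.of_dist_le_mul fun u w => ?_)
    rw [dist_eq_norm, dist_eq_norm, ← map_sub]
    exact (A t).le_of_opNorm_le (hk t ⟨ht.1, ht.2.le.trans hs⟩) _
  · exact (hy t (Ico_subset_Icc_self ht)).mono_of_mem_nhdsWithin (hIci t ht self_mem_nhdsWithin)
  · exact (hz t (Ico_subset_Icc_self ht)).mono_of_mem_nhdsWithin (hIci t ht self_mem_nhdsWithin)

/-- The fundamental solution depends continuously on a parameter, uniformly on `[0, 1]`. -/
lemma tendstoUniformlyOn_fundamentalSolution (A : ℝ → C(ℝ, F →L[ℝ] F)) {t₀ : ℝ}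
    (hA : ∀ t x, ‖A t x - A t₀ x‖ ≤ |t - t₀|) :
    TendstoUniformlyOn (fun t => fundamentalSolution (A t)) (fundamentalSolution (A t₀)) (𝓝 t₀)
      (Icc (0 : ℝ) 1) := by
  obtain ⟨k, hk0, hk⟩ := exists_norm_le_Icc (A t₀)
  have hcont : ∀ t, ContinuousOn (fundamentalSolution (A t)) (Icc (0 : ℝ) 1) := fun t x hx =>
    (hasDerivAt_fundamentalSolution (A t) hx).continuousAt.continuousWithinAt
  obtain ⟨C, hC⟩ := isCompact_Icc.exists_bound_of_continuousOn (hcont t₀)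
  have hC0 : 0 ≤ C := (norm_nonneg _).trans (hC 0 (by simp))
  have hbd : ∀ t, |t - t₀| < 1 → ∀ x ∈ Icc (0 : ℝ) 1,
      dist (fundamentalSolution (A t) x) (fundamentalSolution (A t₀) x) ≤
        gronwallBound 0 (k + 1) (|t - t₀| * C) 1 := by
    intro t ht x hx
    have hAt : ∀ x ∈ Icc (0 : ℝ) 1, ‖A t x‖ ≤ k + 1 := fun x hx => by
      have := norm_add_le (A t₀ x) (A t x - A t₀ x)
      rw [add_sub_cancel] at this
      linarith [hk x hx, hA t x]
    -- The solution for `t₀` solves the equation for `t` up to a defect of at most `|t - t₀| * C`;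
    -- Grönwall's inequality turns this into a distance.
    have h := dist_le_of_approx_trajectories_ODE_of_mem (a := 0) (b := 1)
      (v := fun x (y : F →L[ℝ] F) => A t x * y)
      (K := ⟨k + 1, by positivity⟩) (s := fun _ => univ) (f := fundamentalSolution (A t))
      (g := fundamentalSolution (A t₀)) (f' := fun x => A t x * fundamentalSolution (A t) x)
      (g' := fun x => A t₀ x * fundamentalSolution (A t₀) x) (δ := 0) (εf := 0)
      (εg := |t - t₀| * C) (fun x hx => ?_) (hcont t)
      (fun x hx => (hasDerivAt_fundamentalSolution (A t) (Ico_subset_Icc_self hx)).hasDerivWithinAt)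
      (fun x hx => by simp) (fun _ _ => mem_univ _) (hcont t₀)
      (fun x hx => (hasDerivAt_fundamentalSolution (A t₀) (Ico_subset_Icc_self hx)).hasDerivWithinAt)
      (fun x hx => ?_) (fun _ _ => mem_univ _)
      (by rw [fundamentalSolution_zero, fundamentalSolution_zero, dist_self]) x hx
    · refine h.trans ?_
      rw [zero_add, sub_zero]
      exact gronwallBound_mono le_rfl (mul_nonneg (abs_nonneg _) hC0)
        (show (0 : ℝ) ≤ k + 1 by positivity) hx.2
    · refine LipschitzWith.lipschitzOnWith (LipschitzWith.of_dist_le_mul fun u w => ?_)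
      rw [dist_eq_norm, dist_eq_norm, ← mul_sub]
      refine (norm_mul_le _ _).trans ?_
      gcongr
      exact hAt x (Ico_subset_Icc_self hx)
    · rw [dist_comm, dist_eq_norm, ← sub_mul]
      refine (norm_mul_le _ _).trans ?_
      gcongr
      · exact hA t x
      · exact hC x (Ico_subset_Icc_self hx)
  have hlim : Tendsto (fun t => gronwallBound 0 (k + 1) (|t - t₀| * C) 1) (𝓝 t₀) (𝓝 0) := by
    have h1 : Continuous fun t => gronwallBound 0 (k + 1) (|t - t₀| * C) 1 :=
      (gronwallBound_continuous_ε 0 (k + 1) 1).comp (by fun_prop)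
    have h2 := h1.tendsto t₀
    simpa [gronwallBound_ε0_δ0] using h2
  rw [Metric.tendstoUniformlyOn_iff]
  intro ε hε
  filter_upwards [hlim.eventually (gt_mem_nhds hε), Metric.ball_mem_nhds t₀ one_pos] with t h1 h2 x hx
  rw [dist_comm]
  exact (hbd t (by rwa [Metric.mem_ball, Real.dist_eq] at h2) x hx).trans_lt h1

end LinearODE

end

end MaslovMorse

namespace MaslovMorse

noncomputable section

open Topology Filter Set Module

/-! ### Solutions satisfying the boundary condition at 0, and the Lagrange identity. -/

section Schrodinger

variable {E : Type*} [NormedAddCommGroup E] [InnerProductSpace ℝ E]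

/-- A self-adjoint boundary condition `y ∈ K`, `y' - L y ⊥ K`, with a symmetric operator `L` that
maps into `K`. -/
structure RobinBC (E : Type*) [NormedAddCommGroup E] [InnerProductSpace ℝ E] where
  /-- The space of admissible values. -/
  K : Submodule ℝ E
  /-- The Robin operator. -/
  L : E →L[ℝ] E
  symm : ∀ x y, inner ℝ (L x) y = inner ℝ x (L y)
  mem : ∀ x, L x ∈ K

/-- The vectors `(y, y')` satisfy the boundary condition. -/
def RobinBC.Holds (b : RobinBC E) (y y' : E) : Prop :=
  y ∈ b.K ∧ ∀ k ∈ b.K, inner ℝ (y' - b.L y) k = 0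

/-- Each derivative may be replaced by its Robin part when paired with an element of `K`, and then
symmetry of `L` cancels the two terms. This removes the boundary term at 0 from the Lagrange
identity. -/
lemma RobinBC.Holds.isotropic {b : RobinBC E} {y y' z z' : E} (hy : b.Holds y y')
    (hz : b.Holds z z') : inner ℝ y z' - inner ℝ y' z = 0 := by
  have h1 := hy.2 z hz.1
  have h2 := hz.2 y hy.1
  rw [inner_sub_left] at h1 h2
  rw [real_inner_comm y z', ← b.symm y z |>.trans (real_inner_comm _ _)] at h2
  linarith

/-- The first order system of the equation `p'' = (V - λ) p`. -/
def schrodingerField (V : C(ℝ, E →L[ℝ] E)) (lam : ℝ) : C(ℝ, (E × E) →L[ℝ] (E × E)) where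
  toFun x := (ContinuousLinearMap.inl ℝ E E).comp (ContinuousLinearMap.snd ℝ E E) +
    (ContinuousLinearMap.inr ℝ E E).comp ((V x - lam • ContinuousLinearMap.id ℝ E).comp
      (ContinuousLinearMap.fst ℝ E E))
  continuous_toFun := by
    have := V.continuous
    fun_prop

lemma schrodingerField_apply (V : C(ℝ, E →L[ℝ] E)) (lam x : ℝ) (z : E × E) :
    schrodingerField V lam x z = (z.2, V x z.1 - lam • z.1) := by
  simp [schrodingerField]

lemma schrodingerField_sub (V : C(ℝ, E →L[ℝ] E)) (lam lam₀ x : ℝ) :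
    ‖schrodingerField V lam x - schrodingerField V lam₀ x‖ ≤ |lam - lam₀| := by
  refine ContinuousLinearMap.opNorm_le_bound _ (abs_nonneg _) fun z => ?_
  rw [sub_apply, schrodingerField_apply, schrodingerField_apply]
  have : ((z.2, V x z.1 - lam • z.1) : E × E) - (z.2, V x z.1 - lam₀ • z.1) =
      (0, -((lam - lam₀) • z.1)) := by
    ext <;> simp [sub_smul]
  rw [this, Prod.norm_def]
  simp only [norm_zero, norm_neg, norm_smul, Real.norm_eq_abs]
  rw [max_eq_right (by positivity)]
  gcongr
  exact norm_fst_le z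

/-- The Lagrange identity. -/
lemma lagrange_identity {V : C(ℝ, E →L[ℝ] E)} (hV : ∀ x y z, inner ℝ (V x y) z = inner ℝ y (V x z))
    {s : ℝ} (hs : 0 ≤ s) {l₁ l₂ : ℝ} {p₁ q₁ p₂ q₂ : ℝ → E}
    (hp₁ : ∀ x ∈ Icc 0 s, HasDerivAt p₁ (q₁ x) x)
    (hq₁ : ∀ x ∈ Icc 0 s, HasDerivAt q₁ (V x (p₁ x) - l₁ • p₁ x) x)
    (hp₂ : ∀ x ∈ Icc 0 s, HasDerivAt p₂ (q₂ x) x)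
    (hq₂ : ∀ x ∈ Icc 0 s, HasDerivAt q₂ (V x (p₂ x) - l₂ • p₂ x) x) :
    inner ℝ (p₁ s) (q₂ s) - inner ℝ (q₁ s) (p₂ s) =
      inner ℝ (p₁ 0) (q₂ 0) - inner ℝ (q₁ 0) (p₂ 0) +
        (l₁ - l₂) * ∫ x in (0 : ℝ)..s, inner ℝ (p₁ x) (p₂ x) := by
  have hd : ∀ x ∈ uIcc 0 s, HasDerivAt (fun x => inner ℝ (p₁ x) (q₂ x) - inner ℝ (q₁ x) (p₂ x))
      ((l₁ - l₂) * inner ℝ (p₁ x) (p₂ x)) x := by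
    intro x hx
    rw [uIcc_of_le hs] at hx
    refine (((hp₁ x hx).inner ℝ (hq₂ x hx)).sub ((hq₁ x hx).inner ℝ (hp₂ x hx))).congr_deriv ?_
    simp only [inner_sub_right, inner_sub_left, inner_smul_left, inner_smul_right, hV x,
      conj_trivial]
    ring
  have hc : ∀ {p q : ℝ → E}, (∀ x ∈ Icc 0 s, HasDerivAt p (q x) x) → ContinuousOn p (uIcc 0 s) :=
    fun h x hx => (h x (by rwa [uIcc_of_le hs] at hx)).continuousAt.continuousWithinAt
  have := intervalIntegral.integral_eq_sub_of_hasDerivAt hd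
    (ContinuousOn.intervalIntegrable (continuousOn_const.mul ((hc hp₁).inner (hc hp₂))))
  rw [intervalIntegral.integral_const_mul] at this
  rw [this]
  ring

variable [FiniteDimensional ℝ E]

/-- The values of the vectors satisfying the boundary condition, as a function of a parameter. -/
def RobinBC.fst (b : RobinBC E) : E →L[ℝ] E := b.K.starProjection

/-- The derivatives of the vectors satisfying the boundary condition, as a function of a
parameter. -/
def RobinBC.snd (b : RobinBC E) : E →L[ℝ] E :=
  b.L + (ContinuousLinearMap.id ℝ E - b.K.starProjection)

/-- A symmetric operator with range in `K` kills the orthogonal complement of `K`: `⟪L w, L w⟫ = ⟪w,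
L (L w)⟫ = 0`. -/
lemma RobinBC.map_orthogonal (b : RobinBC E) {w : E} (hw : ∀ k ∈ b.K, inner ℝ w k = 0) :
    b.L w = 0 := by
  rw [← inner_self_eq_zero (𝕜 := ℝ), b.symm]
  exact hw _ (b.mem _)

lemma RobinBC.sub_starProjection (b : RobinBC E) (c : E) :
    ∀ k ∈ b.K, inner ℝ (c - b.K.starProjection c) k = 0 := fun k hk => by
  rw [real_inner_comm]
  exact Submodule.sub_starProjection_mem_orthogonal c k hk

lemma RobinBC.map_fst (b : RobinBC E) (c : E) : b.L (b.fst c) = b.L c := by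
  have := b.map_orthogonal (b.sub_starProjection c)
  rw [map_sub, sub_eq_zero] at this
  exact this.symm

lemma RobinBC.holds_param (b : RobinBC E) (c : E) : b.Holds (b.fst c) (b.snd c) := by
  refine ⟨Submodule.starProjection_apply_mem _ _, fun k hk => ?_⟩
  rw [b.map_fst]
  simp only [RobinBC.snd, add_apply, sub_apply,
    ContinuousLinearMap.id_apply, add_sub_cancel_left]
  exact b.sub_starProjection c k hk

/-- The parameter is `y + (y' - L y)`: its component in `K` is the value `y`, its orthogonal
component is the free part of the derivative. -/
lemma RobinBC.Holds.exists_param {b : RobinBC E} {y y' : E} (h : b.Holds y y') :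
    ∃ c, b.fst c = y ∧ b.snd c = y' := by
  have h1 : b.fst (y + (y' - b.L y)) = y := by
    rw [RobinBC.fst, map_add, Submodule.starProjection_eq_self_iff.2 h.1,
      (Submodule.starProjection_apply_eq_zero_iff _).2, add_zero]
    intro k hk
    rw [real_inner_comm]
    exact h.2 k hk
  refine ⟨y + (y' - b.L y), h1, ?_⟩
  have h2 : b.K.starProjection (y + (y' - b.L y)) = y := h1
  simp only [RobinBC.snd, add_apply, sub_apply,
    ContinuousLinearMap.id_apply, h2]
  rw [map_add, b.map_orthogonal h.2]
  abel

lemma RobinBC.param_injective (b : RobinBC E) {c : E} (h1 : b.fst c = 0) (h2 : b.snd c = 0) :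
    c = 0 := by
  have h3 : b.L c = 0 := by rw [← b.map_fst, h1, map_zero]
  have h4 : b.K.starProjection c = 0 := h1
  simpa [RobinBC.snd, h3, h4] using h2

/-- The solutions `(p, q)` of `p' = q`, `q' = (V - λ) p` that satisfy the boundary condition `b`
at `0`, as a function of a parameter. -/
def sol (V : C(ℝ, E →L[ℝ] E)) (b : RobinBC E) (lam x : ℝ) : E →L[ℝ] E × E :=
  (fundamentalSolution (schrodingerField V lam) x).comp (b.fst.prod b.snd)

/-- The first component `p` of `sol`. -/
def solP (V : C(ℝ, E →L[ℝ] E)) (b : RobinBC E) (lam x : ℝ) : E →L[ℝ] E :=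
  (ContinuousLinearMap.fst ℝ E E).comp (sol V b lam x)

/-- The second component `q` of `sol`. -/
def solQ (V : C(ℝ, E →L[ℝ] E)) (b : RobinBC E) (lam x : ℝ) : E →L[ℝ] E :=
  (ContinuousLinearMap.snd ℝ E E).comp (sol V b lam x)

variable (V : C(ℝ, E →L[ℝ] E)) (b : RobinBC E)

lemma solP_zero (lam : ℝ) : solP V b lam 0 = b.fst := by
  ext c; simp [solP, sol, fundamentalSolution_zero]

lemma solQ_zero (lam : ℝ) : solQ V b lam 0 = b.snd := by
  ext c; simp [solQ, sol, fundamentalSolution_zero]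

lemma hasDerivAt_sol (lam : ℝ) (c : E) {x : ℝ} (hx : x ∈ Icc (0 : ℝ) 1) :
    HasDerivAt (fun x => sol V b lam x c) (schrodingerField V lam x (sol V b lam x c)) x :=
  (hasDerivAt_fundamentalSolution (schrodingerField V lam) hx).clm_apply
    (hasDerivAt_const x (b.fst.prod b.snd c)) |>.congr_deriv (by simp [sol])

lemma hasDerivAt_solP (lam : ℝ) (c : E) {x : ℝ} (hx : x ∈ Icc (0 : ℝ) 1) :
    HasDerivAt (fun x => solP V b lam x c) (solQ V b lam x c) x := by
  have := (ContinuousLinearMap.fst ℝ E E).hasFDerivAt.comp_hasDerivAt x (hasDerivAt_sol V b lam c hx)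
  rw [schrodingerField_apply] at this
  exact this

lemma hasDerivAt_solQ (lam : ℝ) (c : E) {x : ℝ} (hx : x ∈ Icc (0 : ℝ) 1) :
    HasDerivAt (fun x => solQ V b lam x c) (V x (solP V b lam x c) - lam • solP V b lam x c) x := by
  have := (ContinuousLinearMap.snd ℝ E E).hasFDerivAt.comp_hasDerivAt x (hasDerivAt_sol V b lam c hx)
  rw [schrodingerField_apply] at this
  exact this

lemma continuousOn_solP (lam : ℝ) (c : E) : ContinuousOn (fun x => solP V b lam x c) (Icc 0 1) :=
  fun _ hx => (hasDerivAt_solP V b lam c hx).continuousAt.continuousWithinAt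

lemma continuousOn_solQ (lam : ℝ) (c : E) : ContinuousOn (fun x => solQ V b lam x c) (Icc 0 1) :=
  fun _ hx => (hasDerivAt_solQ V b lam c hx).continuousAt.continuousWithinAt

/-- Every solution on `[0, s]` satisfying the boundary condition at `0` is one of `sol`. -/
lemma exists_eq_sol {s lam : ℝ} (hs1 : s ≤ 1) {p q : ℝ → E}
    (hp : ∀ x ∈ Icc 0 s, HasDerivWithinAt p (q x) (Icc 0 s) x)
    (hq : ∀ x ∈ Icc 0 s, HasDerivWithinAt q (V x (p x) - lam • p x) (Icc 0 s) x)
    (h0 : b.Holds (p 0) (q 0)) :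
    ∃ c, ∀ x ∈ Icc 0 s, p x = solP V b lam x c ∧ q x = solQ V b lam x c := by
  obtain ⟨c, hc1, hc2⟩ := h0.exists_param
  have h := linear_ode_unique (schrodingerField V lam) hs1 (y := fun x => (p x, q x))
    (z := fun x => sol V b lam x c) (fun x hx => by
      rw [schrodingerField_apply]
      exact (hp x hx).prodMk (hq x hx))
    (fun x hx => (hasDerivAt_sol V b lam c ⟨hx.1, hx.2.trans hs1⟩).hasDerivWithinAt)
    (by simp [sol, fundamentalSolution_zero, hc1, hc2])
  exact ⟨c, fun x hx => ⟨congrArg Prod.fst (h hx), congrArg Prod.snd (h hx)⟩⟩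

lemma tendstoUniformlyOn_solP (lam₀ : ℝ) (c : E) :
    TendstoUniformlyOn (fun lam x => solP V b lam x c) (fun x => solP V b lam₀ x c) (𝓝 lam₀)
      (Icc 0 1) := by
  have h := tendstoUniformlyOn_fundamentalSolution (schrodingerField V) (t₀ := lam₀)
    fun t x => schrodingerField_sub V t lam₀ x
  have hu : UniformContinuous fun Φ : (E × E) →L[ℝ] (E × E) => (Φ (b.fst c, b.snd c)).1 :=
    ((ContinuousLinearMap.fst ℝ E E).comp
      (ContinuousLinearMap.apply ℝ (E × E) (b.fst c, b.snd c))).uniformContinuous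
  exact hu.comp_tendstoUniformlyOn h

lemma continuous_sol {x : ℝ} (hx : x ∈ Icc (0 : ℝ) 1) : Continuous fun lam => sol V b lam x := by
  refine continuous_iff_continuousAt.2 fun lam₀ => ?_
  have h := (tendstoUniformlyOn_fundamentalSolution (schrodingerField V) (t₀ := lam₀)
    fun t x => schrodingerField_sub V t lam₀ x).tendsto_at hx
  exact ((continuous_id.clm_comp continuous_const).tendsto _).comp h

lemma continuous_solP {x : ℝ} (hx : x ∈ Icc (0 : ℝ) 1) : Continuous fun lam => solP V b lam x :=
  continuous_const.clm_comp (continuous_sol V b hx)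

lemma continuous_solQ {x : ℝ} (hx : x ∈ Icc (0 : ℝ) 1) : Continuous fun lam => solQ V b lam x :=
  continuous_const.clm_comp (continuous_sol V b hx)

lemma intervalIntegrable_inner_solP {s : ℝ} (hs : s ∈ Ioc (0 : ℝ) 1) (l₁ l₂ : ℝ) (c c' : E) :
    IntervalIntegrable (fun x => inner ℝ (solP V b l₁ x c) (solP V b l₂ x c')) volume 0 s := by
  refine ContinuousOn.intervalIntegrable ?_
  rw [uIcc_of_le hs.1.le]
  exact ((continuousOn_solP V b l₁ c).inner (continuousOn_solP V b l₂ c')).mono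
    (Icc_subset_Icc_right hs.2)

/-- The `L²`-pairing on `[0, s]` of solutions for two values of the spectral parameter. -/
def solPairing {s : ℝ} (hs : s ∈ Ioc (0 : ℝ) 1) (l₁ l₂ : ℝ) : LinearMap.BilinForm ℝ E :=
  LinearMap.mk₂ ℝ (fun c c' => ∫ x in (0 : ℝ)..s, inner ℝ (solP V b l₁ x c) (solP V b l₂ x c'))
    (fun c c' d => by
      simp only [map_add, inner_add_left]
      exact intervalIntegral.integral_add (intervalIntegrable_inner_solP V b hs _ _ _ _)
        (intervalIntegrable_inner_solP V b hs _ _ _ _))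
    (fun r c c' => by
      simp only [map_smul, inner_smul_left, conj_trivial]
      exact intervalIntegral.integral_const_mul _ _)
    (fun c c' d => by
      simp only [map_add, inner_add_right]
      exact intervalIntegral.integral_add (intervalIntegrable_inner_solP V b hs _ _ _ _)
        (intervalIntegrable_inner_solP V b hs _ _ _ _))
    (fun r c c' => by
      simp only [map_smul, inner_smul_right]
      exact intervalIntegral.integral_const_mul _ _)

lemma solPairing_apply {s : ℝ} (hs : s ∈ Ioc (0 : ℝ) 1) (l₁ l₂ : ℝ) (c c' : E) :
    solPairing V b hs l₁ l₂ c c' =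
      ∫ x in (0 : ℝ)..s, inner ℝ (solP V b l₁ x c) (solP V b l₂ x c') := rfl

/-- If `p` vanishes on `[0, s]`, so does `q 0 = p' 0`, and the initial data determine the parameter.
-/
lemma sol_eq_zero_of_solP {s : ℝ} (hs : s ∈ Ioc (0 : ℝ) 1) (lam : ℝ) {c : E}
    (h : ∀ x ∈ Icc 0 s, solP V b lam x c = 0) : c = 0 := by
  have h00 : (0 : ℝ) ∈ Icc (0 : ℝ) s := ⟨le_rfl, hs.1.le⟩
  have h1 := (hasDerivAt_solP V b lam c (x := 0) (by simp)).hasDerivWithinAt (s := Icc 0 s)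
  have h2 : HasDerivWithinAt (fun x => solP V b lam x c) 0 (Icc 0 s) 0 :=
    (hasDerivWithinAt_const (0 : ℝ) (Icc 0 s) (0 : E)).congr h (h 0 h00)
  have h3 := (uniqueDiffOn_Icc hs.1 0 h00).eq_deriv _ h1 h2
  have h4 := h 0 h00
  rw [solP_zero] at h4
  rw [solQ_zero] at h3
  exact b.param_injective h4 h3

lemma solPairing_self_pos {s : ℝ} (hs : s ∈ Ioc (0 : ℝ) 1) (lam : ℝ) {c : E} (hc : c ≠ 0) :
    0 < solPairing V b hs lam lam c c := by
  rw [solPairing_apply]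
  obtain ⟨x, hx, hne⟩ : ∃ x ∈ Icc 0 s, solP V b lam x c ≠ 0 := by
    by_contra! h
    exact hc (sol_eq_zero_of_solP V b hs lam h)
  refine intervalIntegral.integral_pos hs.1 ?_ (fun x _ => real_inner_self_nonneg)
    ⟨x, hx, real_inner_self_pos.2 hne⟩
  have := (continuousOn_solP V b lam c).mono (Icc_subset_Icc_right hs.2)
  exact this.inner this

/-- Continuity in the second parameter alone suffices, because the jump arguments keep the first
parameter at the base point. -/
lemma continuous_solPairing {s : ℝ} (hs : s ∈ Ioc (0 : ℝ) 1) (l₁ : ℝ) (c c' : E) :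
    Continuous fun l₂ => solPairing V b hs l₁ l₂ c c' := by
  refine continuous_iff_continuousAt.2 fun l₂ => ?_
  obtain ⟨C, hC⟩ := isCompact_Icc.exists_bound_of_continuousOn (continuousOn_solP V b l₁ c)
  have hC0 : 0 ≤ C := (norm_nonneg _).trans (hC 0 (by simp))
  have hu : TendstoUniformlyOn (fun l₂ x => inner ℝ (solP V b l₁ x c) (solP V b l₂ x c'))
      (fun x => inner ℝ (solP V b l₁ x c) (solP V b l₂ x c')) (𝓝 l₂) (uIcc 0 s) := by
    rw [Metric.tendstoUniformlyOn_iff]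
    intro ε hε
    have := Metric.tendstoUniformlyOn_iff.1 (tendstoUniformlyOn_solP V b l₂ c') (ε / (C + 1))
      (by positivity)
    filter_upwards [this] with l hl x hx
    rw [uIcc_of_le hs.1.le] at hx
    have hx1 : x ∈ Icc (0 : ℝ) 1 := ⟨hx.1, hx.2.trans hs.2⟩
    rw [dist_eq_norm, ← inner_sub_right]
    have h1 := hl x hx1
    rw [dist_eq_norm] at h1
    calc ‖inner ℝ (solP V b l₁ x c) (solP V b l₂ x c' - solP V b l x c')‖
        ≤ ‖solP V b l₁ x c‖ * ‖solP V b l₂ x c' - solP V b l x c'‖ := norm_inner_le_norm _ _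
      _ ≤ C * (ε / (C + 1)) := by gcongr; exact hC x hx1
      _ < (C + 1) * (ε / (C + 1)) := by gcongr; linarith
      _ = ε := by field_simp
  refine hu.tendsto_intervalIntegral_of_continuousOn (Eventually.of_forall fun l => ?_)
  rw [uIcc_of_le hs.1.le]
  exact ((continuousOn_solP V b l₁ c).inner (continuousOn_solP V b l c')).mono
    (Icc_subset_Icc_right hs.2)

variable {V} in
lemma lagrange_identity_sol (hV : ∀ x y z, inner ℝ (V x y) z = inner ℝ y (V x z))
    {s : ℝ} (hs : s ∈ Ioc (0 : ℝ) 1) (l₁ l₂ : ℝ) (c c' : E) :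
    inner ℝ (solP V b l₁ s c) (solQ V b l₂ s c') - inner ℝ (solQ V b l₁ s c) (solP V b l₂ s c') =
      (l₁ - l₂) * solPairing V b hs l₁ l₂ c c' := by
  have hx : ∀ {x}, x ∈ Icc 0 s → x ∈ Icc (0 : ℝ) 1 := fun h => ⟨h.1, h.2.trans hs.2⟩
  rw [lagrange_identity hV hs.1.le (fun x h => hasDerivAt_solP V b l₁ c (hx h))
    (fun x h => hasDerivAt_solQ V b l₁ c (hx h)) (fun x h => hasDerivAt_solP V b l₂ c' (hx h))
    (fun x h => hasDerivAt_solQ V b l₂ c' (hx h))]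
  rw [solP_zero, solQ_zero, solP_zero, solQ_zero,
    (b.holds_param c).isotropic (b.holds_param c'), zero_add, solPairing_apply]

variable {V} in
/-- The values at `s` determine the solution. -/
lemma sol_injective (hV : ∀ x y z, inner ℝ (V x y) z = inner ℝ y (V x z)) {s : ℝ}
    (hs : s ∈ Ioc (0 : ℝ) 1) (lam : ℝ) {c : E} (h1 : solP V b lam s c = 0)
    (h2 : solQ V b lam s c = 0) : c = 0 := by
  by_contra hc
  have := solPairing_self_pos V b hs lam hc
  have hcont := (continuous_solPairing V b hs lam c c)
  -- With vanishing data at `s` the Lagrange identity makes the pairing with every other parameter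
  -- `l` vanish; letting `l → lam` contradicts positivity of the `L²` norm.
  have h0 : ∀ l, l ≠ lam → solPairing V b hs lam l c c = 0 := fun l hl => by
    have h := lagrange_identity_sol b hV hs lam l c c
    rw [h1, h2, inner_zero_left, inner_zero_left, sub_zero] at h
    exact (mul_eq_zero.1 h.symm).resolve_left (sub_ne_zero.2 hl.symm)
  have h3 : Tendsto (fun l => solPairing V b hs lam l c c) (𝓝[≠] lam) (𝓝 0) :=
    tendsto_const_nhds.congr' (by
      filter_upwards [self_mem_nhdsWithin] with l hl using (h0 l hl).symm)
  have h4 := tendsto_nhds_unique h3 ((hcont.tendsto lam).mono_left nhdsWithin_le_nhds)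
  exact this.ne h4

end Schrodinger

end

end MaslovMorse

namespace MaslovMorse

noncomputable section

open Topology Filter Set Module

/-! ### Quadratic forms of Lagrangian subspaces in a chart. -/

section Chart

variable {E : Type*} [NormedAddCommGroup E] [InnerProductSpace ℝ E] [FiniteDimensional ℝ E]

/-- The quadratic form of `D T⁻¹` on the subspace `K`. -/
def chartForm (T D : E →L[ℝ] E) (K : Submodule ℝ E) : QuadraticForm ℝ K :=
  (opForm (D * Ring.inverse T).toLinearMap).restrict K

lemma chartForm_apply (T D : E →L[ℝ] E) (K : Submodule ℝ E) (y : K) :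
    chartForm T D K y = inner ℝ (D (Ring.inverse T y)) (y : E) := rfl

/-- The parameters `c` with `T c ∈ K` and `D c ⊥ K`. -/
def crossSpace (T D : E →L[ℝ] E) (K : Submodule ℝ E) : Submodule ℝ E where
  carrier := {c | T c ∈ K ∧ ∀ k ∈ K, inner ℝ (D c) k = 0}
  add_mem' := by
    rintro c d ⟨h1, h2⟩ ⟨h3, h4⟩
    refine ⟨by rw [map_add]; exact K.add_mem h1 h3, fun k hk => ?_⟩
    rw [map_add, inner_add_left, h2 k hk, h4 k hk, add_zero]
  zero_mem' := by simp
  smul_mem' := by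
    rintro r c ⟨h1, h2⟩
    refine ⟨by rw [map_smul]; exact K.smul_mem r h1, fun k hk => ?_⟩
    rw [map_smul, inner_smul_left, h2 k hk, mul_zero]

lemma mem_crossSpace {T D : E →L[ℝ] E} {K : Submodule ℝ E} {c : E} :
    c ∈ crossSpace T D K ↔ T c ∈ K ∧ ∀ k ∈ K, inner ℝ (D c) k = 0 := Iff.rfl

lemma isUnit_of_injective {T : E →L[ℝ] E} (h : ∀ c, T c = 0 → c = 0) : IsUnit T := by
  have hinj : Function.Injective T := (injective_iff_map_eq_zero T).2 h
  have hT : IsUnit (T : E →ₗ[ℝ] E) := by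
    rw [Module.End.isUnit_iff]
    exact ⟨hinj, LinearMap.injective_iff_surjective.1 hinj⟩
  exact ContinuousLinearMap.isUnit_iff_bijective.2
    ⟨hinj, LinearMap.injective_iff_surjective (f := (T : E →ₗ[ℝ] E)).1 hinj⟩

lemma apply_inverse_apply {T : E →L[ℝ] E} (h : IsUnit T) (y : E) : T (Ring.inverse T y) = y :=
  DFunLike.congr_fun (Ring.mul_inverse_cancel T h) y

lemma inverse_apply_apply {T : E →L[ℝ] E} (h : IsUnit T) (y : E) : Ring.inverse T (T y) = y :=
  DFunLike.congr_fun (Ring.inverse_mul_cancel T h) y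

lemma isSymmetric_mul_inverse {T D : E →L[ℝ] E} (hT : IsUnit T)
    (hs : ∀ w w', inner ℝ (D w) (T w') = inner ℝ (T w) (D w')) :
    (D * Ring.inverse T).toLinearMap.IsSymmetric := fun x y => by
  have := hs (Ring.inverse T x) (Ring.inverse T y)
  rwa [apply_inverse_apply hT, apply_inverse_apply hT] at this

lemma mem_radical_chartForm {T D : E →L[ℝ] E} {K : Submodule ℝ E} (hT : IsUnit T)
    (hs : ∀ w w', inner ℝ (D w) (T w') = inner ℝ (T w) (D w')) {y : K} :
    y ∈ (chartForm T D K).radical ↔ ∀ k ∈ K, inner ℝ (D (Ring.inverse T y)) k = 0 := by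
  have hsymm := isSymmetric_mul_inverse hT hs
  have hadd : ∀ k : K, chartForm T D K (y + k) = chartForm T D K y +
      2 * inner ℝ (D (Ring.inverse T y)) (k : E) + chartForm T D K k := by
    intro k
    simp only [chartForm_apply, Submodule.coe_add, map_add, inner_add_left, inner_add_right]
    have : inner ℝ (D (Ring.inverse T k)) (y : E) = inner ℝ (D (Ring.inverse T y)) (k : E) :=
      (hsymm k y).trans (real_inner_comm _ _)
    rw [this]
    ring
  rw [QuadraticMap.mem_radical_iff']
  constructor
  · rintro ⟨h0, h1⟩ k hk
    have := hadd ⟨k, hk⟩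
    rw [h1, h0] at this
    simpa using this
  · intro h
    have h0 : chartForm T D K y = 0 := h y y.2
    refine ⟨h0, fun k => ?_⟩
    rw [hadd, h0, h k k.2]
    ring

/-- `T` maps the crossing space bijectively onto the radical: for `y = T c` in `K`, the polar form
of `y` with `k` is `⟪D c, k⟫`. -/
lemma finrank_radical_chartForm {T D : E →L[ℝ] E} {K : Submodule ℝ E} (hT : IsUnit T)
    (hs : ∀ w w', inner ℝ (D w) (T w') = inner ℝ (T w) (D w')) :
    finrank ℝ (chartForm T D K).radical = finrank ℝ (crossSpace T D K) := by
  have hinj : Function.Injective (T : E →ₗ[ℝ] E) := fun x y h => by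
    rw [← inverse_apply_apply hT x, ← inverse_apply_apply hT y]
    exact congrArg _ h
  rw [(Submodule.equivMapOfInjective (T : E →ₗ[ℝ] E) hinj (crossSpace T D K)).finrank_eq,
    (Submodule.equivMapOfInjective K.subtype K.subtype_injective
      (chartForm T D K).radical).finrank_eq]
  suffices h : Submodule.map K.subtype (chartForm T D K).radical =
      Submodule.map (T : E →ₗ[ℝ] E) (crossSpace T D K) by rw [h]
  ext y
  simp only [Submodule.mem_map]
  constructor
  · rintro ⟨y, hy, rfl⟩
    refine ⟨Ring.inverse T y, ?_, apply_inverse_apply hT y⟩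
    rw [mem_crossSpace, apply_inverse_apply hT]
    exact ⟨y.2, (mem_radical_chartForm hT hs).1 hy⟩
  · rintro ⟨c, hc, rfl⟩
    refine ⟨⟨T c, hc.1⟩, (mem_radical_chartForm hT hs).2 ?_, rfl⟩
    change ∀ k ∈ K, inner ℝ (D (Ring.inverse T (T c))) k = 0
    rw [inverse_apply_apply hT]
    exact hc.2

/-- The jumps of the negative index along a path of Lagrangian subspaces that is decreasing in the
chart `(T, D)`. -/
lemma eventually_sigNeg_chartForm {I : Set ℝ} {T D : ℝ → E →L[ℝ] E} {K : Submodule ℝ E} {κ : ℝ}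
    {H : ℝ → ℝ → LinearMap.BilinForm ℝ E} (hκ : 0 < κ) (hT : ContinuousOn T I)
    (hTu : ∀ t ∈ I, IsUnit (T t)) (hs : ∀ t w w', inner ℝ (D t w) (T t w') = inner ℝ (T t w) (D t w'))
    (hH : ∀ t₁ c c', Continuous fun t₂ => H t₁ t₂ c c') (hHpos : ∀ t c, c ≠ 0 → 0 < H t t c c)
    (hid : ∀ t₁ t₂ w₁ w₂, T t₁ w₁ = T t₂ w₂ → inner ℝ (D t₂ w₂) (T t₂ w₂) -
      inner ℝ (D t₁ w₁) (T t₁ w₁) = κ * ((t₁ - t₂) * H t₁ t₂ w₁ w₂)) {t₀ : ℝ} (ht₀ : t₀ ∈ I) :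
    ∀ᶠ t in 𝓝[I] t₀, (t ≤ t₀ → sigNeg (chartForm (T t) (D t) K) =
        sigNeg (chartForm (T t₀) (D t₀) K)) ∧
      (t₀ < t → sigNeg (chartForm (T t) (D t) K) =
        sigNeg (chartForm (T t₀) (D t₀) K) + finrank ℝ (crossSpace (T t₀) (D t₀) K)) := by
  let R : ℝ → E →L[ℝ] E := fun t => Ring.inverse (T t)
  have hR : Tendsto R (𝓝[I] t₀) (𝓝 (R t₀)) := by
    obtain ⟨u, hu⟩ := hTu t₀ ht₀
    have h1 := NormedRing.inverse_continuousAt u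
    rw [hu] at h1
    exact h1.tendsto.comp (hT t₀ ht₀)
  -- The pairing is taken between the parameters at `t₀` and at `t` that have the same value `y`
  -- under `T`. The hypothesis `hid` then expresses the difference of the two forms exactly, with no
  -- derivative in `t`.
  let G : ℝ → LinearMap.BilinForm ℝ K := fun t =>
    κ • (H t₀ t).compl₁₂ ((R t₀).toLinearMap ∘ₗ K.subtype) ((R t).toLinearMap ∘ₗ K.subtype)
  have hGa : ∀ t (y y' : K), G t y y' = κ * H t₀ t (R t₀ y) (R t y') := fun t y y' => rfl
  rw [← finrank_radical_chartForm (hTu t₀ ht₀) (hs t₀)]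
  refine eventually_sigNeg_eq (Q := fun t => chartForm (T t) (D t) K) (G := G) (G₀ := G t₀)
    (fun y y' => ?_) (fun y hy => ?_) (fun t ht y => ?_)
  · simp only [hGa]
    refine Tendsto.const_mul κ ?_
    have h1 : Continuous fun t => (H t₀ t (R t₀ y)).toContinuousLinearMap :=
      continuous_clm_apply.2 fun c' => hH t₀ (R t₀ y) c'
    have h2 : Tendsto (fun t => R t y') (𝓝[I] t₀) (𝓝 (R t₀ y')) :=
      ((ContinuousLinearMap.apply ℝ E (y' : E)).continuous.tendsto _).comp hR
    exact (isBoundedBilinearMap_apply.continuous.tendsto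
      ((H t₀ t₀ (R t₀ y)).toContinuousLinearMap, R t₀ y')).comp
      (((h1.tendsto t₀).mono_left nhdsWithin_le_nhds).prodMk_nhds h2)
  · rw [hGa]
    refine mul_pos hκ (hHpos _ _ fun h => hy ?_)
    have := apply_inverse_apply (hTu t₀ ht₀) (y : E)
    rw [show Ring.inverse (T t₀) (y : E) = 0 from h, map_zero] at this
    exact Subtype.ext this.symm
  · have h1 := hid t₀ t (R t₀ y) (R t y) (by
      rw [apply_inverse_apply (hTu t₀ ht₀), apply_inverse_apply (hTu t ht)])
    rw [apply_inverse_apply (hTu t₀ ht₀), apply_inverse_apply (hTu t ht)] at h1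
    rw [chartForm_apply, chartForm_apply, hGa]
    linear_combination h1

end Chart

/-! ### Dirichlet integral and potential energy on short intervals. -/

section Energy

variable {E : Type*} [NormedAddCommGroup E] [InnerProductSpace ℝ E]

/-- `p` is continuously differentiable on `[0, s]` with derivative `q`. -/
structure IsC1 (s : ℝ) (p q : ℝ → E) : Prop where
  deriv : ∀ x ∈ Icc 0 s, HasDerivAt p (q x) x
  cont : ContinuousOn q (Icc 0 s)

lemma IsC1.continuousOn {s : ℝ} {p q : ℝ → E} (h : IsC1 s p q) : ContinuousOn p (Icc 0 s) :=
  fun x hx => (h.deriv x hx).continuousAt.continuousWithinAt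

lemma IsC1.sub {s : ℝ} {p q p' q' : ℝ → E} (h : IsC1 s p q) (h' : IsC1 s p' q') :
    IsC1 s (p - p') (q - q') :=
  ⟨fun x hx => (h.deriv x hx).sub (h'.deriv x hx), h.cont.sub h'.cont⟩

/-- The Dirichlet integral. -/
def dirichlet (s : ℝ) (q : ℝ → E) : ℝ := ∫ x in (0 : ℝ)..s, ‖q x‖ ^ 2

/-- The potential energy. -/
def potential (V : C(ℝ, E →L[ℝ] E)) (s : ℝ) (p : ℝ → E) : ℝ :=
  ∫ x in (0 : ℝ)..s, inner ℝ (V x (p x)) (p x)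

lemma intervalIntegrable_of_continuousOn_Icc {s : ℝ} (hs : 0 ≤ s) {f : ℝ → ℝ}
    (h : ContinuousOn f (Icc 0 s)) : IntervalIntegrable f volume 0 s := by
  refine ContinuousOn.intervalIntegrable ?_
  rwa [uIcc_of_le hs]

lemma dirichlet_nonneg {s : ℝ} (hs : 0 ≤ s) (q : ℝ → E) : 0 ≤ dirichlet s q :=
  intervalIntegral.integral_nonneg hs fun _ _ => by positivity

lemma IsC1.norm_sub_sq_le [CompleteSpace E] {s : ℝ} {p q : ℝ → E} (h : IsC1 s p q) (hs : 0 < s)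
    {x y : ℝ} (hx : x ∈ Icc 0 s) (hy : y ∈ Icc 0 s) : ‖p x - p y‖ ^ 2 ≤ s * dirichlet s q := by
  wlog hxy : y ≤ x generalizing x y
  · rw [norm_sub_rev]
    exact this hy hx (le_of_not_ge hxy)
  have hi : IntervalIntegrable (fun t => ‖q t‖) volume 0 s :=
    intervalIntegrable_of_continuousOn_Icc hs.le h.cont.norm
  have hi2 : IntervalIntegrable (fun t => ‖q t‖ ^ 2) volume 0 s :=
    intervalIntegrable_of_continuousOn_Icc hs.le (h.cont.norm.pow 2)
  have hsub : Icc y x ⊆ Icc 0 s := Icc_subset_Icc hy.1 hx.2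
  have h1 : ∫ t in y..x, q t = p x - p y := by
    refine intervalIntegral.integral_eq_sub_of_hasDerivAt (fun t ht => ?_)
      (ContinuousOn.intervalIntegrable ?_)
    · rw [uIcc_of_le hxy] at ht
      exact h.deriv t (hsub ht)
    · rw [uIcc_of_le hxy]
      exact h.cont.mono hsub
  set J := ∫ t in (0 : ℝ)..s, ‖q t‖ with hJ
  have h2 : ‖p x - p y‖ ≤ J := by
    rw [← h1]
    refine (intervalIntegral.norm_integral_le_integral_norm hxy).trans ?_
    exact intervalIntegral.integral_mono_interval hy.1 hxy hx.2
      (Eventually.of_forall fun t => norm_nonneg _) hi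
  -- Cauchy–Schwarz, in the form that the variance of `‖q‖` about its mean `J / s` is nonnegative.
  have h3 : 0 ≤ ∫ t in (0 : ℝ)..s, (‖q t‖ - J / s) ^ 2 :=
    intervalIntegral.integral_nonneg hs.le fun _ _ => by positivity
  have h4 : ∫ t in (0 : ℝ)..s, (‖q t‖ - J / s) ^ 2 = dirichlet s q - J ^ 2 / s := by
    have : ∀ t, (‖q t‖ - J / s) ^ 2 = ‖q t‖ ^ 2 - (2 * (J / s)) * ‖q t‖ + (J / s) ^ 2 := fun t => by
      ring
    simp_rw [this]
    rw [intervalIntegral.integral_add (hi2.sub (hi.const_mul _)) intervalIntegrable_const,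
      intervalIntegral.integral_sub hi2 (hi.const_mul _), intervalIntegral.integral_const_mul,
      intervalIntegral.integral_const, ← hJ, dirichlet]
    simp only [sub_zero, smul_eq_mul]
    field_simp
    ring
  rw [h4] at h3
  have hJ0 : 0 ≤ ‖p x - p y‖ := norm_nonneg _
  calc ‖p x - p y‖ ^ 2 ≤ J ^ 2 := by gcongr
    _ = s * (J ^ 2 / s) := by field_simp
    _ ≤ s * dirichlet s q := by
      gcongr
      linarith

lemma abs_integral_le_mul_of_le {s C : ℝ} (hs : 0 ≤ s) {f : ℝ → ℝ}
    (h : ∀ x ∈ Icc 0 s, |f x| ≤ C) : |∫ x in (0 : ℝ)..s, f x| ≤ s * C := by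
  have := intervalIntegral.norm_integral_le_of_norm_le_const (a := (0 : ℝ)) (b := s) (f := f) (C := C)
    fun x hx => by
      rw [uIoc_of_le hs] at hx
      exact h x ⟨hx.1.le, hx.2⟩
  rwa [sub_zero, abs_of_nonneg hs, mul_comm] at this

lemma continuousOn_inner_potential (V : C(ℝ, E →L[ℝ] E)) {s : ℝ} {p p' : ℝ → E}
    (hp : ContinuousOn p (Icc 0 s)) (hp' : ContinuousOn p' (Icc 0 s)) :
    ContinuousOn (fun x => inner ℝ (V x (p x)) (p' x)) (Icc 0 s) :=
  (V.continuous.continuousOn.clm_apply hp).inner hp'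

/-- The potential energy of a function that vanishes at `s`. -/
lemma abs_potential_le_of_eq_zero [CompleteSpace E] (V : C(ℝ, E →L[ℝ] E)) {v s : ℝ}
    (hv : ∀ x ∈ Icc (0 : ℝ) 1, ‖V x‖ ≤ v) (hs : s ∈ Ioc (0 : ℝ) 1) {p q : ℝ → E} (h : IsC1 s p q)
    (h0 : p s = 0) : |potential V s p| ≤ v * s * dirichlet s q := by
  have hv0 : 0 ≤ v := (norm_nonneg _).trans (hv 0 (by simp))
  have hD := dirichlet_nonneg hs.1.le q
  have : |potential V s p| ≤ s * (v * (s * dirichlet s q)) := by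
    refine abs_integral_le_mul_of_le hs.1.le fun x hx => ?_
    have h1 := h.norm_sub_sq_le hs.1 hx (right_mem_Icc.2 hs.1.le)
    rw [h0, sub_zero] at h1
    calc |inner ℝ (V x (p x)) (p x)| ≤ ‖V x (p x)‖ * ‖p x‖ := abs_real_inner_le_norm _ _
      _ ≤ (v * ‖p x‖) * ‖p x‖ := by
        gcongr
        exact (V x).le_of_opNorm_le (hv x ⟨hx.1, hx.2.trans hs.2⟩) _
      _ = v * ‖p x‖ ^ 2 := by ring
      _ ≤ _ := by gcongr
  refine this.trans ?_
  have h2 : s * s ≤ s * 1 := mul_le_mul_of_nonneg_left hs.2 hs.1.le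
  calc s * (v * (s * dirichlet s q)) = (s * s) * (v * dirichlet s q) := by ring
    _ ≤ (s * 1) * (v * dirichlet s q) := by gcongr
    _ = _ := by ring

/-- For small `s`, the potential energy is close to `s ⟪V 0 p(s), p(s)⟫`. -/
lemma exists_abs_potential_sub_le [CompleteSpace E] (V : C(ℝ, E →L[ℝ] E)) {δ : ℝ} (hδ : 0 < δ) :
    ∃ C ≥ 0, ∃ s₀ > 0, ∀ s ∈ Ioc (0 : ℝ) 1, s ≤ s₀ → ∀ p q : ℝ → E, IsC1 s p q →
      |potential V s p - s * inner ℝ (V 0 (p s)) (p s)| ≤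
        s * δ * ‖p s‖ ^ 2 + C * s ^ 2 * dirichlet s q := by
  obtain ⟨v, hv0, hv⟩ := exists_norm_le_Icc V
  obtain ⟨s₀, hs₀, hη⟩ := Metric.continuousAt_iff.1 V.continuous.continuousAt (δ / 2) (by positivity)
  -- The error at `x` is at most `δ / 2 ‖b‖² + 2 v ‖b‖ ‖r‖ + v ‖r‖²` with `r = p x - b`; Young's
  -- inequality moves the mixed term into `δ / 2 ‖b‖²` and `2 v² / δ ‖r‖²`. Halving `s₀` makes the
  -- strict inequality of the continuity modulus available on the closed interval.
  refine ⟨2 * v ^ 2 / δ + v, by positivity, s₀ / 2, by positivity, fun s hs hss p q h => ?_⟩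
  have hD := dirichlet_nonneg hs.1.le q
  set b := p s with hb
  have e : potential V s p - s * inner ℝ (V 0 b) b =
      ∫ x in (0 : ℝ)..s, (inner ℝ (V x (p x)) (p x) - inner ℝ (V 0 b) b) := by
    rw [intervalIntegral.integral_sub (intervalIntegrable_of_continuousOn_Icc hs.1.le
      (continuousOn_inner_potential V h.continuousOn h.continuousOn)) intervalIntegrable_const]
    simp [potential]
  rw [e]
  have key : |∫ x in (0 : ℝ)..s, (inner ℝ (V x (p x)) (p x) - inner ℝ (V 0 b) b)| ≤
      s * (δ * ‖b‖ ^ 2 + (2 * v ^ 2 / δ + v) * (s * dirichlet s q)) := by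
    refine abs_integral_le_mul_of_le hs.1.le fun x hx => ?_
    have h1 := h.norm_sub_sq_le hs.1 hx (right_mem_Icc.2 hs.1.le)
    rw [← hb] at h1
    set r := p x - b with hr
    have hpx : p x = b + r := by rw [hr]; abel
    have hVx := hv x ⟨hx.1, hx.2.trans hs.2⟩
    have hVd : ‖V x - V 0‖ ≤ δ / 2 := by
      rw [← dist_eq_norm]
      refine (hη ?_).le
      rw [Real.dist_eq, sub_zero, abs_of_nonneg hx.1]
      linarith [hx.2]
    have hsplit : inner ℝ (V x (p x)) (p x) - inner ℝ (V 0 b) b =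
        inner ℝ ((V x - V 0) b) b + inner ℝ (V x b) r + inner ℝ (V x r) b + inner ℝ (V x r) r := by
      rw [hpx]
      simp only [map_add, inner_add_left, inner_add_right, sub_apply, inner_sub_left]
      ring
    have hb1 : ∀ (T : E →L[ℝ] E) (y z : E) (C : ℝ), ‖T‖ ≤ C → |inner ℝ (T y) z| ≤ C * ‖y‖ * ‖z‖ :=
      fun T y z C hC => (abs_real_inner_le_norm _ _).trans (by
        gcongr
        exact T.le_of_opNorm_le hC y)
    have i1 := hb1 _ b b _ hVd
    have i2 := hb1 _ b r _ hVx
    have i3 := hb1 _ r b _ hVx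
    have i4 := hb1 _ r r _ hVx
    rw [hsplit]
    have hyoung : 2 * v * ‖b‖ * ‖r‖ ≤ δ / 2 * ‖b‖ ^ 2 + 2 * v ^ 2 / δ * ‖r‖ ^ 2 := by
      have := sq_nonneg (δ * ‖b‖ - 2 * v * ‖r‖)
      have h3 : δ / 2 * ‖b‖ ^ 2 + 2 * v ^ 2 / δ * ‖r‖ ^ 2 - 2 * v * ‖b‖ * ‖r‖ =
          (δ * ‖b‖ - 2 * v * ‖r‖) ^ 2 / (2 * δ) := by
        field_simp
        ring
      have h4 : 0 ≤ (δ * ‖b‖ - 2 * v * ‖r‖) ^ 2 / (2 * δ) := by positivity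
      linarith
    have h5 : (2 * v ^ 2 / δ + v) * ‖r‖ ^ 2 ≤ (2 * v ^ 2 / δ + v) * (s * dirichlet s q) := by gcongr
    refine (abs_add_le _ _).trans ?_
    have a1 := abs_add_le (inner ℝ ((V x - V 0) b) b + inner ℝ (V x b) r) (inner ℝ (V x r) b)
    have a2 := abs_add_le (inner ℝ ((V x - V 0) b) b) (inner ℝ (V x b) r)
    nlinarith
  refine key.trans (le_of_eq ?_)
  ring

end Energy

end

end MaslovMorse

namespace MaslovMorse

noncomputable section

open Topology Filter Set Module

/-! ### Green's formula, coercivity and the minimizing property of solutions. -/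

section Green

variable {E : Type*} [NormedAddCommGroup E] [InnerProductSpace ℝ E] [FiniteDimensional ℝ E]
  {V : C(ℝ, E →L[ℝ] E)} (b : RobinBC E) {s : ℝ}

lemma isC1_sol (hs : s ∈ Ioc (0 : ℝ) 1) (lam : ℝ) (c : E) :
    IsC1 s (fun x => solP V b lam x c) (fun x => solQ V b lam x c) :=
  ⟨fun _ hx => hasDerivAt_solP V b lam c ⟨hx.1, hx.2.trans hs.2⟩,
    (continuousOn_solQ V b lam c).mono (Icc_subset_Icc_right hs.2)⟩

/-- Green's formula for a solution and an arbitrary function. -/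
lemma green_sol (hs : s ∈ Ioc (0 : ℝ) 1) (lam : ℝ) (c : E) {u w : ℝ → E} (hu : IsC1 s u w) :
    (∫ x in (0 : ℝ)..s, inner ℝ (solQ V b lam x c) (w x)) +
      (∫ x in (0 : ℝ)..s, inner ℝ (V x (solP V b lam x c)) (u x)) -
      lam * (∫ x in (0 : ℝ)..s, inner ℝ (solP V b lam x c) (u x)) =
    inner ℝ (solQ V b lam s c) (u s) - inner ℝ (solQ V b lam 0 c) (u 0) := by
  have h := isC1_sol (V := V) b hs lam c
  have i1 := intervalIntegrable_of_continuousOn_Icc hs.1.le (h.cont.inner (𝕜 := ℝ) hu.cont)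
  have i2 := intervalIntegrable_of_continuousOn_Icc hs.1.le
    (continuousOn_inner_potential V h.continuousOn hu.continuousOn)
  have i3 := intervalIntegrable_of_continuousOn_Icc hs.1.le
    (h.continuousOn.inner (𝕜 := ℝ) hu.continuousOn)
  have hd : ∀ x ∈ uIcc 0 s, HasDerivAt (fun x => inner ℝ (solQ V b lam x c) (u x))
      (inner ℝ (solQ V b lam x c) (w x) + inner ℝ (V x (solP V b lam x c)) (u x) -
        lam * inner ℝ (solP V b lam x c) (u x)) x := by
    intro x hx
    rw [uIcc_of_le hs.1.le] at hx
    refine ((hasDerivAt_solQ V b lam c ⟨hx.1, hx.2.trans hs.2⟩).inner ℝ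
      (hu.deriv x hx)).congr_deriv ?_
    simp only [inner_sub_left, inner_smul_left, conj_trivial]
    ring
  rw [← intervalIntegral.integral_eq_sub_of_hasDerivAt hd ((i1.add i2).sub (i3.const_mul _)),
    intervalIntegral.integral_sub (i1.add i2) (i3.const_mul _), intervalIntegral.integral_add i1 i2,
    intervalIntegral.integral_const_mul]

lemma inner_snd_fst (c : E) {y : E} (hy : y ∈ b.K) :
    inner ℝ (b.snd c) y = inner ℝ (b.L (b.fst c)) y := by
  have := (b.holds_param c).2 y hy
  rwa [inner_sub_left, sub_eq_zero] at this

/-- The energy of a solution. -/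
lemma energy_sol (hs : s ∈ Ioc (0 : ℝ) 1) (lam : ℝ) (c : E) :
    inner ℝ (solQ V b lam s c) (solP V b lam s c) =
      dirichlet s (fun x => solQ V b lam x c) + potential V s (fun x => solP V b lam x c) -
        lam * solPairing V b hs lam lam c c +
        inner ℝ (b.L (solP V b lam 0 c)) (solP V b lam 0 c) := by
  have h := green_sol (V := V) b hs lam c (isC1_sol (V := V) b hs lam c)
  have h2 := inner_snd_fst b c (b.holds_param c).1
  rw [solPairing_apply, potential, dirichlet]
  simp only [real_inner_self_eq_norm_sq] at h ⊢
  rw [h, solP_zero, solQ_zero, h2]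
  ring

lemma abs_inner_le (T : E →L[ℝ] E) (y z : E) : |inner ℝ (T y) z| ≤ ‖T‖ * ‖y‖ * ‖z‖ :=
  (abs_real_inner_le_norm _ _).trans (by gcongr; exact T.le_opNorm y)

/-- When `u s = 0`, Cauchy–Schwarz gives `‖u x‖² ≤ s D`, so the potential and the boundary term at 0
are small multiples of the Dirichlet integral `D`. This coercivity yields both the injectivity of
the value at `s` and the minimality of solutions. -/
lemma IsC1.energy_ge {v : ℝ} (hv : ∀ x ∈ Icc (0 : ℝ) 1, ‖V x‖ ≤ v) (hs : s ∈ Ioc (0 : ℝ) 1)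
    {u w : ℝ → E} (hu : IsC1 s u w) (h0 : u s = 0) :
    (1 - (v + ‖b.L‖) * s) * dirichlet s w ≤
      dirichlet s w + potential V s u + inner ℝ (b.L (u 0)) (u 0) := by
  have h1 := (abs_le.1 (abs_potential_le_of_eq_zero V hv hs hu h0)).1
  have h2 := hu.norm_sub_sq_le hs.1 (left_mem_Icc.2 hs.1.le) (right_mem_Icc.2 hs.1.le)
  rw [h0, sub_zero] at h2
  have h3 := (abs_le.1 (abs_inner_le b.L (u 0) (u 0))).1
  have h4 : ‖b.L‖ * ‖u 0‖ ^ 2 ≤ ‖b.L‖ * (s * dirichlet s w) := by gcongr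
  linarith

lemma IsC1.eq_zero_of_dirichlet {u w : ℝ → E} (hu : IsC1 s u w) (hs : 0 < s) (h0 : u s = 0)
    (hD : dirichlet s w ≤ 0) : ∀ x ∈ Icc 0 s, u x = 0 := fun x hx => by
  have h := hu.norm_sub_sq_le hs hx (right_mem_Icc.2 hs.le)
  rw [h0, sub_zero] at h
  have h2 : s * dirichlet s w ≤ 0 := mul_nonpos_of_nonneg_of_nonpos hs.le hD
  have h3 : ‖u x‖ ^ 2 = 0 := le_antisymm (h.trans h2) (by positivity)
  simpa using h3

/-- For small `s` and `λ ≤ 0`, the values at `s` of the solutions determine them. -/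
lemma isUnit_solP {v : ℝ} (hv : ∀ x ∈ Icc (0 : ℝ) 1, ‖V x‖ ≤ v) (hs : s ∈ Ioc (0 : ℝ) 1)
    (hsmall : (v + ‖b.L‖) * s < 1) {lam : ℝ} (hlam : lam ≤ 0) : IsUnit (solP V b lam s) := by
  refine isUnit_of_injective fun c hc => ?_
  have h := isC1_sol (V := V) b hs lam c
  have h1 := h.energy_ge b hv hs hc
  -- A solution with `p s = 0` has energy `λ ∫ ‖p‖² ≤ 0`, while coercivity bounds the energy below
  -- by a positive multiple of the Dirichlet integral.
  have h2 := energy_sol (V := V) b hs lam c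
  rw [hc, inner_zero_right] at h2
  have h3 : 0 ≤ solPairing V b hs lam lam c c := by
    by_cases h0 : c = 0
    · simp [h0]
    · exact (solPairing_self_pos V b hs lam h0).le
  have h4 : (1 - (v + ‖b.L‖) * s) * dirichlet s (fun x => solQ V b lam x c) ≤ 0 := by nlinarith
  have h5 : dirichlet s (fun x => solQ V b lam x c) ≤ 0 := by
    by_contra! hpos
    have := mul_pos (sub_pos.2 hsmall) hpos
    linarith
  exact sol_eq_zero_of_solP V b hs lam (h.eq_zero_of_dirichlet hs.1 hc h5)

/-- A trace inequality, obtained by integrating `‖p x₀‖² ≤ 2 ‖p x‖² + 2 s D` over `x`. It controls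
the boundary terms at both ends by the `L²` norm and the Dirichlet integral. -/
lemma norm_sq_solP_le (hs : s ∈ Ioc (0 : ℝ) 1) (lam : ℝ) (c : E) {x₀ : ℝ} (hx₀ : x₀ ∈ Icc 0 s) :
    s * ‖solP V b lam x₀ c‖ ^ 2 ≤ 2 * solPairing V b hs lam lam c c +
      2 * s ^ 2 * dirichlet s (fun x => solQ V b lam x c) := by
  have h := isC1_sol (V := V) b hs lam c
  set D := dirichlet s (fun x => solQ V b lam x c)
  have hi := intervalIntegrable_inner_solP V b hs lam lam c c
  have h1 : ∫ x in (0 : ℝ)..s, ‖solP V b lam x₀ c‖ ^ 2 ≤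
      ∫ x in (0 : ℝ)..s, (2 * inner ℝ (solP V b lam x c) (solP V b lam x c) + 2 * (s * D)) := by
    refine intervalIntegral.integral_mono_on hs.1.le intervalIntegrable_const
      ((hi.const_mul 2).add intervalIntegrable_const) fun x hx => ?_
    have h2 := h.norm_sub_sq_le hs.1 hx₀ hx
    rw [real_inner_self_eq_norm_sq]
    have h3 : ‖solP V b lam x₀ c‖ ≤ ‖solP V b lam x c‖ +
        ‖solP V b lam x₀ c - solP V b lam x c‖ := by
      rw [add_comm]
      exact norm_le_norm_sub_add _ _
    have h4 : ‖solP V b lam x₀ c‖ ^ 2 ≤ (‖solP V b lam x c‖ +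
        ‖solP V b lam x₀ c - solP V b lam x c‖) ^ 2 := by gcongr
    have h5 := add_sq_le (a := ‖solP V b lam x c‖) (b := ‖solP V b lam x₀ c - solP V b lam x c‖)
    linarith
  rw [intervalIntegral.integral_const, intervalIntegral.integral_add (hi.const_mul 2)
    intervalIntegrable_const, intervalIntegral.integral_const_mul, intervalIntegral.integral_const,
    ← solPairing_apply V b hs] at h1
  simp only [sub_zero, smul_eq_mul] at h1
  linarith

/-- For very negative `λ`, the form of the boundary value problem is positive. -/
lemma form_pos_of_le {v : ℝ} (hv : ∀ x ∈ Icc (0 : ℝ) 1, ‖V x‖ ≤ v) (hs : s ∈ Ioc (0 : ℝ) 1)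
    (L₁ : E →L[ℝ] E) (hsmall : 2 * (‖b.L‖ + ‖L₁‖) * s ≤ 1) {lam : ℝ}
    (hlam : lam < -(v + 2 * (‖b.L‖ + ‖L₁‖) / s)) {c : E} (hc : c ≠ 0) :
    0 < inner ℝ (solQ V b lam s c) (solP V b lam s c) -
      inner ℝ (L₁ (solP V b lam s c)) (solP V b lam s c) := by
  have h := isC1_sol (V := V) b hs lam c
  have hN := solPairing_self_pos V b hs lam hc
  have hD := dirichlet_nonneg hs.1.le (fun x => solQ V b lam x c)
  have t0 := norm_sq_solP_le (V := V) b hs lam c (left_mem_Icc.2 hs.1.le)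
  have t1 := norm_sq_solP_le (V := V) b hs lam c (right_mem_Icc.2 hs.1.le)
  rw [energy_sol b hs]
  set N := solPairing V b hs lam lam c c with hNdef
  set D := dirichlet s (fun x => solQ V b lam x c) with hDdef
  have l0 := (abs_le.1 (abs_inner_le b.L (solP V b lam 0 c) (solP V b lam 0 c))).1
  have l1 := (abs_le.1 (abs_inner_le L₁ (solP V b lam s c) (solP V b lam s c))).2
  have hpot : -(v * N) ≤ potential V s (fun x => solP V b lam x c) := by
    rw [hNdef, solPairing_apply, potential, ← intervalIntegral.integral_const_mul,
      ← intervalIntegral.integral_neg]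
    refine intervalIntegral.integral_mono_on hs.1.le
      ((intervalIntegrable_inner_solP V b hs lam lam c c).const_mul v).neg
      (intervalIntegrable_of_continuousOn_Icc hs.1.le
        (continuousOn_inner_potential V h.continuousOn h.continuousOn)) fun x hx => ?_
    have h1 := (abs_le.1 (abs_inner_le (V x) (solP V b lam x c) (solP V b lam x c))).1
    rw [real_inner_self_eq_norm_sq]
    have h2 : ‖V x‖ * ‖solP V b lam x c‖ ^ 2 ≤ v * ‖solP V b lam x c‖ ^ 2 := by
      gcongr
      exact hv x ⟨hx.1, hx.2.trans hs.2⟩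
    linarith
  set p0 := ‖solP V b lam 0 c‖
  set p1 := ‖solP V b lam s c‖
  have hs0 := hs.1
  have k0 : p0 ^ 2 ≤ 2 / s * N + 2 * s * D := by
    have : p0 ^ 2 = s * p0 ^ 2 / s := by field_simp
    rw [this, div_le_iff₀ hs0]
    calc s * p0 ^ 2 ≤ _ := t0
      _ = (2 / s * N + 2 * s * D) * s := by field_simp
  have k1 : p1 ^ 2 ≤ 2 / s * N + 2 * s * D := by
    have : p1 ^ 2 = s * p1 ^ 2 / s := by field_simp
    rw [this, div_le_iff₀ hs0]
    calc s * p1 ^ 2 ≤ _ := t1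
      _ = (2 / s * N + 2 * s * D) * s := by field_simp
  have m0 : ‖b.L‖ * p0 ^ 2 ≤ ‖b.L‖ * (2 / s * N + 2 * s * D) := by gcongr
  have m1 : ‖L₁‖ * p1 ^ 2 ≤ ‖L₁‖ * (2 / s * N + 2 * s * D) := by gcongr
  -- The boundary terms cost at most `(‖L‖ + ‖L₁‖) (2 / s N + 2 s D)`. The part with `D` is absorbed
  -- by the Dirichlet integral through `hsmall`, the part with `N` by `-λ N`, which explains the
  -- threshold for `lam`.
  have m2 : 2 * (‖b.L‖ + ‖L₁‖) * s * D ≤ 1 * D := by gcongr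
  have m3 : (v + 2 * (‖b.L‖ + ‖L₁‖) / s) * N < -lam * N := by
    apply mul_lt_mul_of_pos_right _ hN
    linarith
  have m4 : 2 * (‖b.L‖ + ‖L₁‖) / s * N = (‖b.L‖ + ‖L₁‖) * (2 / s * N) := by ring
  nlinarith

/-- For small `s`, solutions with `λ = 0` minimize the energy. -/
lemma energy_sol_le (hV : ∀ x y z, inner ℝ (V x y) z = inner ℝ y (V x z)) {v : ℝ}
    (hv : ∀ x ∈ Icc (0 : ℝ) 1, ‖V x‖ ≤ v) (hs : s ∈ Ioc (0 : ℝ) 1)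
    (hsmall : (v + ‖b.L‖) * s < 1) (c : E) {p q : ℝ → E} (h : IsC1 s p q) (h0 : p 0 ∈ b.K)
    (hps : p s = solP V b 0 s c) :
    inner ℝ (solQ V b 0 s c) (solP V b 0 s c) ≤
      dirichlet s q + potential V s p + inner ℝ (b.L (p 0)) (p 0) := by
  have hsol := isC1_sol (V := V) b hs 0 c
  -- The energy is expanded about the solution `P`. The increment vanishes at `s` and lies in `K` at
  -- 0, so Green's formula cancels the linear terms, and coercivity makes the remaining energy of
  -- the increment nonnegative.
  have hu := h.sub hsol
  set P : ℝ → E := fun x => solP V b 0 x c with hP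
  set Q : ℝ → E := fun x => solQ V b 0 x c with hQ
  have hus : (p - P) s = 0 := by simp [hP, hps]
  have g := green_sol (V := V) b hs 0 c hu
  rw [hus, inner_zero_right, zero_mul, sub_zero, zero_sub] at g
  have hP0 : P 0 ∈ b.K := by
    simp only [hP, solP_zero]
    exact (b.holds_param c).1
  have hu0 : (p - P) 0 ∈ b.K := b.K.sub_mem h0 hP0
  have hQ0 : inner ℝ (solQ V b 0 0 c) ((p - P) 0) = inner ℝ (b.L (P 0)) ((p - P) 0) := by
    simp only [hP, solP_zero, solQ_zero]
    have := inner_snd_fst b c hu0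
    simpa only [hP, solP_zero] using this
  rw [hQ0] at g
  have e := hu.energy_ge b hv hs hus
  have e2 : 0 ≤ (1 - (v + ‖b.L‖) * s) * dirichlet s (q - Q) :=
    mul_nonneg (by linarith) (dirichlet_nonneg hs.1.le _)
  have e3 := energy_sol (V := V) b hs 0 c
  rw [zero_mul, sub_zero] at e3
  have d1 : dirichlet s q = dirichlet s Q + 2 * (∫ x in (0 : ℝ)..s, inner ℝ (Q x) ((q - Q) x)) +
      dirichlet s (q - Q) := by
    have i1 : IntervalIntegrable (fun x => ‖Q x‖ ^ 2) volume 0 s :=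
      intervalIntegrable_of_continuousOn_Icc hs.1.le (hsol.cont.norm.pow 2)
    have i2 := intervalIntegrable_of_continuousOn_Icc hs.1.le (hsol.cont.inner (𝕜 := ℝ) hu.cont)
    have i3 : IntervalIntegrable (fun x => ‖(q - Q) x‖ ^ 2) volume 0 s :=
      intervalIntegrable_of_continuousOn_Icc hs.1.le (hu.cont.norm.pow 2)
    rw [dirichlet, dirichlet, dirichlet, ← intervalIntegral.integral_const_mul,
      ← intervalIntegral.integral_add i1 (i2.const_mul 2),
      ← intervalIntegral.integral_add (i1.add (i2.const_mul 2)) i3]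
    refine intervalIntegral.integral_congr fun x _ => ?_
    have : q x = Q x + (q - Q) x := by simp
    rw [this, norm_add_sq_real]
  have d2 : potential V s p = potential V s P +
      2 * (∫ x in (0 : ℝ)..s, inner ℝ (V x (P x)) ((p - P) x)) + potential V s (p - P) := by
    have i1 := intervalIntegrable_of_continuousOn_Icc hs.1.le
      (continuousOn_inner_potential V hsol.continuousOn hsol.continuousOn)
    have i2 := intervalIntegrable_of_continuousOn_Icc hs.1.le
      (continuousOn_inner_potential V hsol.continuousOn hu.continuousOn)
    have i3 := intervalIntegrable_of_continuousOn_Icc hs.1.le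
      (continuousOn_inner_potential V hu.continuousOn hu.continuousOn)
    rw [potential, potential, potential, ← intervalIntegral.integral_const_mul,
      ← intervalIntegral.integral_add i1 (i2.const_mul 2),
      ← intervalIntegral.integral_add (i1.add (i2.const_mul 2)) i3]
    refine intervalIntegral.integral_congr fun x _ => ?_
    have : p x = P x + (p - P) x := by simp
    rw [this]
    simp only [map_add, inner_add_left, inner_add_right]
    rw [hV x ((p - P) x) (P x), real_inner_comm (V x (P x)) ((p - P) x)]
    ring
  have d3 : inner ℝ (b.L (p 0)) (p 0) = inner ℝ (b.L (P 0)) (P 0) +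
      2 * inner ℝ (b.L (P 0)) ((p - P) 0) + inner ℝ (b.L ((p - P) 0)) ((p - P) 0) := by
    have : p 0 = P 0 + (p - P) 0 := by simp
    conv_lhs => rw [this]
    simp only [map_add, inner_add_left, inner_add_right]
    rw [b.symm ((p - P) 0) (P 0), real_inner_comm (b.L (P 0)) ((p - P) 0)]
    ring
  linarith

end Green

end

end MaslovMorse

namespace MaslovMorse

noncomputable section

open Topology Filter Set Module QuadraticMap

/-! ### Scalar inequalities behind the expansion in s. -/

section Real

/-- Here `x` and `y` are the norms of the components in the negative space of B and in ker B, with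
gains of order 1 and s. The mixed term `s x y` is harmless because it is small against the geometric
mean of the two gains. -/
lemma exists_forall_quadratic_neg {c A : ℝ} (hc : 0 < c) (hA : 0 ≤ A) :
    ∃ s₀ > 0, ∀ s, 0 < s → s ≤ s₀ → ∀ x y : ℝ, (x ≠ 0 ∨ y ≠ 0) →
      -(c * x ^ 2) - c / 2 * s * y ^ 2 + A * s * x ^ 2 + A * s * (x * y) + A * s ^ 2 * y ^ 2 < 0 := by
  set R := A + 2 * A ^ 2 / c + 1 with hR
  have hR0 : 0 < R := by positivity
  -- From `s R ≤ c / 8` one gets both `s A ≤ c / 8` and `s (A + 2 A² / c) ≤ c / 8`, the latter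
  -- carrying the constant from Young's inequality in `h3`.
  refine ⟨c / (8 * R), by positivity, fun s hs hs₀ x y hxy => ?_⟩
  rw [le_div_iff₀ (by positivity)] at hs₀
  have hA2 : 0 ≤ 2 * A ^ 2 / c := by positivity
  have h1 : s * A ≤ c / 8 := by nlinarith
  have h2 : s * (A + 2 * A ^ 2 / c) ≤ c / 8 := by nlinarith
  have h3 : A * (x * y) ≤ c / 8 * y ^ 2 + 2 * A ^ 2 / c * x ^ 2 := by
    have : c / 8 * y ^ 2 + 2 * A ^ 2 / c * x ^ 2 - A * (x * y) =
        (c * y - 4 * A * x) ^ 2 / (8 * c) := by field_simp; ring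
    have h4 : 0 ≤ (c * y - 4 * A * x) ^ 2 / (8 * c) := by positivity
    linarith
  have h4 := mul_le_mul_of_nonneg_left h3 hs.le
  have h5 := mul_le_mul_of_nonneg_right h1 (show 0 ≤ s * y ^ 2 by positivity)
  have h6 := mul_le_mul_of_nonneg_right h2 (sq_nonneg x)
  have h7 : 0 < c * x ^ 2 + s * (c * y ^ 2) := by
    rcases hxy with h | h <;> positivity
  have h8 : 0 ≤ c * x ^ 2 := by positivity
  nlinarith

/-- After the scaling `t = s τ`, the bound `D ≥ s τ²` completes a square: `s τ² - 2 s l τ + s l² = s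
(τ - l)²`. Since `l ≤ B y`, this square and the gain in `y²` together control `s τ²`, and all error
terms fit under a small multiple of `s (τ² + y²)` and of `x²`. -/
lemma quadratic_pos_aux {c A B s r D τ l x y : ℝ} (hc : 0 < c) (hA : 0 ≤ A) (hs : 0 < s)
    (hs2 : s ≤ 1 / 2) (hr0 : 0 ≤ r) (hsAr : 8 * (s * A) ≤ r)
    (hr : s * (4 * A + 4 * A ^ 2 / c) ≤ r) (k0 : r * 4 ≤ 1) (k2 : r * 8 ≤ c)
    (k3 : r * (2 * B ^ 2 + 1) ≤ c / 4) (hτ : 0 ≤ τ) (hx : 0 ≤ x) (hy : 0 ≤ y) (hl : 0 ≤ l)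
    (hD : (s * τ) ^ 2 ≤ s * D) (hly : l ≤ B * y) (hne : τ ≠ 0 ∨ x ≠ 0 ∨ y ≠ 0) :
    0 < D * (1 - A * s ^ 2) - 2 * l * (s * τ) + s * l ^ 2 + c / 2 * s * y ^ 2 + c * x ^ 2 -
      A * (x * (s * τ) + (s * τ) ^ 2) - A * s * ((x + s * τ) * (x + s * τ + y)) := by
  have hs1 : s ≤ 1 := by linarith
  have hD' : s * τ ^ 2 ≤ D := by
    have : s * (s * τ ^ 2) ≤ s * D := by linarith
    exact le_of_mul_le_mul_left this hs
  have hAs2 : A * s ^ 2 ≤ 1 := by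
    have : s * A * s ≤ 1 * 1 := by gcongr; linarith
    linarith
  have m1 : s * τ ^ 2 * (1 - A * s ^ 2) ≤ D * (1 - A * s ^ 2) :=
    mul_le_mul_of_nonneg_right hD' (by linarith)
  have a1 : 2 * A * (x * (s * τ)) ≤ c / 4 * x ^ 2 + s ^ 2 * (4 * A ^ 2 / c) * τ ^ 2 := by
    have : c / 4 * x ^ 2 + s ^ 2 * (4 * A ^ 2 / c) * τ ^ 2 - 2 * A * (x * (s * τ)) =
        (c * x - 4 * A * s * τ) ^ 2 / (4 * c) := by field_simp; ring
    have h4 : 0 ≤ (c * x - 4 * A * s * τ) ^ 2 / (4 * c) := by positivity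
    linarith
  have a2 : 2 * A * (x * (s * y)) ≤ c / 4 * x ^ 2 + s ^ 2 * (4 * A ^ 2 / c) * y ^ 2 := by
    have : c / 4 * x ^ 2 + s ^ 2 * (4 * A ^ 2 / c) * y ^ 2 - 2 * A * (x * (s * y)) =
        (c * x - 4 * A * s * y) ^ 2 / (4 * c) := by field_simp; ring
    have h4 : 0 ≤ (c * x - 4 * A * s * y) ^ 2 / (4 * c) := by positivity
    linarith
  have a2' : 0 ≤ A * (x * (s * y)) := by positivity
  have a3 : s * A * x ^ 2 ≤ c / 4 * x ^ 2 := by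
    gcongr
    linarith
  have a4 : s ^ 2 * A * (τ * y) ≤ s ^ 2 * A * (τ ^ 2 + y ^ 2) := by
    gcongr
    have h2 : 0 ≤ (τ - y) ^ 2 := sq_nonneg _
    have h3 : 0 ≤ τ ^ 2 + y ^ 2 := by positivity
    linarith
  have a5 : s * (2 * (A * x * (s * τ))) ≤ 1 / 2 * (2 * (A * x * (s * τ))) := by
    gcongr
  have a6 : s * (s ^ 2 * A * τ ^ 2) ≤ 1 * (s ^ 2 * A * τ ^ 2) := by gcongr
  have a7 : s ^ 2 * (4 * A + 4 * A ^ 2 / c) * (τ ^ 2 + y ^ 2) ≤ s * r * (τ ^ 2 + y ^ 2) := by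
    have := mul_le_mul_of_nonneg_left hr (show 0 ≤ s * (τ ^ 2 + y ^ 2) by positivity)
    linarith
  have a8 : τ ^ 2 + y ^ 2 ≤ 2 * (τ - l) ^ 2 + (2 * B ^ 2 + 1) * y ^ 2 := by
    have h1 : l ^ 2 ≤ (B * y) ^ 2 := by gcongr
    have h2 : 0 ≤ (τ - 2 * l) ^ 2 := sq_nonneg _
    linarith
  have a9 : s * (r * (τ ^ 2 + y ^ 2)) ≤ s * (1 / 2 * (τ - l) ^ 2 + c / 4 * y ^ 2) := by
    gcongr
    have h1 := mul_le_mul_of_nonneg_left a8 hr0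
    have h2 : r * 4 * (τ - l) ^ 2 ≤ 1 * (τ - l) ^ 2 := by gcongr
    have h3 : r * (2 * B ^ 2 + 1) * y ^ 2 ≤ c / 4 * y ^ 2 := by gcongr
    linarith
  have fin : 0 < s * (1 / 2 * (τ - l) ^ 2 + c / 4 * y ^ 2) + c / 4 * x ^ 2 := by
    by_cases hy0 : y = 0
    · have hl0 : l = 0 := le_antisymm (by simpa [hy0] using hly) hl
      rcases hne with h | h | h
      · rw [hl0, sub_zero]
        positivity
      · positivity
      · exact absurd hy0 h
    · positivity
  have b1 : 0 ≤ s ^ 2 * A * y ^ 2 := by positivity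
  have b2 : 0 ≤ s ^ 2 * A * τ ^ 2 := by positivity
  have b3 : 0 ≤ s ^ 2 * (4 * A ^ 2 / c) * y ^ 2 := by positivity
  have b4 : 0 ≤ s ^ 2 * (4 * A ^ 2 / c) * τ ^ 2 := by positivity
  linarith only [m1, a1, a2, a2', a3, a4, a5, a6, a7, a9, fin, b1, b2, b3, b4]

/-- In the application `D` is the Dirichlet integral, `t = ‖p(s) - p(0)‖`, `l = ‖L₀ z‖`, and `x`,
`y` are the norms of the components in the positive space of B and in ker B. -/
lemma exists_forall_quadratic_pos {c A B : ℝ} (hc : 0 < c) (hA : 0 ≤ A) :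
    ∃ s₀ > 0, ∀ s, 0 < s → s ≤ s₀ → ∀ D t l x y : ℝ, 0 ≤ t → 0 ≤ x → 0 ≤ y → 0 ≤ l →
      t ^ 2 ≤ s * D → l ≤ B * y → (t ≠ 0 ∨ x ≠ 0 ∨ y ≠ 0) →
      0 < D * (1 - A * s ^ 2) - 2 * l * t + s * l ^ 2 + c / 2 * s * y ^ 2 + c * x ^ 2 -
        A * (x * t + t ^ 2) - A * s * ((x + t) * (x + t + y)) := by
  set R := 8 * A + 16 * A ^ 2 / c + 1 with hR
  have hR0 : 0 < R := by positivity
  -- The single condition `s S ≤ 1` yields `s ≤ 1 / 2` and, for `r = s R`, all the smallness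
  -- conditions on `r` used in `quadratic_pos_aux`.
  set S := R * (4 + (4 * (2 * B ^ 2 + 1) + 8) / c) + 1 with hS
  have hS0 : 0 < S := by positivity
  refine ⟨1 / S, by positivity, fun s hs hs₀ D t l x y ht hx hy hl hD hly hne => ?_⟩
  rw [le_div_iff₀ (by positivity)] at hs₀
  have e1 : 0 ≤ R * ((4 * (2 * B ^ 2 + 1) + 8) / c) := by positivity
  have k0 : s * R * 4 ≤ 1 := by nlinarith
  have k1 : s * R * (4 * (2 * B ^ 2 + 1) + 8) ≤ c := by
    have : s * (R * ((4 * (2 * B ^ 2 + 1) + 8) / c)) ≤ 1 := by nlinarith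
    calc s * R * (4 * (2 * B ^ 2 + 1) + 8)
        = s * (R * ((4 * (2 * B ^ 2 + 1) + 8) / c)) * c := by field_simp
      _ ≤ 1 * c := by gcongr
      _ = c := one_mul c
  have hS5 : 5 ≤ S := by
    have : 0 ≤ 8 * A + 16 * A ^ 2 / c := by positivity
    rw [hS]
    linarith
  have hs2 : s ≤ 1 / 2 := by nlinarith
  have hs1 : s ≤ 1 := by linarith
  obtain ⟨τ, rfl⟩ : ∃ τ, t = s * τ := ⟨t / s, by field_simp⟩
  have hτ : 0 ≤ τ := nonneg_of_mul_nonneg_right ht hs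
  have hRA : 8 * A ≤ R := by
    have : 0 ≤ 16 * A ^ 2 / c := by positivity
    linarith
  obtain ⟨r, hr⟩ : ∃ r, r = s * R := ⟨_, rfl⟩
  have hr0 : 0 ≤ r := by rw [hr]; positivity
  rw [← hr] at k0 k1
  have hsAr : 8 * (s * A) ≤ r := by
    rw [hr]
    have := mul_le_mul_of_nonneg_left hRA hs.le
    linarith
  have k2 : r * 8 ≤ c := by
    have : 0 ≤ r * (4 * (2 * B ^ 2 + 1)) := by positivity
    linarith
  have k3 : r * (2 * B ^ 2 + 1) ≤ c / 4 := by linarith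
  refine quadratic_pos_aux hc hA hs hs2 hr0 hsAr ?_ (by linarith) k2 k3 hτ hx hy hl hD hly ?_
  · rw [hr]
    gcongr
    rw [hR]
    have h1 : 4 * A ^ 2 / c ≤ 16 * A ^ 2 / c := by gcongr; norm_num
    linarith
  · exact hne.imp_left fun h h' => h (by rw [h', mul_zero])

end Real

end

end MaslovMorse

namespace MaslovMorse

noncomputable section

open Topology Filter Set Module QuadraticMap

/-! ### Sign of the form at λ = 0 for small s. -/

section Asymptotics

variable {E : Type*} [NormedAddCommGroup E] [InnerProductSpace ℝ E] [FiniteDimensional ℝ E]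

lemma exists_pos_mul_norm_sq_le_inner (T : E →L[ℝ] E) {S : Submodule ℝ E}
    (hS : ∀ x ∈ S, x ≠ 0 → 0 < inner ℝ (T x) x) : ∃ c > 0, ∀ x ∈ S, c * ‖x‖ ^ 2 ≤ inner ℝ (T x) x :=
  exists_pos_mul_norm_sq_le (B₀ := (innerₗ E).comp T.toLinearMap) hS

/-- Disjoint subspaces meet at a positive angle. -/
lemma exists_norm_le_mul_norm_add {S K : Submodule ℝ E} (h : S ⊓ K = ⊥) :
    ∃ C ≥ 0, ∀ g ∈ S, ∀ k ∈ K, ‖g‖ ≤ C * ‖g + k‖ := by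
  have hP : ∀ x, inner ℝ (Kᗮ.starProjection x) x = ‖Kᗮ.starProjection x‖ ^ 2 := fun x => by
    rw [← real_inner_self_eq_norm_sq, ← Submodule.inner_starProjection_left_eq_right,
      Submodule.starProjection_eq_self_iff.2 (Submodule.starProjection_apply_mem _ _)]
  -- The projection onto the complement of `K` kills only `K`, so its quadratic form is positive
  -- definite, hence coercive, on `S`.
  obtain ⟨c, hc, hcS⟩ := exists_pos_mul_norm_sq_le_inner Kᗮ.starProjection (S := S)
    fun x hx hx0 => by
      have h0 : Kᗮ.starProjection x ≠ 0 := fun h0 => hx0 <| by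
        rw [Submodule.starProjection_apply_eq_zero_iff, Submodule.orthogonal_orthogonal] at h0
        exact (Submodule.mem_bot ℝ).1 (h ▸ ⟨hx, h0⟩)
      rw [hP]
      positivity
  refine ⟨1 / √c, by positivity, fun g hg k hk => ?_⟩
  rw [one_div, ← div_eq_inv_mul, le_div_iff₀ (by positivity)]
  refine le_of_sq_le_sq ?_ (norm_nonneg _)
  have h1 := hcS g hg
  have h2 : Kᗮ.starProjection g = Kᗮ.starProjection (g + k) := by
    have hk0 : Kᗮ.starProjection k = 0 := by
      rwa [Submodule.starProjection_apply_eq_zero_iff, Submodule.orthogonal_orthogonal]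
    rw [map_add, hk0, add_zero]
  have h3 : ‖Kᗮ.starProjection (g + k)‖ ≤ ‖g + k‖ := Submodule.norm_starProjection_apply_le _ _
  rw [hP, h2] at h1
  rw [mul_pow, Real.sq_sqrt hc.le, mul_comm]
  exact h1.trans (by gcongr)

variable {V : C(ℝ, E →L[ℝ] E)} (b₀ b₁ : RobinBC E)

/-- By minimality the form is bounded above by the energy of the trial function `x ↦ y + z + (x - s)
L₀ z`. Its leading part is `⟪(L₀ - L₁) y, y⟫ + s (⟪V 0 z, z⟫ - ‖L₀ z‖²)`; there is no mixed term of
order 1 because `L₀ z = L₁ z`. -/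
lemma eventually_form_neg (hV : ∀ x y z, inner ℝ (V x y) z = inner ℝ y (V x z))
    {NB NQ : Submodule ℝ E} (hNB : NB ≤ b₀.K) (hNQ : NQ ≤ b₀.K)
    (hL : ∀ y ∈ NQ, b₀.L y = b₁.L y)
    (negB : ∀ y ∈ NB, y ≠ 0 → inner ℝ (b₀.L y) y - inner ℝ (b₁.L y) y < 0)
    (negQ : ∀ y ∈ NQ, y ≠ 0 → inner ℝ (V 0 y) y - ‖b₀.L y‖ ^ 2 < 0) :
    ∃ s₁ > 0, ∀ s ∈ Ioc (0 : ℝ) 1, s ≤ s₁ → ∀ y ∈ NB, ∀ z ∈ NQ, (y ≠ 0 ∨ z ≠ 0) → ∀ c,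
      solP V b₀ 0 s c = y + z →
        inner ℝ (solQ V b₀ 0 s c) (y + z) - inner ℝ (b₁.L (y + z)) (y + z) < 0 := by
  obtain ⟨v, hv0, hv⟩ := exists_norm_le_Icc V
  obtain ⟨c₁, hc₁, hB⟩ := exists_pos_mul_norm_sq_le_inner (b₁.L - b₀.L) (S := NB)
    fun y hy hy0 => by
      have := negB y hy hy0
      rw [sub_apply, inner_sub_left]
      linarith
  obtain ⟨c₂, hc₂, hQ⟩ := exists_pos_mul_norm_sq_le_inner (b₀.L * b₀.L - V 0) (S := NQ)
    fun y hy hy0 => by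
      have := negQ y hy hy0
      rw [sub_apply, inner_sub_left, mul_apply_eq_comp, b₀.symm,
        real_inner_self_eq_norm_sq]
      linarith
  set γ := min c₁ c₂ with hγ
  have hγ0 : 0 < γ := lt_min hc₁ hc₂
  -- With `δ = γ / 4` the error in the potential costs at most `s γ / 2 (‖y‖² + ‖z‖²)`, which leaves
  -- half of the gain `γ s ‖z‖²`.
  obtain ⟨C, hC, s₂, hs₂, hpot⟩ := exists_abs_potential_sub_le V (δ := γ / 4) (by positivity)
  set l := ‖b₀.L‖ with hl
  have hl0 : 0 ≤ l := norm_nonneg _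
  set A := γ + 2 * v + 2 * l ^ 2 + l ^ 3 + C * l ^ 2 with hA
  obtain ⟨s₃, hs₃, hreal⟩ := exists_forall_quadratic_neg (c := γ) (A := A) hγ0 (by positivity)
  refine ⟨min (min s₂ s₃) (1 / (v + l + 1)), by positivity, fun s hs hss y hy z hz hyz c hc => ?_⟩
  have hs0 := hs.1
  have hs1 := hs.2
  have hss2 : s ≤ s₂ := hss.trans ((min_le_left _ _).trans (min_le_left _ _))
  have hss3 : s ≤ s₃ := hss.trans ((min_le_left _ _).trans (min_le_right _ _))
  have hsm : (v + l) * s < 1 := by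
    have := hss.trans (min_le_right _ _)
    rw [le_div_iff₀ (by positivity)] at this
    linarith
  -- For `y = 0` this slope minimizes `s ‖w‖² - 2 s ⟪L₀ z, w⟫`, the slope-dependent part of the
  -- energy at order s; the minimum is the term `-s ‖L₀ z‖²`.
  set w := b₀.L z with hw
  have hp : IsC1 s (fun x => y + z + (x - s) • w) (fun _ => w) :=
    ⟨fun x _ => by simpa using ((((hasDerivAt_id x).sub_const s).smul_const w).const_add (y + z)),
      continuousOn_const⟩
  have hen := energy_sol_le b₀ hV hv hs hsm c hp
    (b₀.K.add_mem (b₀.K.add_mem (hNB hy) (hNQ hz)) (b₀.K.smul_mem _ (b₀.mem z))) (by simp [hc])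
  rw [hc] at hen
  have hpo := (abs_le.1 (hpot s hs hss2 _ _ hp)).2
  simp only [sub_self, zero_smul, add_zero, zero_sub] at hen hpo
  have hdir : dirichlet s (fun _ => w) = s * ‖w‖ ^ 2 := by simp [dirichlet]
  rw [hdir] at hen hpo
  have eL : inner ℝ (b₀.L (y + z + -s • w)) (y + z + -s • w) - inner ℝ (b₁.L (y + z)) (y + z) =
      inner ℝ (b₀.L y) y - inner ℝ (b₁.L y) y - 2 * s * inner ℝ (b₀.L y) w - 2 * s * ‖w‖ ^ 2 +
        s ^ 2 * inner ℝ (b₀.L w) w := by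
    have h1 : inner ℝ (b₀.L w) y = inner ℝ (b₀.L y) w := by rw [b₀.symm, real_inner_comm]
    have h2 : inner ℝ (b₀.L w) z = ‖w‖ ^ 2 := by
      rw [b₀.symm, ← hw, real_inner_self_eq_norm_sq]
    have h3 : inner ℝ (b₁.L y) z = inner ℝ w y := by
      rw [b₁.symm, ← hL z hz, real_inner_comm]
    have h4 : inner ℝ (b₀.L y) z = inner ℝ w y := by rw [b₀.symm, ← hw, real_inner_comm]
    have h5 : b₁.L z = w := (hL z hz).symm
    simp only [map_add, map_smul, inner_add_left, inner_add_right, inner_smul_left,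
      inner_smul_right, conj_trivial, ← hw, h1, h2, h3, h4, h5, real_inner_self_eq_norm_sq]
    ring
  have bB := hB y hy
  have bQ := hQ z hz
  rw [sub_apply, inner_sub_left] at bB bQ
  rw [mul_apply_eq_comp, b₀.symm, ← hw, real_inner_self_eq_norm_sq] at bQ
  have eV : inner ℝ (V 0 (y + z)) (y + z) =
      inner ℝ (V 0 z) z + 2 * inner ℝ (V 0 y) z + inner ℝ (V 0 y) y := by
    have h1 : inner ℝ (V 0 z) y = inner ℝ (V 0 y) z := by rw [hV, real_inner_comm]
    simp only [map_add, inner_add_left, inner_add_right, h1]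
    ring
  have hV0 := hv 0 ⟨le_rfl, zero_le_one⟩
  have hwn : ‖w‖ ≤ l * ‖z‖ := b₀.L.le_opNorm z
  have v1 : inner ℝ (V 0 y) z ≤ v * ‖y‖ * ‖z‖ :=
    (le_abs_self _).trans ((abs_inner_le (V 0) y z).trans (by gcongr))
  have v2 : inner ℝ (V 0 y) y ≤ v * ‖y‖ * ‖y‖ :=
    (le_abs_self _).trans ((abs_inner_le (V 0) y y).trans (by gcongr))
  have v3 : -(l * ‖y‖ * (l * ‖z‖)) ≤ inner ℝ (b₀.L y) w :=
    neg_le.1 ((neg_le_abs _).trans ((abs_inner_le b₀.L y w).trans (by gcongr)))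
  have v4 : inner ℝ (b₀.L w) w ≤ l * (l * ‖z‖) * (l * ‖z‖) :=
    (le_abs_self _).trans ((abs_inner_le b₀.L w w).trans (by gcongr))
  have v5 : ‖w‖ ^ 2 ≤ (l * ‖z‖) ^ 2 := by gcongr
  have v6 : ‖y + z‖ ^ 2 ≤ (‖y‖ + ‖z‖) ^ 2 := by
    gcongr
    exact norm_add_le y z
  have hr := hreal s hs0 hss3 ‖y‖ ‖z‖ (by simpa using hyz)
  have g1 : γ * ‖y‖ ^ 2 ≤ c₁ * ‖y‖ ^ 2 := by gcongr; exact min_le_left _ _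
  have g2 : γ * ‖z‖ ^ 2 ≤ c₂ * ‖z‖ ^ 2 := by gcongr; exact min_le_right _ _
  set β := ‖y‖
  set ζ := ‖z‖
  have hβ : 0 ≤ β := norm_nonneg y
  have hζ : 0 ≤ ζ := norm_nonneg z
  have g3 : s * (γ / 4 * ‖y + z‖ ^ 2) ≤ s * (γ / 4 * (2 * (β ^ 2 + ζ ^ 2))) := by
    gcongr
    linarith [add_sq_le (a := β) (b := ζ)]
  have g4 : s ^ 2 * (s * (C * ‖w‖ ^ 2)) ≤ s ^ 2 * (1 * (C * (l * ζ) ^ 2)) := by gcongr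
  have g5 : s * (inner ℝ (V 0 (y + z)) (y + z)) ≤
      s * (‖w‖ ^ 2 - γ * ζ ^ 2 + 2 * (v * β * ζ) + v * β * β) := by
    gcongr
    linarith
  have g6 : s * -(l * β * (l * ζ)) ≤ s * inner ℝ (b₀.L y) w := by gcongr
  have g7 : s ^ 2 * inner ℝ (b₀.L w) w ≤ s ^ 2 * (l * (l * ζ) * (l * ζ)) := by gcongr
  have r1 : A * s * β ^ 2 = (γ + v) * s * β ^ 2 + (v + 2 * l ^ 2 + l ^ 3 + C * l ^ 2) * s * β ^ 2 := by
    rw [hA]; ring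
  have r2 : A * s * (β * ζ) = (2 * v + 2 * l ^ 2) * s * (β * ζ) +
      (γ + l ^ 3 + C * l ^ 2) * s * (β * ζ) := by
    rw [hA]; ring
  have r3 : A * s ^ 2 * ζ ^ 2 = (l ^ 3 + C * l ^ 2) * s ^ 2 * ζ ^ 2 +
      (γ + 2 * v + 2 * l ^ 2) * s ^ 2 * ζ ^ 2 := by
    rw [hA]; ring
  have p1 : 0 ≤ (v + 2 * l ^ 2 + l ^ 3 + C * l ^ 2) * s * β ^ 2 := by positivity
  have p2 : 0 ≤ (γ + l ^ 3 + C * l ^ 2) * s * (β * ζ) := by positivity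
  have p3 : 0 ≤ (γ + 2 * v + 2 * l ^ 2) * s ^ 2 * ζ ^ 2 := by positivity
  have p4 : 0 ≤ γ * s * β ^ 2 := by positivity
  rw [r1, r2, r3] at hr
  clear_value A γ β ζ l
  linarith

-- A lower bound needs the solution itself. With `d = p(s) - p(0)` one has `‖d‖² ≤ s D`, and `‖g‖`
-- is bounded by a multiple of `‖d‖`, because `g` differs from `d` by an element of `K₀` and `S`
-- meets `K₀` only in zero. The terms `D - 2 ⟪L₀ z, d⟫ + s ‖L₀ z‖²` are nonnegative by completing
-- the square, where the last one is extracted from `s ⟪V 0 z, z⟫` by positivity of `V 0 - L₀²`; the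
-- strict gains in `y` and `z` remain.
set_option maxHeartbeats 1000000 in
lemma eventually_form_pos (hV : ∀ x y z, inner ℝ (V x y) z = inner ℝ y (V x z))
    {S PB PQ : Submodule ℝ E} (hS : S ⊓ b₀.K = ⊥) (hPB : PB ≤ b₀.K) (hPQ : PQ ≤ b₀.K)
    (hL : ∀ y ∈ PQ, b₀.L y = b₁.L y)
    (posB : ∀ y ∈ PB, y ≠ 0 → 0 < inner ℝ (b₀.L y) y - inner ℝ (b₁.L y) y)
    (posQ : ∀ y ∈ PQ, y ≠ 0 → 0 < inner ℝ (V 0 y) y - ‖b₀.L y‖ ^ 2) :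
    ∃ s₁ > 0, ∀ s ∈ Ioc (0 : ℝ) 1, s ≤ s₁ → ∀ g ∈ S, ∀ y ∈ PB, ∀ z ∈ PQ,
      (g ≠ 0 ∨ y ≠ 0 ∨ z ≠ 0) → ∀ c, solP V b₀ 0 s c = g + y + z →
        0 < inner ℝ (solQ V b₀ 0 s c) (g + y + z) -
          inner ℝ (b₁.L (g + y + z)) (g + y + z) := by
  obtain ⟨v, hv0, hv⟩ := exists_norm_le_Icc V
  obtain ⟨C₁, hC₁, hangle⟩ := exists_norm_le_mul_norm_add hS
  obtain ⟨c₁, hc₁, hB⟩ := exists_pos_mul_norm_sq_le_inner (b₀.L - b₁.L) (S := PB)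
    fun y hy hy0 => by
      have := posB y hy hy0
      rw [sub_apply, inner_sub_left]
      linarith
  obtain ⟨c₂, hc₂, hQ⟩ := exists_pos_mul_norm_sq_le_inner (V 0 - b₀.L * b₀.L) (S := PQ)
    fun y hy hy0 => by
      have := posQ y hy hy0
      rw [sub_apply, inner_sub_left, mul_apply_eq_comp, b₀.symm,
        real_inner_self_eq_norm_sq]
      linarith
  set γ := min c₁ c₂ with hγ
  have hγ0 : 0 < γ := lt_min hc₁ hc₂
  obtain ⟨C, hC, s₂, hs₂, hpot⟩ := exists_abs_potential_sub_le V (δ := γ / 4) (by positivity)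
  set l := ‖b₀.L‖ with hl
  have hl0 : 0 ≤ l := norm_nonneg _
  set m := ‖b₀.L - b₁.L‖ with hm
  have hm0 : 0 ≤ m := norm_nonneg _
  set a := C₁ + 1 with ha
  have ha0 : 1 ≤ a := by linarith
  set A := C + 2 * m * a ^ 2 + 2 * l * a + l + (2 * v + γ) * a ^ 2 with hA
  obtain ⟨s₃, hs₃, hreal⟩ := exists_forall_quadratic_pos (c := γ) (A := A) (B := l) hγ0
    (by positivity)
  refine ⟨min s₂ s₃, by positivity, fun s hs hss g hg y hy z hz hne c hc => ?_⟩
  have hs0 := hs.1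
  have hs1 := hs.2
  have hsol := isC1_sol (V := V) b₀ hs 0 c
  have hen := energy_sol (V := V) b₀ hs 0 c
  have hpo := (abs_le.1 (hpot s hs (hss.trans (min_le_left _ _)) _ _ hsol)).1
  have hdist := hsol.norm_sub_sq_le hs0 (right_mem_Icc.2 hs0.le) (left_mem_Icc.2 hs0.le)
  have hp0 : solP V b₀ 0 0 c ∈ b₀.K := by
    rw [solP_zero]
    exact (b₀.holds_param c).1
  rw [hc] at hen hpo hdist
  set p₀ := solP V b₀ 0 0 c
  set D := dirichlet s (fun x => solQ V b₀ 0 x c)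
  obtain ⟨d, hd⟩ : ∃ d, d = g + y + z - p₀ := ⟨_, rfl⟩
  have hgd : ‖g‖ ≤ C₁ * ‖d‖ := by
    have := hangle g hg (y + z - p₀) (b₀.K.sub_mem (b₀.K.add_mem (hPB hy) (hPQ hz)) hp0)
    rwa [show g + (y + z - p₀) = d by rw [hd]; abel] at this
  have hp₀ : p₀ = g + y + z - d := by rw [hd]; abel
  rw [← hd] at hdist
  rw [zero_mul, sub_zero, hp₀] at hen
  set w := b₀.L z with hw
  obtain ⟨u, hu⟩ : ∃ u, u = g + y := ⟨_, rfl⟩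
  have bB := hB y hy
  have bQ := hQ z hz
  rw [mul_comm] at bQ
  rw [sub_apply, inner_sub_left, mul_apply_eq_comp, b₀.symm _ z, ← hw,
    real_inner_self_eq_norm_sq] at bQ
  have eL : inner ℝ (b₀.L (g + y + z - d)) (g + y + z - d) -
      inner ℝ (b₁.L (g + y + z)) (g + y + z) =
      inner ℝ ((b₀.L - b₁.L) y) y + 2 * inner ℝ ((b₀.L - b₁.L) g) y +
        inner ℝ ((b₀.L - b₁.L) g) g - 2 * inner ℝ (b₀.L u) d - 2 * inner ℝ w d +
        inner ℝ (b₀.L d) d := by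
    have h1 : ∀ x, inner ℝ w x = inner ℝ (b₀.L x) z := fun x => by
      rw [b₀.symm x z, ← hw, real_inner_comm]
    have h2 : ∀ x, inner ℝ (b₁.L x) z = inner ℝ (b₀.L x) z := fun x => by
      rw [b₁.symm, ← hL z hz, ← hw, real_inner_comm, h1]
    have h3 : b₁.L z = w := (hL z hz).symm
    have h4 : ∀ x x', inner ℝ (b₀.L x) x' = inner ℝ (b₀.L x') x := fun x x' => by
      rw [b₀.symm, real_inner_comm]
    have h5 : inner ℝ (b₁.L y) g = inner ℝ (b₁.L g) y := by
      rw [b₁.symm, real_inner_comm]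
    rw [hu]
    simp only [map_add, map_sub, inner_add_left, inner_add_right, inner_sub_left,
      inner_sub_right, ← hw, h1, h2, h3, h5, sub_apply, h4 y g, h4 d g, h4 d y]
    ring
  have eV : inner ℝ (V 0 (g + y + z)) (g + y + z) =
      inner ℝ (V 0 z) z + 2 * inner ℝ (V 0 u) z + inner ℝ (V 0 u) u := by
    have h1 : inner ℝ (V 0 z) u = inner ℝ (V 0 u) z := by rw [hV, real_inner_comm]
    rw [← hu]
    simp only [map_add, inner_add_left, inner_add_right, h1]
    ring
  have hV0 := hv 0 ⟨le_rfl, zero_le_one⟩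
  have hwn : ‖w‖ ≤ l * ‖z‖ := b₀.L.le_opNorm z
  obtain ⟨t, ht⟩ : ∃ t, t = ‖d‖ := ⟨_, rfl⟩
  have ht0 : 0 ≤ t := ht ▸ norm_nonneg d
  have hr := hreal s hs0 (hss.trans (min_le_right _ _)) D t ‖w‖ ‖y‖ ‖z‖ ht0
    (norm_nonneg _) (norm_nonneg _) (norm_nonneg _) (ht ▸ hdist) hwn (by
      -- The scalar inequality does not see `g`; a nonzero `g` forces `d ≠ 0` by `hgd`.
      rcases hne with h | h | h
      · left
        rintro rfl
        rw [← ht, mul_zero] at hgd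
        exact h (norm_le_zero_iff.1 hgd)
      · simp [h]
      · simp [h])
  rw [← ht] at hgd
  have hga : ‖g‖ ≤ a * t := hgd.trans (by rw [ha]; linarith)
  have hua : ‖u‖ ≤ a * (‖y‖ + t) := by
    have h1 : ‖u‖ ≤ ‖g‖ + ‖y‖ := hu ▸ norm_add_le g y
    have h2 : 1 * ‖y‖ ≤ a * ‖y‖ := by gcongr
    linarith
  have v1 := (neg_le_abs _).trans ((abs_inner_le (V 0) u z).trans
    (show _ ≤ v * (a * (‖y‖ + t)) * ‖z‖ by gcongr))
  have v2 := (neg_le_abs _).trans ((abs_inner_le (V 0) u u).trans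
    (show _ ≤ v * (a * (‖y‖ + t)) * (a * (‖y‖ + t)) by gcongr))
  have v3 := (neg_le_abs _).trans ((abs_inner_le (b₀.L - b₁.L) g y).trans
    (show _ ≤ m * (a * t) * ‖y‖ by gcongr))
  have v4 := (neg_le_abs _).trans ((abs_inner_le (b₀.L - b₁.L) g g).trans
    (show _ ≤ m * (a * t) * (a * t) by gcongr))
  have v5 := (le_abs_self _).trans ((abs_inner_le b₀.L u d).trans
    (show _ ≤ l * (a * (‖y‖ + t)) * t by rw [ht]; rw [ht] at hua; gcongr))
  have v6 := (neg_le_abs _).trans ((abs_inner_le b₀.L d d).trans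
    (show _ ≤ l * t * t by rw [ht]))
  have v7 : inner ℝ w d ≤ ‖w‖ * t := ht ▸ real_inner_le_norm w d
  have v8 : ‖g + y + z‖ ^ 2 ≤ (a * (‖y‖ + t) + ‖z‖) ^ 2 := by
    rw [← hu]
    gcongr
    exact (norm_add_le u z).trans (by gcongr)
  have g1 : γ * ‖y‖ ^ 2 ≤ c₁ * ‖y‖ ^ 2 := by gcongr; exact min_le_left _ _
  have g2 : γ * ‖z‖ ^ 2 ≤ ‖z‖ ^ 2 * c₂ := by rw [mul_comm]; gcongr; exact min_le_right _ _
  set β := ‖y‖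
  set ζ := ‖z‖
  set ω := ‖w‖
  have hβ : 0 ≤ β := norm_nonneg y
  have hζ : 0 ≤ ζ := norm_nonneg z
  have hD : 0 ≤ D := dirichlet_nonneg hs0.le _
  have g3 : s * (γ / 4 * ‖g + y + z‖ ^ 2) ≤ s * (γ / 4 * (2 * ((a * (β + t)) ^ 2 + ζ ^ 2))) := by
    gcongr
    exact v8.trans add_sq_le
  have g5 : s * (ω ^ 2 + γ * ζ ^ 2 - 2 * (v * (a * (β + t)) * ζ) -
      v * (a * (β + t)) * (a * (β + t))) ≤ s * (inner ℝ (V 0 (g + y + z)) (g + y + z)) := by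
    gcongr
    linarith
  have aa : a ≤ a ^ 2 := by nlinarith
  have q1 : A * (β * t + t ^ 2) =
      2 * m * a ^ 2 * (β * t) + m * a ^ 2 * t ^ 2 + 2 * l * a * (β * t + t ^ 2) + l * t ^ 2 +
        ((C + (2 * v + γ) * a ^ 2 + l) * (β * t) +
          (C + m * a ^ 2 + (2 * v + γ) * a ^ 2) * t ^ 2) := by
    rw [hA]; ring
  have q2 : A * s * ((β + t) * (β + t + ζ)) = s * ((v + γ / 2) * a ^ 2 * (β + t) ^ 2) +
      s * (2 * v * a ^ 2 * ((β + t) * ζ)) +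
      s * ((C + 2 * m * a ^ 2 + 2 * l * a + l + (v + γ / 2) * a ^ 2) * (β + t) ^ 2 +
        (C + 2 * m * a ^ 2 + 2 * l * a + l + γ * a ^ 2) * ((β + t) * ζ)) := by
    rw [hA]; ring
  have q3 : D * (1 - A * s ^ 2) = D - C * s ^ 2 * D -
      (2 * m * a ^ 2 + 2 * l * a + l + (2 * v + γ) * a ^ 2) * s ^ 2 * D := by
    rw [hA]; ring
  have p1 : 0 ≤ (C + (2 * v + γ) * a ^ 2 + l) * (β * t) +
          (C + m * a ^ 2 + (2 * v + γ) * a ^ 2) * t ^ 2 := by positivity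
  have p2 : 0 ≤ s * ((C + 2 * m * a ^ 2 + 2 * l * a + l + (v + γ / 2) * a ^ 2) * (β + t) ^ 2 +
        (C + 2 * m * a ^ 2 + 2 * l * a + l + γ * a ^ 2) * ((β + t) * ζ)) := by positivity
  have p3 : 0 ≤ (2 * m * a ^ 2 + 2 * l * a + l + (2 * v + γ) * a ^ 2) * s ^ 2 * D := by positivity
  have p4 : s * (2 * v * a * ((β + t) * ζ)) ≤ s * (2 * v * a ^ 2 * ((β + t) * ζ)) := by gcongr
  have p5 : 2 * (m * (a * t) * β) ≤ 2 * m * a ^ 2 * (β * t) := by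
    have := mul_le_mul_of_nonneg_left aa (show 0 ≤ m * t * β by positivity)
    linarith
  rw [q1, q2, q3] at hr
  clear_value A γ β ζ l m a D ω
  linarith only [hen, eL, hpo, g3, g5, bB, g1, v3, v4, v5, v6, v7, hr, p1, p2, p3, p4, p5]

end Asymptotics

end

end MaslovMorse

namespace MaslovMorse

noncomputable section

open Topology Filter Set Module QuadraticMap QuadraticForm

/-! ### Negative index of the form at λ = 0. -/

section SigNeg

variable {E : Type*} [NormedAddCommGroup E] [InnerProductSpace ℝ E] [FiniteDimensional ℝ E]

/-- The chart form of the boundary value problem on `[0, s]`. -/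
def shotForm (V : C(ℝ, E →L[ℝ] E)) (b₀ b₁ : RobinBC E) (s lam : ℝ) : QuadraticForm ℝ b₁.K :=
  chartForm (solP V b₀ lam s) (solQ V b₀ lam s - b₁.L * solP V b₀ lam s) b₁.K

lemma shotForm_apply {V : C(ℝ, E →L[ℝ] E)} {b₀ b₁ : RobinBC E} {s lam : ℝ}
    (h : IsUnit (solP V b₀ lam s)) {y : b₁.K} {c : E} (hc : solP V b₀ lam s c = y) :
    shotForm V b₀ b₁ s lam y = inner ℝ (solQ V b₀ lam s c) (y : E) - inner ℝ (b₁.L y) (y : E) := by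
  rw [shotForm, chartForm_apply, ← hc, inverse_apply_apply h, sub_apply, mul_apply_eq_comp,
    inner_sub_left]

lemma exists_forall_isUnit_solP (V : C(ℝ, E →L[ℝ] E)) (b : RobinBC E) :
    ∃ s₁ > 0, ∀ s ∈ Ioc (0 : ℝ) 1, s ≤ s₁ → ∀ lam ≤ 0, IsUnit (solP V b lam s) := by
  obtain ⟨v, hv0, hv⟩ := exists_norm_le_Icc V
  refine ⟨1 / (v + ‖b.L‖ + 1), by positivity, fun s hs hss lam hlam =>
    isUnit_solP b hv hs ?_ hlam⟩
  rw [le_div_iff₀ (by positivity)] at hss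
  linarith [hs.1]

/-- For small `s`, the negative index of the form of the boundary value problem at `λ = 0`. -/
lemma exists_forall_sigNeg_shotForm {V : C(ℝ, E →L[ℝ] E)}
    (hV : ∀ x y z, inner ℝ (V x y) z = inner ℝ y (V x z)) (b₀ b₁ : RobinBC E)
    {NB PB NQ PQ : Submodule ℝ E} (hNB : NB ≤ b₀.K ⊓ b₁.K) (hPB : PB ≤ b₀.K ⊓ b₁.K)
    (hNQ : NQ ≤ b₀.K ⊓ b₁.K) (hPQ : PQ ≤ b₀.K ⊓ b₁.K)
    (hLN : ∀ y ∈ NQ, b₀.L y = b₁.L y) (hLP : ∀ y ∈ PQ, b₀.L y = b₁.L y)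
    (negB : ∀ y ∈ NB, y ≠ 0 → inner ℝ (b₀.L y) y - inner ℝ (b₁.L y) y < 0)
    (posB : ∀ y ∈ PB, y ≠ 0 → 0 < inner ℝ (b₀.L y) y - inner ℝ (b₁.L y) y)
    (negQ : ∀ y ∈ NQ, y ≠ 0 → inner ℝ (V 0 y) y - ‖b₀.L y‖ ^ 2 < 0)
    (posQ : ∀ y ∈ PQ, y ≠ 0 → 0 < inner ℝ (V 0 y) y - ‖b₀.L y‖ ^ 2)
    (hdim : finrank ℝ NB + finrank ℝ PB + (finrank ℝ NQ + finrank ℝ PQ) =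
      finrank ℝ (b₀.K ⊓ b₁.K : Submodule ℝ E)) :
    ∃ s₁ > 0, ∀ s ∈ Ioc (0 : ℝ) 1, s ≤ s₁ →
      sigNeg (shotForm V b₀ b₁ s 0) = finrank ℝ NB + finrank ℝ NQ := by
  set K := b₀.K ⊓ b₁.K with hK
  -- The orthogonal complement of `K` inside `b₁.K`; a vector of it that lies in `b₀.K` lies in `K`,
  -- hence is orthogonal to itself.
  set S := Kᗮ ⊓ b₁.K with hS
  have hSK : S ⊓ b₀.K = ⊥ := by
    rw [eq_bot_iff]
    rintro x ⟨⟨h1, h2⟩, h3⟩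
    exact (Submodule.mem_bot ℝ).2 (inner_self_eq_zero.1 (h1 x ⟨h3, h2⟩ : inner ℝ x x = 0))
  obtain ⟨s₁, hs₁, hu⟩ := exists_forall_isUnit_solP V b₀
  obtain ⟨s₂, hs₂, hneg⟩ := eventually_form_neg b₀ b₁ hV (hNB.trans inf_le_left)
    (hNQ.trans inf_le_left) hLN negB negQ
  obtain ⟨s₃, hs₃, hpos⟩ := eventually_form_pos b₀ b₁ hV hSK (hPB.trans inf_le_left)
    (hPQ.trans inf_le_left) hLP posB posQ
  refine ⟨min s₁ (min s₂ s₃), by positivity, fun s hs hss => ?_⟩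
  have hT := hu s hs (hss.trans (min_le_left _ _)) 0 le_rfl
  have hss' := hss.trans (min_le_right _ _)
  have hneg' := hneg s hs (hss'.trans (min_le_left _ _))
  have hpos' := hpos s hs (hss'.trans (min_le_right _ _))
  have hval : ∀ y : b₁.K, ∃ c, solP V b₀ 0 s c = y := fun y => ⟨_, apply_inverse_apply hT y⟩
  -- The form is negative definite on the range of `f` and positive definite on the range of `g`,
  -- and their dimensions add up to that of `b₁.K`, so both index bounds are sharp.
  let f : (NB × NQ) →ₗ[ℝ] b₁.K := LinearMap.coprod
    (Submodule.inclusion (hNB.trans inf_le_right)) (Submodule.inclusion (hNQ.trans inf_le_right))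
  let g : (S × (PB × PQ)) →ₗ[ℝ] b₁.K := LinearMap.coprod
    (Submodule.inclusion inf_le_right) (LinearMap.coprod
    (Submodule.inclusion (hPB.trans inf_le_right)) (Submodule.inclusion (hPQ.trans inf_le_right)))
  have hf : ∀ x, x ≠ 0 → shotForm V b₀ b₁ s 0 (f x) < 0 := by
    rintro ⟨y, z⟩ hx
    obtain ⟨c, hc⟩ := hval (f (y, z))
    rw [shotForm_apply hT hc]
    refine hneg' y y.2 z z.2 ?_ c hc
    by_contra! h
    exact hx (Prod.ext (Subtype.ext h.1) (Subtype.ext h.2))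
  have hg : ∀ x, x ≠ 0 → 0 < shotForm V b₀ b₁ s 0 (g x) := by
    rintro ⟨w, y, z⟩ hx
    obtain ⟨c, hc⟩ := hval (g (w, y, z))
    have hgc : ((g (w, y, z) : b₁.K) : E) = w + y + z := by
      rw [add_assoc]; rfl
    rw [shotForm_apply hT hc, hgc]
    refine hpos' w w.2 y y.2 z z.2 ?_ c (hc.trans hgc)
    by_contra! h
    exact hx (Prod.ext (Subtype.ext h.1) (Prod.ext (Subtype.ext h.2.1) (Subtype.ext h.2.2)))
  -- Independence of the summands comes for free: a nonzero element of the kernel would give the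
  -- form a strict sign at zero.
  have hfi : Function.Injective f := (injective_iff_map_eq_zero f).2 fun x hx => by
    by_contra h0
    have := hf x h0
    rw [hx, map_zero] at this
    exact this.false
  have hgi : Function.Injective g := (injective_iff_map_eq_zero g).2 fun x hx => by
    by_contra h0
    have := hg x h0
    rw [hx, map_zero] at this
    exact this.false
  have h1 : finrank ℝ (LinearMap.range f) ≤ sigNeg (shotForm V b₀ b₁ s 0) := by
    apply finrank_le_sigNeg
    rintro _ ⟨x, rfl⟩ hx
    exact hf x fun h => hx (by rw [h, map_zero])
  have h2 : sigNeg (shotForm V b₀ b₁ s 0) + finrank ℝ (LinearMap.range g) ≤ finrank ℝ b₁.K := by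
    apply sigNeg_add_finrank_le_of_nonneg
    rintro _ ⟨x, rfl⟩
    by_cases h : x = 0
    · rw [h, map_zero, map_zero]
    · exact (hg x h).le
  rw [LinearMap.finrank_range_of_inj hfi, finrank_prod] at h1
  rw [LinearMap.finrank_range_of_inj hgi, finrank_prod, finrank_prod] at h2
  have h3 : finrank ℝ K + finrank ℝ S = finrank ℝ b₁.K :=
    Submodule.finrank_add_inf_finrank_orthogonal inf_le_right
  omega

lemma radical_opForm {T : E →ₗ[ℝ] E} (hT : T.IsSymmetric) :
    (opForm T).radical = LinearMap.ker T := by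
  ext y
  have hadd : ∀ k, opForm T (y + k) = opForm T y + 2 * inner ℝ (T y) k + opForm T k := by
    intro k
    simp only [opForm_apply, map_add, inner_add_left, inner_add_right]
    rw [hT k y, real_inner_comm (T y) k]
    ring
  rw [QuadraticMap.mem_radical_iff', LinearMap.mem_ker]
  constructor
  · rintro ⟨h0, h1⟩
    -- Testing against `T y` isolates `2 ‖T y‖²`.
    have := hadd (T y)
    rw [h1, h0] at this
    simpa using this
  · intro h
    have h0 : opForm T y = 0 := by rw [opForm_apply, h, inner_zero_left]
    refine ⟨h0, fun k => ?_⟩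
    rw [hadd, h0, h, inner_zero_left]
    ring

/-- Version in terms of the operators `B` and `Q (V(0) - L²) Q`. -/
lemma exists_forall_sigNeg_shotForm_eq {V : C(ℝ, E →L[ℝ] E)}
    (hV : ∀ x y z, inner ℝ (V x y) z = inner ℝ y (V x z)) (b₀ b₁ : RobinBC E)
    {B : (b₀.K ⊓ b₁.K : Submodule ℝ E) →ₗ[ℝ] (b₀.K ⊓ b₁.K : Submodule ℝ E)} (hB : B.IsSymmetric)
    (hB' : ∀ y, inner ℝ (B y) y = inner ℝ (b₀.L y) (y : E) - inner ℝ (b₁.L y) (y : E))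
    {N : Submodule ℝ E} (hN : N = (LinearMap.ker B).map (Submodule.subtype _))
    (hNL : ∀ y ∈ N, b₀.L y = b₁.L y)
    {R : N →ₗ[ℝ] N} (hR : R.IsSymmetric) (hR0 : ∀ y, R y = 0 → y = 0)
    (hR' : ∀ y : N, inner ℝ (R y) y = inner ℝ (V 0 y) (y : E) - ‖b₀.L y‖ ^ 2) :
    ∃ s₁ > 0, ∀ s ∈ Ioc (0 : ℝ) 1, s ≤ s₁ →
      sigNeg (shotForm V b₀ b₁ s 0) = mor B + mor R := by
  obtain ⟨NB, dNB, hNB⟩ := exists_submodule_neg (opForm B)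
  obtain ⟨PB, dPB, hPB⟩ := exists_submodule_pos (opForm B)
  obtain ⟨NR, dNR, hNR⟩ := exists_submodule_neg (opForm R)
  obtain ⟨PR, dPR, hPR⟩ := exists_submodule_pos (opForm R)
  have kB := sigPos_add_sigNeg_add_radical (Q := opForm B)
  have kR := sigPos_add_sigNeg_add_radical (Q := opForm R)
  rw [radical_opForm hB] at kB
  rw [radical_opForm hR, (LinearMap.ker_eq_bot' (f := R)).2 hR0, finrank_bot] at kR
  have hsub : ∀ {S : Submodule ℝ E} (T : Submodule ℝ S),
    finrank ℝ (T.map S.subtype) = finrank ℝ T := fun T =>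
      (Submodule.equivMapOfInjective _ (Submodule.injective_subtype _) T).symm.finrank_eq
  have hNK : N ≤ b₀.K ⊓ b₁.K := hN ▸ Submodule.map_subtype_le _ _
  have hNfin : finrank ℝ N = finrank ℝ (LinearMap.ker B) := by rw [hN, hsub]
  rw [mor_eq_sigNeg hB, mor_eq_sigNeg hR, ← dNB, ← dNR, ← hsub NB, ← hsub NR]
  refine exists_forall_sigNeg_shotForm hV b₀ b₁ (PB := PB.map (Submodule.subtype _))
    (PQ := PR.map (Submodule.subtype _)) (Submodule.map_subtype_le _ _)
    (Submodule.map_subtype_le _ _) ((Submodule.map_subtype_le _ _).trans hNK)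
    ((Submodule.map_subtype_le _ _).trans hNK)
    (fun y hy => hNL y (Submodule.map_subtype_le _ _ hy))
    (fun y hy => hNL y (Submodule.map_subtype_le _ _ hy)) ?_ ?_ ?_ ?_ ?_
  · rintro _ ⟨y, hy, rfl⟩ h0
    have := hNB y hy fun h => h0 (by rw [h]; rfl)
    rwa [opForm_apply, hB'] at this
  · rintro _ ⟨y, hy, rfl⟩ h0
    have := hPB y hy fun h => h0 (by rw [h]; rfl)
    rwa [opForm_apply, hB'] at this
  · rintro _ ⟨y, hy, rfl⟩ h0
    have := hNR y hy fun h => h0 (by rw [h]; rfl)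
    rwa [opForm_apply, hR'] at this
  · rintro _ ⟨y, hy, rfl⟩ h0
    have := hPR y hy fun h => h0 (by rw [h]; rfl)
    rwa [opForm_apply, hR'] at this
  -- Since `R` is nondegenerate, its definite subspaces fill out the dimension of the kernel of `B`,
  -- which is what the definite subspaces of `B` miss in `K`.
  · rw [hsub, hsub, hsub, hsub]
    omega

end SigNeg

end

end MaslovMorse

namespace MaslovMorse

noncomputable section

open Topology Filter Set Module QuadraticMap QuadraticForm

/-! ### From the matrices of the theorem to abstract Robin conditions. -/

section Bridge

variable {n : ℕ}

/-- The continuous linear map of a matrix. -/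
abbrev toCLM (A : Matrix (Fin n) (Fin n) ℝ) :
    EuclideanSpace ℝ (Fin n) →L[ℝ] EuclideanSpace ℝ (Fin n) :=
  (Matrix.toEuclideanLin A).toContinuousLinearMap

lemma toCLM_inner_of_isSymm {A : Matrix (Fin n) (Fin n) ℝ} (h : A.IsSymm)
    (x y : EuclideanSpace ℝ (Fin n)) : inner ℝ (toCLM A x) y = inner ℝ x (toCLM A y) := by
  have h1 : A.IsHermitian := by
    rw [Matrix.IsHermitian, Matrix.conjTranspose_eq_transpose_of_trivial, h]
  exact Matrix.isSymmetric_toEuclideanLin_iff.2 h1 x y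

lemma toEuclideanLin_eq_zero_iff {A : Matrix (Fin n) (Fin n) ℝ} {x : EuclideanSpace ℝ (Fin n)} :
    Matrix.toEuclideanLin A x = 0 ↔ A *ᵥ WithLp.ofLp x = 0 :=
  ⟨fun h => congrArg WithLp.ofLp h, fun h => congrArg (WithLp.toLp 2) h⟩

lemma ker_projD (α₁ α₂ : Matrix (Fin n) (Fin n) ℝ) :
    LinearMap.ker (Matrix.toEuclideanLin (projD α₁ α₂)) =
      (LinearMap.ker (Matrix.toEuclideanLin α₂))ᗮ := by
  ext y
  rw [LinearMap.mem_ker, projD, kerProj, LinearEquiv.apply_symm_apply]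
  exact Submodule.starProjection_apply_eq_zero_iff _

variable {α₁ α₂ β₁ β₂ : Matrix (Fin n) (Fin n) ℝ}

lemma IsSelfAdjointBC.projD_mul_robin (H : IsSelfAdjointBC α₁ α₂) :
    projD α₁ α₂ * robin α₁ α₂ = 0 := by
  have h : projD α₁ α₂ * projR α₁ α₂ = 0 := by
    have h1 : projD α₁ α₂ * projD α₁ α₂ = projD α₁ α₂ := kerProj_mul_self _
    rw [projR, mul_sub, mul_sub, mul_one, h1, H.projD_mul_projN]
    simp
  rw [← H.projR_mul_robin_mul_projR, ← Matrix.mul_assoc, ← Matrix.mul_assoc, h]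
  simp

lemma IsSelfAdjointBC.projN_mul_robin (H : IsSelfAdjointBC α₁ α₂) :
    projN α₁ α₂ * robin α₁ α₂ = 0 := by
  have h : projN α₁ α₂ * projR α₁ α₂ = 0 := by
    have h1 : projN α₁ α₂ * projN α₁ α₂ = projN α₁ α₂ := kerProj_mul_self _
    rw [projR, mul_sub, mul_sub, mul_one, h1, H.projN_mul_projD]
    simp
  rw [← H.projR_mul_robin_mul_projR, ← Matrix.mul_assoc, ← Matrix.mul_assoc, h]
  simp

/-- The boundary condition `α₁ y + α₂ y' = 0`. -/
def IsSelfAdjointBC.toRobin (H : IsSelfAdjointBC α₁ α₂) :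
    RobinBC (EuclideanSpace ℝ (Fin n)) where
  K := LinearMap.ker (Matrix.toEuclideanLin (projD α₁ α₂))
  L := toCLM (robin α₁ α₂)
  symm := toCLM_inner_of_isSymm H.robin_isSymm
  mem x := toEuclideanLin_eq_zero_iff.2 (by
    change projD α₁ α₂ *ᵥ (robin α₁ α₂ *ᵥ WithLp.ofLp x) = 0
    rw [Matrix.mulVec_mulVec, H.projD_mul_robin, Matrix.zero_mulVec])

/-- `K` is the orthogonal complement of `ker α₂`, so `y' - L y ⊥ K` says `α₂ (y' - L y) = 0`; and
`(y, L y)` itself satisfies the boundary condition for every `y ∈ K`. -/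
lemma IsSelfAdjointBC.holds_iff (H : IsSelfAdjointBC α₁ α₂) {y y' : EuclideanSpace ℝ (Fin n)} :
    H.toRobin.Holds y y' ↔ α₁ *ᵥ WithLp.ofLp y + α₂ *ᵥ WithLp.ofLp y' = 0 := by
  have h1 : (∀ k ∈ H.toRobin.K, inner ℝ (y' - H.toRobin.L y) k = 0) ↔
      α₂ *ᵥ (WithLp.ofLp y' - robin α₁ α₂ *ᵥ WithLp.ofLp y) = 0 := by
    rw [← Submodule.mem_orthogonal']
    change _ ∈ (LinearMap.ker (Matrix.toEuclideanLin (projD α₁ α₂)))ᗮ ↔ _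
    rw [ker_projD, Submodule.orthogonal_orthogonal, LinearMap.mem_ker, toEuclideanLin_eq_zero_iff]
    rfl
  rw [RobinBC.Holds, h1]
  have h2 : y ∈ H.toRobin.K ↔ projD α₁ α₂ *ᵥ WithLp.ofLp y = 0 := toEuclideanLin_eq_zero_iff
  rw [h2]
  have key : projD α₁ α₂ *ᵥ WithLp.ofLp y = 0 →
      α₁ *ᵥ WithLp.ofLp y + α₂ *ᵥ (robin α₁ α₂ *ᵥ WithLp.ofLp y) = 0 := fun h => by
    refine (H.boundary_iff _ _).2 ⟨h, ?_, ?_⟩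
    · rw [Matrix.mulVec_mulVec, H.projN_mul_robin, Matrix.zero_mulVec]
    · have h3 : projR α₁ α₂ * robin α₁ α₂ = robin α₁ α₂ := by
        rw [projR, sub_mul, sub_mul, H.projD_mul_robin, H.projN_mul_robin]
        simp
      rw [Matrix.mulVec_mulVec, h3]
  constructor
  · rintro ⟨h, h'⟩
    rw [Matrix.mulVec_sub, sub_eq_zero] at h'
    rw [h', key h]
  · intro h
    have hD := ((H.boundary_iff _ _).1 h).1
    refine ⟨hD, ?_⟩
    rw [Matrix.mulVec_sub, sub_eq_zero]
    exact add_left_cancel (h.trans (key hD).symm)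

/-- The continuous extension of the potential to the line, as an operator-valued function. -/
def extendPotential (V : ℝ → Matrix (Fin n) (Fin n) ℝ) (hV : ContinuousOn V (Icc (0 : ℝ) 1)) :
    C(ℝ, EuclideanSpace ℝ (Fin n) →L[ℝ] EuclideanSpace ℝ (Fin n)) where
  toFun x := toCLM (Set.IccExtend zero_le_one (Set.domRestrict (Icc (0 : ℝ) 1) V) x)
  continuous_toFun := by
    have h1 : Continuous (Set.IccExtend zero_le_one (Set.domRestrict (Icc (0 : ℝ) 1) V)) :=
      hV.domRestrict.Icc_extend'
    let f : Matrix (Fin n) (Fin n) ℝ →ₗ[ℝ] (EuclideanSpace ℝ (Fin n) →L[ℝ] EuclideanSpace ℝ (Fin n)) :=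
      LinearMap.toContinuousLinearMap.toLinearMap ∘ₗ Matrix.toEuclideanLin.toLinearMap
    exact (LinearMap.continuous_of_finiteDimensional f).comp h1

lemma extendPotential_apply {V : ℝ → Matrix (Fin n) (Fin n) ℝ}
    (hV : ContinuousOn V (Icc (0 : ℝ) 1)) {x : ℝ} (hx : x ∈ Icc (0 : ℝ) 1) :
    extendPotential V hV x = toCLM (V x) := by
  change toCLM (Set.IccExtend zero_le_one (Set.domRestrict (Icc (0 : ℝ) 1) V) x) = _
  rw [Set.IccExtend_of_mem _ _ hx]
  rfl

lemma extendPotential_symm {V : ℝ → Matrix (Fin n) (Fin n) ℝ}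
    (hV : ContinuousOn V (Icc (0 : ℝ) 1)) (hVs : ∀ x ∈ Icc (0 : ℝ) 1, (V x).IsSymm) (x : ℝ)
    (y z : EuclideanSpace ℝ (Fin n)) :
    inner ℝ (extendPotential V hV x y) z = inner ℝ y (extendPotential V hV x z) :=
  toCLM_inner_of_isSymm (hVs _ (Set.projIcc (0 : ℝ) 1 zero_le_one x).2) y z

lemma inner_compress (S : Submodule ℝ (EuclideanSpace ℝ (Fin n))) (M : Matrix (Fin n) (Fin n) ℝ)
    (x y : S) : inner ℝ (compress S M x) y = inner ℝ (toCLM M x) (y : EuclideanSpace ℝ (Fin n)) := by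
  simp [compress]

lemma isSymmetric_compress (S : Submodule ℝ (EuclideanSpace ℝ (Fin n)))
    {M : Matrix (Fin n) (Fin n) ℝ} (hM : M.IsSymm) : (compress S M).IsSymmetric := fun x y =>
  (inner_compress S M x y).trans (((toCLM_inner_of_isSymm hM x y).trans (real_inner_comm _ _)).trans
    ((inner_compress S M y x).symm.trans (real_inner_comm _ _)))

lemma toCLM_sq (A : Matrix (Fin n) (Fin n) ℝ) (x : EuclideanSpace ℝ (Fin n)) :
    toCLM (A ^ 2) x = toCLM A (toCLM A x) := by
  rw [pow_two]
  exact congrArg (WithLp.toLp 2) (Matrix.mulVec_mulVec (WithLp.ofLp x) A A).symm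

/-- For z in ker B the definition of B only gives that M z is orthogonal to K. Hypothesis (i)
upgrades this to `L₀ z = L₁ z`, which also removes the coupling of z with the part of `K₁` outside
K. Hypothesis (ii) makes the form on ker B nondegenerate. -/
lemma exists_forall_sigNeg_shotForm_matrix {V : ℝ → Matrix (Fin n) (Fin n) ℝ}
    (hV : ContinuousOn V (Icc (0 : ℝ) 1)) (hVs : ∀ x ∈ Icc (0 : ℝ) 1, (V x).IsSymm)
    (hα : IsSelfAdjointBC α₁ α₂) (hβ : IsSelfAdjointBC β₁ β₂)
    (hB : ∀ p ∈ kerB α₁ α₂ β₁ β₂,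
      Matrix.toEuclideanLin (robin α₁ α₂ - robin β₁ β₂) p = 0)
    (hnd : (0 : ℝ) ∉ spectrum ℝ (opQ α₁ α₂ β₁ β₂ (V 0))) :
    ∃ s₁ > 0, ∀ s ∈ Ioc (0 : ℝ) 1, s ≤ s₁ →
      sigNeg (shotForm (extendPotential V hV) hα.toRobin hβ.toRobin s 0) =
        mor (opB α₁ α₂ β₁ β₂) + mor (opQ α₁ α₂ β₁ β₂ (V 0)) := by
  have h0 : (0 : ℝ) ∈ Icc (0 : ℝ) 1 := ⟨le_rfl, zero_le_one⟩
  refine exists_forall_sigNeg_shotForm_eq (extendPotential_symm hV hVs) hα.toRobin hβ.toRobin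
    (B := opB α₁ α₂ β₁ β₂) (R := opQ α₁ α₂ β₁ β₂ (V 0))
    (isSymmetric_compress _ (hα.robin_isSymm.sub hβ.robin_isSymm)) (fun y => ?_) rfl
    (fun y hy => ?_)
    (isSymmetric_compress _ ((hVs 0 h0).sub (hα.robin_isSymm.pow 2))) (fun y hy => ?_) (fun y => ?_)
  · refine (inner_compress _ _ _ _).trans ?_
    rw [toCLM, map_sub, map_sub, sub_apply, inner_sub_left]
    rfl
  · have := hB y hy
    rw [map_sub, LinearMap.sub_apply, sub_eq_zero] at this
    exact this
  · by_contra hne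
    refine hnd (Module.End.hasEigenvalue_iff_mem_spectrum.1 ?_)
    refine Module.End.hasEigenvalue_of_hasEigenvector (x := y)
      ⟨Module.End.mem_eigenspace_iff.2 (hy.trans (zero_smul ℝ y).symm), hne⟩
  · refine (inner_compress _ _ _ _).trans ?_
    rw [toCLM, map_sub, map_sub, sub_apply, inner_sub_left, extendPotential_apply hV h0]
    congr 1
    refine (congrArg (fun z => inner ℝ z (y : EuclideanSpace ℝ (Fin n))) (toCLM_sq _ _)).trans ?_
    change inner ℝ (hα.toRobin.L (hα.toRobin.L y)) (y : EuclideanSpace ℝ (Fin n)) = _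
    rw [hα.toRobin.symm, real_inner_self_eq_norm_sq]

end Bridge

end

end MaslovMorse

namespace MaslovMorse

noncomputable section

open Topology Filter Set Module QuadraticMap QuadraticForm

/-! ### Monotonicity in λ and counting of crossings. -/

section SpectralParameter

variable {E : Type*} [NormedAddCommGroup E] [InnerProductSpace ℝ E] [FiniteDimensional ℝ E]

/-- The solutions that satisfy the boundary condition `b₁` at `s`. -/
def shotCross (V : C(ℝ, E →L[ℝ] E)) (b₀ b₁ : RobinBC E) (s lam : ℝ) : Submodule ℝ E :=
  crossSpace (solP V b₀ lam s) (solQ V b₀ lam s - b₁.L * solP V b₀ lam s) b₁.K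

lemma mem_shotCross {V : C(ℝ, E →L[ℝ] E)} {b₀ b₁ : RobinBC E} {s lam : ℝ} {c : E} :
    c ∈ shotCross V b₀ b₁ s lam ↔ b₁.Holds (solP V b₀ lam s c) (solQ V b₀ lam s c) :=
  Iff.rfl

variable {V : C(ℝ, E →L[ℝ] E)} (b₀ b₁ : RobinBC E)

lemma inner_solP_solQ (hV : ∀ x y z, inner ℝ (V x y) z = inner ℝ y (V x z))
    {s : ℝ} (hs : s ∈ Ioc (0 : ℝ) 1) (lam : ℝ) (c c' : E) :
    inner ℝ (solQ V b₀ lam s c) (solP V b₀ lam s c') =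
      inner ℝ (solP V b₀ lam s c) (solQ V b₀ lam s c') := by
  have := lagrange_identity_sol b₀ hV hs lam lam c c'
  rw [sub_self, zero_mul] at this
  linarith

lemma inner_shot_symm (hV : ∀ x y z, inner ℝ (V x y) z = inner ℝ y (V x z))
    {s : ℝ} (hs : s ∈ Ioc (0 : ℝ) 1) (lam : ℝ) (c c' : E) :
    inner ℝ ((solQ V b₀ lam s - b₁.L * solP V b₀ lam s) c) (solP V b₀ lam s c') =
      inner ℝ (solP V b₀ lam s c) ((solQ V b₀ lam s - b₁.L * solP V b₀ lam s) c') := by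
  rw [sub_apply, sub_apply, inner_sub_left, inner_sub_right, inner_solP_solQ b₀ hV hs,
    mul_apply_eq_comp, mul_apply_eq_comp, b₁.symm]

/-- For two solutions with the same value at `s` the terms with `L₁` cancel in the difference of the
forms, and the rest is the left side of the Lagrange identity, that is `(l₁ - l₂)` times the `L²`
pairing. So the form strictly decreases in λ. -/
lemma eventually_sigNeg_shotForm (hV : ∀ x y z, inner ℝ (V x y) z = inner ℝ y (V x z))
    {s : ℝ} (hs : s ∈ Ioc (0 : ℝ) 1) {I : Set ℝ}
    (hu : ∀ lam ∈ I, IsUnit (solP V b₀ lam s)) {lam₀ : ℝ} (h₀ : lam₀ ∈ I) :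
    ∀ᶠ lam in 𝓝[I] lam₀,
      (lam ≤ lam₀ → sigNeg (shotForm V b₀ b₁ s lam) = sigNeg (shotForm V b₀ b₁ s lam₀)) ∧
      (lam₀ < lam → sigNeg (shotForm V b₀ b₁ s lam) =
        sigNeg (shotForm V b₀ b₁ s lam₀) + finrank ℝ (shotCross V b₀ b₁ s lam₀)) := by
  refine eventually_sigNeg_chartForm (H := fun l₁ l₂ => solPairing V b₀ hs l₁ l₂) one_pos
    (continuous_solP V b₀ ⟨hs.1.le, hs.2⟩).continuousOn hu
    (fun lam c c' => inner_shot_symm b₀ b₁ hV hs lam c c')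
    (fun l₁ c c' => continuous_solPairing V b₀ hs l₁ c c')
    (fun l c hc => solPairing_self_pos V b₀ hs l hc) (fun l₁ l₂ w₁ w₂ h => ?_) h₀
  have := lagrange_identity_sol b₀ hV hs l₁ l₂ w₁ w₂
  rw [one_mul, ← this]
  simp only [sub_apply, mul_apply_eq_comp, inner_sub_left, ← h]
  rw [real_inner_comm (solQ V b₀ l₂ s w₂)]
  ring

/-- For small `s`, the crossings at negative `λ` add up to the negative index of the form at
`λ = 0`. -/
lemma exists_forall_finsum_shotCross
    (hV : ∀ x y z, inner ℝ (V x y) z = inner ℝ y (V x z)) :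
    ∃ s₁ > 0, ∀ s ∈ Ioc (0 : ℝ) 1, s ≤ s₁ → (∀ lam ≤ 0, IsUnit (solP V b₀ lam s)) ∧
      (∃ lam₀ > 0, ∀ lam < -lam₀, sigNeg (shotForm V b₀ b₁ s lam) = 0) ∧
      {lam | lam < 0 ∧ shotCross V b₀ b₁ s lam ≠ ⊥}.Finite ∧
      ∑ᶠ lam ∈ Iio (0 : ℝ), finrank ℝ (shotCross V b₀ b₁ s lam) =
        sigNeg (shotForm V b₀ b₁ s 0) := by
  obtain ⟨s₁, hs₁, hu⟩ := exists_forall_isUnit_solP V b₀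
  obtain ⟨v, hv0, hv⟩ := exists_norm_le_Icc V
  set m := 2 * (‖b₀.L‖ + ‖b₁.L‖) with hm
  have hm0 : 0 ≤ m := by positivity
  refine ⟨min s₁ (1 / (m + 1)), by positivity, fun s hs hss => ?_⟩
  have hu' := hu s hs (hss.trans (min_le_left _ _))
  have hsm : m * s ≤ 1 := by
    have := hss.trans (min_le_right _ _)
    rw [le_div_iff₀ (by positivity)] at this
    linarith [hs.1]
  have hs0 := hs.1
  set lam₀ := v + m / s with hlam₀
  have hlam₀' : 0 < lam₀ := by positivity
  have hpos : ∀ lam < -lam₀, ∀ c ≠ 0, 0 < inner ℝ (solQ V b₀ lam s c) (solP V b₀ lam s c) -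
      inner ℝ (b₁.L (solP V b₀ lam s c)) (solP V b₀ lam s c) := fun lam hl c hc =>
    form_pos_of_le b₀ hv hs b₁.L hsm hl hc
  have hneg : ∀ lam < -lam₀, sigNeg (shotForm V b₀ b₁ s lam) = 0 := fun lam hl => by
    have hT := hu' lam (by linarith)
    have := sigNeg_add_finrank_le_of_nonneg (Q := shotForm V b₀ b₁ s lam) (S := ⊤) fun y _ => by
      have hc := apply_inverse_apply hT y
      rw [shotForm_apply hT hc]
      by_cases h0 : Ring.inverse (solP V b₀ lam s) y = 0
      · rw [h0, map_zero] at hc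
        simp [← hc]
      · have := hpos lam hl _ h0
        rw [hc] at this
        exact this.le
    rw [finrank_top] at this
    omega
  have hbot : ∀ lam < -lam₀, shotCross V b₀ b₁ s lam = ⊥ := fun lam hl => by
    rw [eq_bot_iff]
    intro c hc
    rw [mem_shotCross] at hc
    by_contra h0
    have h1 := hpos lam hl c (by simpa using h0)
    have h2 := hc.2 _ hc.1
    rw [inner_sub_left] at h2
    exact h1.ne' h2
  -- The count starts strictly below `-lam₀`, where the negative index is zero; no crossing lies
  -- below `-lam₀`, so none is missed.
  have hstep := step_function_sum (f := fun lam => sigNeg (shotForm V b₀ b₁ s lam))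
    (d := fun lam => finrank ℝ (shotCross V b₀ b₁ s lam)) (a := -lam₀ - 1) (b := 0) (by linarith)
    fun t₀ ht₀ => eventually_sigNeg_shotForm b₀ b₁ hV hs (fun lam hl => hu' lam hl.2) ht₀
  simp only [hneg (-lam₀ - 1) (by linarith), zero_add] at hstep
  refine ⟨hu', ⟨lam₀, hlam₀', hneg⟩, hstep.1.subset fun lam hl => ⟨⟨?_, hl.1⟩, ?_⟩, ?_⟩
  · by_contra! h
    exact hl.2 (hbot lam (by linarith))
  · exact fun h => hl.2 (Submodule.finrank_eq_zero.1 h)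
  · rw [← hstep.2]
    refine finsum_mem_inter_support_eq _ _ _ ?_
    ext lam
    simp only [mem_inter_iff, mem_Iio, mem_Ico, Function.mem_support]
    refine ⟨fun h => ⟨⟨?_, h.1⟩, h.2⟩, fun h => ⟨h.1.2, h.2⟩⟩
    by_contra! h'
    exact h.2 (Submodule.finrank_eq_zero.2 (hbot lam (by linarith)))

end SpectralParameter

end

end MaslovMorse

namespace MaslovMorse

noncomputable section

open Topology Filter Set Module

/-! ### Eigenfunctions of H(s) as rescaled solutions. -/

section Eigenspace

variable {n : ℕ} {V : ℝ → Matrix (Fin n) (Fin n) ℝ} {α₁ α₂ β₁ β₂ : Matrix (Fin n) (Fin n) ℝ}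

lemma memLp_of_continuousOn_Icc {f : ℝ → EuclideanSpace ℝ (Fin n)}
    (hf : ContinuousOn f (Icc (0 : ℝ) 1)) : MemLp f 2 (volume.restrict (Icc (0 : ℝ) 1)) := by
  obtain ⟨C, hC⟩ := isCompact_Icc.exists_bound_of_continuousOn hf
  refine MemLp.of_bound (hf.aestronglyMeasurable measurableSet_Icc) C ?_
  filter_upwards [ae_restrict_mem measurableSet_Icc] with x hx using hC x hx

lemma hasDerivWithinAt_primitive {f g : ℝ → EuclideanSpace ℝ (Fin n)}
    (hg : ContinuousOn g (Icc (0 : ℝ) 1))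
    (h : ∀ x ∈ Icc (0 : ℝ) 1, f x = f 0 + ∫ t in (0 : ℝ)..x, g t) {x : ℝ}
    (hx : x ∈ Icc (0 : ℝ) 1) : HasDerivWithinAt f (g x) (Icc 0 1) x := by
  have : Fact (x ∈ Icc (0 : ℝ) 1) := ⟨hx⟩
  have hi : IntervalIntegrable g volume 0 x := by
    apply ContinuousOn.intervalIntegrable
    rw [uIcc_of_le hx.1]
    exact hg.mono (Icc_subset_Icc_right hx.2)
  have h1 : HasDerivWithinAt (fun u => ∫ t in (0 : ℝ)..u, g t) (g x) (Icc 0 1) x :=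
    intervalIntegral.integral_hasDerivWithinAt_right hi
      (hg.stronglyMeasurableAtFilter_nhdsWithin measurableSet_Icc x) (hg x hx)
  exact (h1.const_add (f 0)).congr (fun y hy => h y hy) (h x hx)

lemma eq_add_integral_of_hasDerivAt {f g : ℝ → EuclideanSpace ℝ (Fin n)}
    (hg : ContinuousOn g (Icc (0 : ℝ) 1)) (h : ∀ x ∈ Icc (0 : ℝ) 1, HasDerivAt f (g x) x) {x : ℝ}
    (hx : x ∈ Icc (0 : ℝ) 1) : f x = f 0 + ∫ t in (0 : ℝ)..x, g t := by
  rw [intervalIntegral.integral_eq_sub_of_hasDerivAt (f := f)]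
  · abel
  · intro t ht
    rw [uIcc_of_le hx.1] at ht
    exact h t ⟨ht.1, ht.2.trans hx.2⟩
  · apply ContinuousOn.intervalIntegrable
    rw [uIcc_of_le hx.1]
    exact hg.mono (Icc_subset_Icc_right hx.2)

lemma mul_mem_Icc {s x : ℝ} (hs : s ∈ Ioc (0 : ℝ) 1) (hx : x ∈ Icc (0 : ℝ) 1) :
    s * x ∈ Icc (0 : ℝ) 1 :=
  ⟨mul_nonneg hs.1.le hx.1, mul_le_one₀ hs.2 hx.1 hx.2⟩

lemma toEuclideanLin_add_smul_eq_zero_iff {s : ℝ} (A₁ A₂ : Matrix (Fin n) (Fin n) ℝ)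
    (y y' : EuclideanSpace ℝ (Fin n)) :
    Matrix.toEuclideanLin A₁ y + (1 / s) • Matrix.toEuclideanLin A₂ y' = 0 ↔
      A₁ *ᵥ WithLp.ofLp y + A₂ *ᵥ WithLp.ofLp ((1 / s) • y') = 0 := by
  rw [← map_smul]
  exact ⟨fun h => congrArg WithLp.ofLp h, fun h => congrArg (WithLp.toLp 2) h⟩

variable (hVc : ContinuousOn V (Icc (0 : ℝ) 1)) (hα : IsSelfAdjointBC α₁ α₂)
  (hβ : IsSelfAdjointBC β₁ β₂)

lemma continuousOn_solP_mul {s : ℝ} (hs : s ∈ Ioc (0 : ℝ) 1) (lam : ℝ)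
    (c : EuclideanSpace ℝ (Fin n)) :
    ContinuousOn (fun x => solP (extendPotential V hVc) hα.toRobin lam (s * x) c) (Icc 0 1) :=
  (continuousOn_solP _ hα.toRobin lam c).comp (by fun_prop) fun _ hx => mul_mem_Icc hs hx

/-- The solution operator with values in `L²`. -/
def solL2 {s : ℝ} (hs : s ∈ Ioc (0 : ℝ) 1) (lam : ℝ) : EuclideanSpace ℝ (Fin n) →ₗ[ℝ] L2 n where
  toFun c := (memLp_of_continuousOn_Icc (continuousOn_solP_mul hVc hα hs lam c)).toLp
  map_add' c c' := by
    rw [← MemLp.toLp_add]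
    exact MemLp.toLp_congr _ _ (Eventually.of_forall fun x => map_add _ c c')
  map_smul' r c := by
    rw [RingHom.id_apply, ← MemLp.toLp_const_smul]
    exact MemLp.toLp_congr _ _ (Eventually.of_forall fun x => map_smul _ r c)

lemma coeFn_solL2 {s : ℝ} (hs : s ∈ Ioc (0 : ℝ) 1) (lam : ℝ) (c : EuclideanSpace ℝ (Fin n)) :
    solL2 hVc hα hs lam c =ᵐ[volume.restrict (Icc (0 : ℝ) 1)]
      fun x => solP (extendPotential V hVc) hα.toRobin lam (s * x) c :=
  MemLp.coeFn_toLp (memLp_of_continuousOn_Icc (continuousOn_solP_mul hVc hα hs lam c))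

lemma solL2_injective {s : ℝ} (hs : s ∈ Ioc (0 : ℝ) 1) (lam : ℝ) :
    Function.Injective (solL2 hVc hα hs lam) := by
  rw [injective_iff_map_eq_zero]
  intro c hc
  have h1 := coeFn_solL2 hVc hα hs lam c
  rw [hc] at h1
  have h2 : EqOn (fun x => solP (extendPotential V hVc) hα.toRobin lam (s * x) c) 0 (Icc 0 1) :=
    Measure.eqOn_Icc_of_ae_eq volume zero_ne_one (h1.symm.trans (Lp.coeFn_zero _ _ _))
      (continuousOn_solP_mul hVc hα hs lam c) continuousOn_const
  refine sol_eq_zero_of_solP (extendPotential V hVc) hα.toRobin hs lam fun x hx => ?_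
  have hs0 := hs.1
  have := h2 (show x / s ∈ Icc (0 : ℝ) 1 from ⟨div_nonneg hx.1 hs0.le, (div_le_one hs0).2 hx.2⟩)
  simpa [mul_div_cancel₀ x hs0.ne'] using this

/-- Rescaling: for `u(x) = p(s x)` one has `u' / s = q(s x)`, which matches the boundary conditions,
and `-u'' + s² V(s x) u = s² λ u`. -/
lemma inGraphH_solL2 {s : ℝ} (hs : s ∈ Ioc (0 : ℝ) 1) (lam : ℝ) {c : EuclideanSpace ℝ (Fin n)}
    (hc : c ∈ shotCross (extendPotential V hVc) hα.toRobin hβ.toRobin s lam) :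
    InGraphH V α₁ α₂ β₁ β₂ s (solL2 hVc hα hs lam c)
      ((s ^ 2 * lam) • solL2 hVc hα hs lam c) := by
  set VE := extendPotential V hVc with hVE
  set b := hα.toRobin
  have hs0 := hs.1.ne'
  have hm : ∀ x ∈ Icc (0 : ℝ) 1, s * x ∈ Icc (0 : ℝ) 1 := fun x hx => mul_mem_Icc hs hx
  have cP : ContinuousOn (fun x => solP VE b lam (s * x) c) (Icc 0 1) :=
    continuousOn_solP_mul hVc hα hs lam c
  have cQ : ContinuousOn (fun x => solQ VE b lam (s * x) c) (Icc 0 1) :=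
    (continuousOn_solQ _ b lam c).comp (by fun_prop) hm
  have cV : ContinuousOn (fun x => VE (s * x) (solP VE b lam (s * x) c)) (Icc 0 1) :=
    ContinuousOn.clm_apply (VE.continuous.comp (by fun_prop)).continuousOn cP
  have cH : ContinuousOn (fun x => s ^ 2 • (VE (s * x) (solP VE b lam (s * x) c) -
      lam • solP VE b lam (s * x) c)) (Icc 0 1) := (cV.sub (cP.const_smul lam)).const_smul (s ^ 2)
  have hd : ∀ x : ℝ, HasDerivAt (fun x => s * x) s x := fun x => by
    simpa using (hasDerivAt_id x).const_mul s
  refine ⟨fun x => solP VE b lam (s * x) c, fun x => s • solQ VE b lam (s * x) c,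
    fun x => s ^ 2 • (VE (s * x) (solP VE b lam (s * x) c) - lam • solP VE b lam (s * x) c),
    ⟨memLp_of_continuousOn_Icc cH, fun x hx => ?_, fun x hx => ?_⟩, ?_, ?_,
    coeFn_solL2 hVc hα hs lam c, ?_⟩
  · refine eq_add_integral_of_hasDerivAt (f := fun x => s • solQ VE b lam (s * x) c) cH
      (fun x hx => ?_) hx
    have := ((hasDerivAt_solQ VE b lam c (hm x hx)).scomp x (hd x)).const_smul s
    rw [smul_smul, ← pow_two] at this
    exact this
  · refine eq_add_integral_of_hasDerivAt (f := fun x => solP VE b lam (s * x) c)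
      (cQ.const_smul s) (fun x hx => ?_) hx
    exact (hasDerivAt_solP VE b lam c (hm x hx)).scomp x (hd x)
  · rw [toEuclideanLin_add_smul_eq_zero_iff, smul_smul, one_div, inv_mul_cancel₀ hs0, one_smul]
    have := b.holds_param c
    rw [← solP_zero VE b lam, ← solQ_zero VE b lam, ← mul_zero s] at this
    exact hα.holds_iff.1 this
  · rw [toEuclideanLin_add_smul_eq_zero_iff, smul_smul, one_div, inv_mul_cancel₀ hs0, one_smul]
    have := mem_shotCross.1 hc
    rw [show solP VE b lam s = solP VE b lam (s * 1) by rw [mul_one],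
      show solQ VE b lam s = solQ VE b lam (s * 1) by rw [mul_one]] at this
    exact hβ.holds_iff.1 this
  · filter_upwards [Lp.coeFn_smul (s ^ 2 * lam) (solL2 hVc hα hs lam c),
      coeFn_solL2 hVc hα hs lam c, ae_restrict_mem measurableSet_Icc] with x h1 h2 hx
    rw [h1, Pi.smul_apply, h2, hVE, extendPotential_apply hVc (hm x hx)]
    change _ = -(s ^ 2 • (toCLM (V (s * x)) _ - lam • _)) + s ^ 2 • toCLM (V (s * x)) _
    rw [smul_sub, smul_smul]
    abel

/-- The inverse rescaling `p(x) = f(x / s)`, once the equation has upgraded the `H²` function to a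
classical solution. -/
lemma exists_solL2_eq {s : ℝ} (hs : s ∈ Ioc (0 : ℝ) 1) (lam : ℝ) {u : L2 n}
    (hu : InGraphH V α₁ α₂ β₁ β₂ s u ((s ^ 2 * lam) • u)) :
    ∃ c ∈ shotCross (extendPotential V hVc) hα.toRobin hβ.toRobin s lam,
      solL2 hVc hα hs lam c = u := by
  obtain ⟨f, g, h, H, h0, h1, huf, hw⟩ := hu
  set VE := extendPotential V hVc with hVE
  have hs0 : 0 < s := hs.1
  have hm : ∀ x ∈ Icc (0 : ℝ) 1, s * x ∈ Icc (0 : ℝ) 1 := fun x hx => mul_mem_Icc hs hx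
  -- By the eigenvalue equation the `L²` second derivative agrees almost everywhere with a
  -- continuous function, so `g` is its primitive and is differentiable everywhere.
  have hae : h =ᵐ[volume.restrict (Icc (0 : ℝ) 1)]
      fun x => s ^ 2 • (VE (s * x) (f x) - lam • f x) := by
    filter_upwards [Lp.coeFn_smul (s ^ 2 * lam) u, huf, hw, ae_restrict_mem measurableSet_Icc]
      with x k1 k2 k3 hx
    rw [k1, Pi.smul_apply, k2] at k3
    rw [hVE, extendPotential_apply hVc (hm x hx), smul_sub, smul_smul, k3]
    change h x = s ^ 2 • Matrix.toEuclideanLin (V (s * x)) (f x) - _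
    abel
  have cV : ContinuousOn (fun x => VE (s * x) (f x)) (Icc 0 1) :=
    ContinuousOn.clm_apply (VE.continuous.comp (by fun_prop)).continuousOn H.continuousOn
  have cH : ContinuousOn (fun x => s ^ 2 • (VE (s * x) (f x) - lam • f x)) (Icc 0 1) :=
    (cV.sub (H.continuousOn.const_smul lam)).const_smul (s ^ 2)
  have dg : ∀ x ∈ Icc (0 : ℝ) 1, HasDerivWithinAt g (s ^ 2 • (VE (s * x) (f x) - lam • f x))
      (Icc 0 1) x := fun x hx => by
    refine hasDerivWithinAt_primitive cH (fun y hy => ?_) hx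
    rw [H.deriv_eq y hy]
    congr 1
    refine intervalIntegral.integral_congr_ae ?_
    rw [EventuallyEq, ae_restrict_iff' measurableSet_Icc] at hae
    filter_upwards [hae] with t ht htm
    rw [uIoc_of_le hy.1] at htm
    exact ht ⟨htm.1.le, htm.2.trans hy.2⟩
  have df : ∀ x ∈ Icc (0 : ℝ) 1, HasDerivWithinAt f (g x) (Icc 0 1) x := fun x hx =>
    hasDerivWithinAt_primitive H.continuousOn_deriv H.eq hx
  have hd : ∀ x : ℝ, HasDerivWithinAt (fun x => x / s) (1 / s) (Icc 0 s) x := fun x =>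
    ((hasDerivAt_id x).div_const s).hasDerivWithinAt
  have hmaps : MapsTo (fun x => x / s) (Icc 0 s) (Icc 0 1) := fun x hx =>
    ⟨div_nonneg hx.1 hs0.le, (div_le_one hs0).2 hx.2⟩
  obtain ⟨c, hc⟩ := exists_eq_sol VE hα.toRobin (lam := lam) hs.2 (p := fun x => f (x / s))
    (q := fun x => (1 / s) • g (x / s))
    (fun x hx => (df _ (hmaps hx)).scomp x (hd x) hmaps)
    (fun x hx => by
      have := ((dg _ (hmaps hx)).scomp x (hd x) hmaps).const_smul (1 / s)
      rw [smul_smul, smul_smul, mul_div_cancel₀ x hs0.ne',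
        show 1 / s * (1 / s) * s ^ 2 = 1 by field_simp, one_smul] at this
      exact this)
    (hα.holds_iff.2 (by
      rw [toEuclideanLin_add_smul_eq_zero_iff] at h0
      rw [zero_div]
      exact h0))
  refine ⟨c, ?_, ?_⟩
  · have hcs := hc s ⟨hs0.le, le_rfl⟩
    rw [mem_shotCross, ← hcs.1, ← hcs.2, hβ.holds_iff, div_self hs0.ne']
    rwa [toEuclideanLin_add_smul_eq_zero_iff] at h1
  · refine Lp.ext ?_
    filter_upwards [coeFn_solL2 hVc hα hs lam c, huf, ae_restrict_mem measurableSet_Icc]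
      with x k1 k2 hx
    rw [k1, k2, ← (hc (s * x) ⟨(hm x hx).1, mul_le_of_le_one_right hs0.le hx.2⟩).1,
      mul_div_cancel_left₀ x hs0.ne']

lemma mem_pmapEigenspace_iff {F : Type*} [AddCommGroup F] [Module ℝ F] {T : F →ₗ.[ℝ] F} {μ : ℝ}
    {x : T.domain} : x ∈ pmapEigenspace T μ ↔ ((x : F), μ • (x : F)) ∈ T.graph := by
  have h : x ∈ pmapEigenspace T μ ↔ T x = μ • (x : F) := by
    rw [pmapEigenspace, LinearMap.mem_ker, LinearMap.sub_apply, sub_eq_zero]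
    rfl
  rw [h, LinearPMap.mem_graph_iff]
  constructor
  · intro h
    exact ⟨x, rfl, h⟩
  · rintro ⟨y, hy, hy'⟩
    exact (congrArg T (Subtype.ext hy)).symm.trans hy'

/-- The eigenspaces of `H(s)` in terms of solutions. -/
def eigenspaceEquiv {s : ℝ} (hs : s ∈ Ioc (0 : ℝ) 1) (lam : ℝ) :
    shotCross (extendPotential V hVc) hα.toRobin hβ.toRobin s lam ≃ₗ[ℝ]
      pmapEigenspace (opH V α₁ α₂ β₁ β₂ s) (s ^ 2 * lam) := by
  let S := shotCross (extendPotential V hVc) hα.toRobin hβ.toRobin s lam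
  let D := (opH V α₁ α₂ β₁ β₂ s).domain
  refine (Submodule.equivMapOfInjective _ (solL2_injective hVc hα hs lam) S).trans
    (LinearEquiv.trans (LinearEquiv.ofEq _ _ ?_)
    (Submodule.equivMapOfInjective D.subtype D.subtype_injective
      (pmapEigenspace (opH V α₁ α₂ β₁ β₂ s) (s ^ 2 * lam))).symm)
  ext u
  simp only [Submodule.mem_map, Submodule.coe_subtype]
  constructor
  · rintro ⟨c, hc, rfl⟩
    have hg : (solL2 hVc hα hs lam c, (s ^ 2 * lam) • solL2 hVc hα hs lam c) ∈
        (opH V α₁ α₂ β₁ β₂ s).graph := by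
      rw [opH_graph]
      exact inGraphH_solL2 hVc hα hβ hs lam hc
    obtain ⟨y, hy, hy'⟩ := (LinearPMap.mem_graph_iff _).1 hg
    exact ⟨y, mem_pmapEigenspace_iff.2 (by rw [hy]; exact hg), hy⟩
  · rintro ⟨y, hy, rfl⟩
    rw [mem_pmapEigenspace_iff, opH_graph] at hy
    exact exists_solL2_eq hVc hα hβ hs lam hy

lemma hasMorseIndex_opH {s : ℝ} (hs : s ∈ Ioc (0 : ℝ) 1) {m : ℕ}
    (hfin : {lam | lam < 0 ∧
      shotCross (extendPotential V hVc) hα.toRobin hβ.toRobin s lam ≠ ⊥}.Finite)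
    (hsum : ∑ᶠ lam ∈ Iio (0 : ℝ), finrank ℝ
      (shotCross (extendPotential V hVc) hα.toRobin hβ.toRobin s lam) = m) :
    HasMorseIndex (opH V α₁ α₂ β₁ β₂ s) m := by
  have hs2 : 0 < s ^ 2 := pow_pos hs.1 2
  have hμ : ∀ μ : ℝ, s ^ 2 * (μ / s ^ 2) = μ := fun μ => mul_div_cancel₀ μ hs2.ne'
  refine ⟨?_, fun μ _ => ?_, ?_⟩
  · refine (hfin.image fun lam => s ^ 2 * lam).subset fun μ ⟨hμ0, hne⟩ => ?_
    refine ⟨μ / s ^ 2, ⟨div_neg_of_neg_of_pos hμ0 hs2, fun h => hne ?_⟩, hμ μ⟩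
    have e := eigenspaceEquiv hVc hα hβ hs (μ / s ^ 2)
    rw [hμ μ, h] at e
    have : Subsingleton (pmapEigenspace (opH V α₁ α₂ β₁ β₂ s) μ) := e.symm.injective.subsingleton
    exact Submodule.subsingleton_iff_eq_bot.1 this
  · have e := eigenspaceEquiv hVc hα hβ hs (μ / s ^ 2)
    rw [hμ μ] at e
    exact Module.Finite.equiv e
  · rw [← hsum]
    symm
    refine finsum_mem_eq_of_bijOn (fun lam => s ^ 2 * lam) ⟨fun lam hl => ?_, fun a _ b _ h => ?_,
      fun μ hμ0 => ?_⟩ fun lam _ => (eigenspaceEquiv hVc hα hβ hs lam).finrank_eq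
    · exact mul_neg_of_pos_of_neg hs2 hl
    · exact mul_left_cancel₀ hs2.ne' h
    · exact ⟨μ / s ^ 2, div_neg_of_neg_of_pos hμ0 hs2, hμ μ⟩

end Eigenspace

end

end MaslovMorse

namespace MaslovMorse

noncomputable section

open Module

/-! ### The identification of ℝ²ⁿ with ℂⁿ, and unitary frames of Lagrangian subspaces. -/

section ComplexStructure

variable {n : ℕ}

/-- The complex vector `p + i q` of `(p, q)`. -/
def cvec (z : Fin n ⊕ Fin n → ℝ) : Fin n → ℂ := fun i => ⟨z (Sum.inl i), z (Sum.inr i)⟩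

/-- A real vector as a complex vector. -/
def rvec (c : Fin n → ℝ) : Fin n → ℂ := fun i => (c i : ℂ)

/-- The real `2n × 2n` matrix of a complex `n × n` matrix. -/
def realRep (A : Matrix (Fin n) (Fin n) ℂ) : Matrix (Fin n ⊕ Fin n) (Fin n ⊕ Fin n) ℝ :=
  Matrix.fromBlocks (A.map Complex.re) (-A.map Complex.im) (A.map Complex.im) (A.map Complex.re)

/-- The matrix of complex conjugation. -/
def conjRep (n : ℕ) : Matrix (Fin n ⊕ Fin n) (Fin n ⊕ Fin n) ℝ := Matrix.fromBlocks 1 0 0 (-1)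

lemma cvec_injective : Function.Injective (cvec (n := n)) := fun z z' h => by
  ext i
  rcases i with i | i
  · exact congrArg Complex.re (congrFun h i)
  · exact congrArg Complex.im (congrFun h i)

lemma exists_cvec_eq (v : Fin n → ℂ) : ∃ z, cvec z = v :=
  ⟨Sum.elim (fun i => (v i).re) fun i => (v i).im, rfl⟩

lemma cvec_add (z z' : Fin n ⊕ Fin n → ℝ) : cvec (z + z') = cvec z + cvec z' := rfl

lemma cvec_sub (z z' : Fin n ⊕ Fin n → ℝ) : cvec (z - z') = cvec z - cvec z' := rfl

lemma star_rvec (c : Fin n → ℝ) : star (rvec c) = rvec c := by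
  ext i; simp [rvec]

lemma eq_rvec_of_im_eq_zero {v : Fin n → ℂ} (h : ∀ i, (v i).im = 0) : ∃ c, rvec c = v :=
  ⟨fun i => (v i).re, funext fun i => Complex.ext rfl (h i).symm⟩

lemma cvec_realRep_mulVec (A : Matrix (Fin n) (Fin n) ℂ) (z : Fin n ⊕ Fin n → ℝ) :
    cvec (realRep A *ᵥ z) = A *ᵥ cvec z := by
  ext i
  apply Complex.ext
  · simp [cvec, realRep, Matrix.mulVec, dotProduct, Fintype.sum_sum_type, Complex.mul_re,
      sub_eq_add_neg, Finset.sum_add_distrib]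
  · simp [cvec, realRep, Matrix.mulVec, dotProduct, Fintype.sum_sum_type, Complex.mul_im,
      Finset.sum_add_distrib, add_comm]

lemma cvec_conjRep_mulVec (z : Fin n ⊕ Fin n → ℝ) : cvec (conjRep n *ᵥ z) = star (cvec z) := by
  obtain ⟨p, q, rfl⟩ : ∃ p q, z = Sum.elim p q := ⟨_, _, (Sum.elim_comp_inl_inr z).symm⟩
  rw [conjRep, Matrix.fromBlocks_mulVec]
  ext i
  apply Complex.ext <;> simp [cvec, Matrix.neg_mulVec]

lemma J_eq_realRep : Matrix.J (Fin n) ℝ = realRep (Complex.I • 1) := by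
  rw [Matrix.J, realRep]
  congr 1 <;> ext i j <;> by_cases h : i = j <;> simp [Matrix.one_apply, h]

lemma cvec_J_mulVec (z : Fin n ⊕ Fin n → ℝ) :
    cvec (Matrix.J (Fin n) ℝ *ᵥ z) = Complex.I • cvec z := by
  rw [J_eq_realRep, cvec_realRep_mulVec, Matrix.smul_mulVec, Matrix.one_mulVec]

lemma eq_of_cvec_mulVec {A B : Matrix (Fin n ⊕ Fin n) (Fin n ⊕ Fin n) ℝ}
    (h : ∀ z, cvec (A *ᵥ z) = cvec (B *ᵥ z)) : A = B :=
  Matrix.ext_of_mulVec_single fun _ => cvec_injective (h _)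

lemma realRep_mul (A B : Matrix (Fin n) (Fin n) ℂ) : realRep (A * B) = realRep A * realRep B :=
  eq_of_cvec_mulVec fun z => by
    rw [← Matrix.mulVec_mulVec, cvec_realRep_mulVec, cvec_realRep_mulVec, cvec_realRep_mulVec,
      Matrix.mulVec_mulVec]

lemma realRep_one : realRep (1 : Matrix (Fin n) (Fin n) ℂ) = 1 :=
  eq_of_cvec_mulVec fun z => by rw [cvec_realRep_mulVec, Matrix.one_mulVec, Matrix.one_mulVec]

lemma realRep_transpose (A : Matrix (Fin n) (Fin n) ℂ) : (realRep A)ᵀ = realRep Aᴴ := by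
  rw [realRep, realRep, Matrix.fromBlocks_transpose]
  congr 1 <;> (ext i j; simp)

lemma toComplex_realRep (A : Matrix (Fin n) (Fin n) ℂ) : toComplex (realRep A) = A := by
  ext i j
  apply Complex.ext <;> simp [toComplex, realRep]

/-- `Aᴴᵀ` is the entrywise complex conjugate of `A`; it is written this way throughout. -/
lemma star_mulVec_eq (A : Matrix (Fin n) (Fin n) ℂ) (v : Fin n → ℂ) :
    star (A *ᵥ v) = Aᴴᵀ *ᵥ star v := by
  rw [Matrix.star_mulVec, Matrix.mulVec_transpose]

lemma conjRep_mul_realRep (A : Matrix (Fin n) (Fin n) ℂ) :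
    conjRep n * realRep A = realRep Aᴴᵀ * conjRep n :=
  eq_of_cvec_mulVec fun z => by
    rw [← Matrix.mulVec_mulVec, ← Matrix.mulVec_mulVec, cvec_realRep_mulVec, cvec_conjRep_mulVec,
      cvec_conjRep_mulVec, cvec_realRep_mulVec, star_mulVec_eq]

lemma conjRep_mul_conjRep : conjRep n * conjRep n = 1 :=
  eq_of_cvec_mulVec fun z => by
    rw [← Matrix.mulVec_mulVec, cvec_conjRep_mulVec, cvec_conjRep_mulVec, star_star,
      Matrix.one_mulVec]

lemma re_star_cvec_dotProduct (z z' : Fin n ⊕ Fin n → ℝ) :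
    (star (cvec z) ⬝ᵥ cvec z').re = z ⬝ᵥ z' := by
  simp [dotProduct, cvec, Fintype.sum_sum_type, Complex.mul_re, Finset.sum_add_distrib]

lemma im_star_cvec_dotProduct (z z' : Fin n ⊕ Fin n → ℝ) :
    (star (cvec z) ⬝ᵥ cvec z').im = (Matrix.J (Fin n) ℝ *ᵥ z) ⬝ᵥ z' := by
  rw [← re_star_cvec_dotProduct, cvec_J_mulVec, star_smul, smul_dotProduct]
  simp

/-- `F` is a unitary frame of the Lagrangian subspace `ℓ`. -/
structure IsFrame (ℓ : Submodule ℝ (Fin n ⊕ Fin n → ℝ)) (F : Matrix (Fin n) (Fin n) ℂ) : Prop where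
  unitary : Fᴴ * F = 1
  mem_iff : ∀ z, z ∈ ℓ ↔ ∃ c, cvec z = F *ᵥ rvec c

/-- A real orthonormal basis of a Lagrangian subspace is a unitary basis of ℂⁿ: the real parts of
the Hermitian products are the Euclidean products, and the imaginary parts vanish by isotropy. -/
lemma IsLagrangian.exists_frame {ℓ : Submodule ℝ (Fin n ⊕ Fin n → ℝ)} (h : IsLagrangian ℓ) :
    ∃ F, IsFrame ℓ F := by
  let e := (WithLp.linearEquiv 2 ℝ (Fin n ⊕ Fin n → ℝ)).symm
  let ℓ' : Submodule ℝ (EuclideanSpace ℝ (Fin n ⊕ Fin n)) := ℓ.map e.toLinearMap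
  have hd : finrank ℝ ℓ' = n := by
    rw [LinearEquiv.finrank_map_eq, h.finrank_eq]
  let b := (stdOrthonormalBasis ℝ ℓ').reindex (finCongr hd)
  let z : Fin n → (Fin n ⊕ Fin n → ℝ) := fun k => WithLp.ofLp (b k : EuclideanSpace ℝ (Fin n ⊕ Fin n))
  have hz : ∀ k, z k ∈ ℓ := fun k => by
    obtain ⟨w, hw, hwb⟩ := (b k).2
    have : z k = w := by
      change WithLp.ofLp (b k : EuclideanSpace ℝ (Fin n ⊕ Fin n)) = w
      rw [← hwb]
      rfl
    rw [this]
    exact hw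
  have hzz : ∀ k l, z k ⬝ᵥ z l = if k = l then 1 else 0 := fun k l => by
    rw [← (orthonormal_iff_ite.1 b.orthonormal k l)]
    rw [Submodule.coe_inner, PiLp.inner_apply]
    refine Finset.sum_congr rfl fun i _ => ?_
    rw [RCLike.inner_apply, conj_trivial, mul_comm]
  let F : Matrix (Fin n) (Fin n) ℂ := Matrix.of fun i k => cvec (z k) i
  have hF : ∀ c : Fin n → ℝ, F *ᵥ rvec c = cvec (∑ k, c k • z k) := fun c => by
    ext i
    simp only [F, Matrix.mulVec, dotProduct, Matrix.of_apply, rvec, cvec]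
    apply Complex.ext <;> simp [Complex.re_sum, Complex.im_sum, mul_comm]
  refine ⟨F, ?_, fun w => ⟨fun hw => ?_, ?_⟩⟩
  · ext k l
    have : (Fᴴ * F) k l = star (cvec (z k)) ⬝ᵥ cvec (z l) := rfl
    rw [this, Matrix.one_apply]
    apply Complex.ext
    · rw [re_star_cvec_dotProduct, hzz]
      split_ifs <;> simp
    · rw [im_star_cvec_dotProduct, h.isotropic _ (hz k) _ (hz l)]
      split_ifs <;> simp
  · let w' : ℓ' := ⟨e w, Submodule.mem_map_of_mem hw⟩
    refine ⟨fun k => inner ℝ (b k) w', ?_⟩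
    rw [hF]
    congr 1
    have h1 := congrArg (fun y : ℓ' => WithLp.ofLp (y : EuclideanSpace ℝ (Fin n ⊕ Fin n)))
      (b.sum_repr' w')
    have h2 : WithLp.ofLp (w' : EuclideanSpace ℝ (Fin n ⊕ Fin n)) = w := rfl
    simp only [h2] at h1
    rw [← h1, Submodule.coe_sum, WithLp.ofLp_sum]
    rfl
  · rintro ⟨c, hc⟩
    rw [hF] at hc
    rw [cvec_injective hc]
    exact ℓ.sum_mem fun k _ => ℓ.smul_mem _ (hz k)

lemma IsFrame.unitary' {ℓ : Submodule ℝ (Fin n ⊕ Fin n → ℝ)} {F : Matrix (Fin n) (Fin n) ℂ}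
    (h : IsFrame ℓ F) : F * Fᴴ = 1 := mul_eq_one_comm.1 h.unitary

/-- The complex matrix associated with a pair of Lagrangian subspaces in terms of frames. -/
lemma IsFrame.isSouriau {ℓ ℓ₁ : Submodule ℝ (Fin n ⊕ Fin n → ℝ)} {F G : Matrix (Fin n) (Fin n) ℂ}
    (hF : IsFrame ℓ F) (hG : IsFrame ℓ₁ G) : IsSouriau ℓ ℓ₁ (-(F * Fᵀ * (Gᴴᵀ * Gᴴ))) := by
  have hGt : Gᵀ * Gᴴᵀ = 1 := by rw [← Matrix.transpose_mul, hG.unitary, Matrix.transpose_one]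
  -- The orthogonal complement of `ℓ₁ = G ℝⁿ` is `i G ℝⁿ`, and this unitary matrix carries it to `F
  -- ℝⁿ = ℓ`.
  set A : Matrix (Fin n) (Fin n) ℂ := -(Complex.I • (F * Gᴴ)) with hA
  have hAh : Aᴴ = Complex.I • (G * Fᴴ) := by
    rw [hA]
    simp [Matrix.conjTranspose_mul]
  have hAA : Aᴴ * A = 1 := by
    rw [hAh, hA, mul_neg, Matrix.smul_mul, Matrix.mul_smul, smul_smul, Complex.I_mul_I,
      neg_smul, one_smul, neg_neg, Matrix.mul_assoc, ← Matrix.mul_assoc Fᴴ, hF.unitary,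
      Matrix.one_mul, hG.unitary']
  -- The conjugation of `ℓ₁` is `v ↦ G Gᵀ v̄`: it fixes `G c` and negates `i G c` for real `c`.
  refine ⟨realRep A, realRep (G * Gᵀ) * conjRep n, ⟨?_, ?_, ?_⟩, fun x hx y hy => ?_,
    fun z => ?_, ?_⟩
  · rw [realRep_transpose, ← realRep_mul, hAA, realRep_one]
  · rw [realRep_transpose, ← realRep_mul, mul_eq_one_comm.1 hAA, realRep_one]
  · rw [J_eq_realRep, ← realRep_mul, ← realRep_mul, Matrix.mul_smul, Matrix.smul_mul, mul_one,
      one_mul]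
  · obtain ⟨a, ha⟩ := (hG.mem_iff x).1 hx
    obtain ⟨b, hb⟩ := (hG.mem_iff y).1 hy
    apply cvec_injective
    rw [← Matrix.mulVec_mulVec, cvec_realRep_mulVec, cvec_conjRep_mulVec, cvec_add, cvec_sub,
      cvec_J_mulVec, ha, hb, star_add, star_smul, star_mulVec_eq, star_mulVec_eq, star_rvec,
      star_rvec, Matrix.mulVec_add, Matrix.mulVec_smul, Matrix.mulVec_mulVec, Matrix.mulVec_mulVec,
      Matrix.mul_assoc, hGt, Matrix.mul_one, sub_eq_add_neg]
    simp
  · have horth : ∀ v, (∀ x ∈ ℓ₁, x ⬝ᵥ v = 0) ↔ ∃ c, cvec v = Complex.I • (G *ᵥ rvec c) := by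
      intro v
      constructor
      · intro h
        have him : ∀ i, ((-Complex.I • (Gᴴ *ᵥ cvec v)) i).im = 0 := fun i => by
          obtain ⟨x, hx⟩ := exists_cvec_eq (G *ᵥ rvec (Pi.single i 1))
          have h1 := h x ((hG.mem_iff x).2 ⟨_, hx⟩)
          rw [← re_star_cvec_dotProduct, hx, Matrix.star_mulVec, star_rvec,
            ← Matrix.dotProduct_mulVec] at h1
          have h2 : rvec (Pi.single i (1 : ℝ)) = Pi.single i (1 : ℂ) := by
            ext j
            by_cases hj : j = i <;> simp [rvec, hj]
          rw [h2, single_one_dotProduct] at h1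
          simp [h1]
        obtain ⟨c, hc⟩ := eq_rvec_of_im_eq_zero him
        refine ⟨c, ?_⟩
        rw [hc, Matrix.mulVec_smul, Matrix.mulVec_mulVec, hG.unitary', Matrix.one_mulVec,
          smul_smul]
        simp
      · rintro ⟨c, hc⟩ x hx
        obtain ⟨a, ha⟩ := (hG.mem_iff x).1 hx
        rw [← re_star_cvec_dotProduct, hc, ha, Matrix.star_mulVec, star_rvec, dotProduct_smul,
          ← Matrix.dotProduct_mulVec, Matrix.mulVec_mulVec, hG.unitary, Matrix.one_mulVec]
        simp [rvec, dotProduct, Complex.im_sum]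
    simp only [horth]
    rw [hF.mem_iff]
    constructor
    · rintro ⟨c, hc⟩
      obtain ⟨v, hv⟩ := exists_cvec_eq (Complex.I • (G *ᵥ rvec c))
      refine ⟨v, ⟨c, hv⟩, cvec_injective ?_⟩
      rw [cvec_realRep_mulVec, hv, hc, hA, Matrix.neg_mulVec, Matrix.smul_mulVec,
        Matrix.mulVec_smul, smul_smul, Complex.I_mul_I, neg_smul, one_smul, neg_neg,
        Matrix.mulVec_mulVec, Matrix.mul_assoc, hG.unitary, Matrix.mul_one]
    · rintro ⟨v, ⟨c, hv⟩, rfl⟩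
      refine ⟨c, ?_⟩
      rw [cvec_realRep_mulVec, hv, hA, Matrix.neg_mulVec, Matrix.smul_mulVec,
        Matrix.mulVec_smul, smul_smul, Complex.I_mul_I, neg_smul, one_smul, neg_neg,
        Matrix.mulVec_mulVec, Matrix.mul_assoc, hG.unitary, Matrix.mul_one]
  · have h1 : realRep (G * Gᵀ) * conjRep n * (realRep A)ᵀ * (realRep (G * Gᵀ) * conjRep n) =
        realRep (G * Gᵀ * (Aᴴᴴᵀ * (G * Gᵀ)ᴴᵀ)) := by
      rw [realRep_transpose, Matrix.mul_assoc, Matrix.mul_assoc, ← Matrix.mul_assoc (realRep Aᴴ),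
        ← realRep_mul, ← Matrix.mul_assoc (conjRep n), conjRep_mul_realRep, Matrix.mul_assoc,
        conjRep_mul_conjRep, Matrix.mul_one, ← realRep_mul, Matrix.conjTranspose_mul,
        Matrix.transpose_mul]
    rw [h1, ← realRep_mul, toComplex_realRep]
    have h2 : Aᴴᴴᵀ = -(Complex.I • (Gᴴᵀ * Fᵀ)) := by
      rw [Matrix.conjTranspose_conjTranspose, hA]
      simp
    have h3 : (G * Gᵀ)ᴴᵀ = Gᴴᵀ * Gᴴ := by
      rw [Matrix.conjTranspose_mul, Matrix.transpose_mul]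
      rfl
    rw [h2, h3, hA]
    simp only [neg_mul, mul_neg, Matrix.smul_mul, Matrix.mul_smul, neg_neg, smul_smul,
      Complex.I_mul_I, neg_smul, one_smul]
    congr 1
    symm
    calc F * Gᴴ * (G * Gᵀ * (Gᴴᵀ * Fᵀ * (Gᴴᵀ * Gᴴ)))
        = F * ((Gᴴ * G) * ((Gᵀ * Gᴴᵀ) * (Fᵀ * (Gᴴᵀ * Gᴴ)))) := by simp only [Matrix.mul_assoc]
      _ = _ := by rw [hG.unitary, hGt, Matrix.one_mul, Matrix.one_mul, Matrix.mul_assoc]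

end ComplexStructure

end

end MaslovMorse

namespace MaslovMorse

noncomputable section

open Module QuadraticForm

/-! ### Counting eigenvalues on an arc by a symmetric operator. -/

section ArcCount

variable {n : ℕ}

/-- The real part of a complex matrix, as an operator. -/
def reOp (M : Matrix (Fin n) (Fin n) ℂ) : EuclideanSpace ℝ (Fin n) →L[ℝ] EuclideanSpace ℝ (Fin n) :=
  toCLM (M.map Complex.re)

/-- The imaginary part of a complex matrix, as an operator. -/
def imOp (M : Matrix (Fin n) (Fin n) ℂ) : EuclideanSpace ℝ (Fin n) →L[ℝ] EuclideanSpace ℝ (Fin n) :=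
  toCLM (M.map Complex.im)

/-- The vector `x + i y`. -/
def pvec (x y : EuclideanSpace ℝ (Fin n)) : Fin n → ℂ :=
  cvec (Sum.elim (WithLp.ofLp x) (WithLp.ofLp y))

lemma mulVec_rvec (M : Matrix (Fin n) (Fin n) ℂ) (c : EuclideanSpace ℝ (Fin n)) :
    M *ᵥ rvec (WithLp.ofLp c) = pvec (reOp M c) (imOp M c) := by
  ext i
  apply Complex.ext
  · change _ = (M.map Complex.re *ᵥ WithLp.ofLp c) i
    simp [Matrix.mulVec, dotProduct, rvec]
  · change _ = (M.map Complex.im *ᵥ WithLp.ofLp c) i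
    simp [Matrix.mulVec, dotProduct, rvec]

lemma pvec_injective {x y x' y' : EuclideanSpace ℝ (Fin n)} (h : pvec x y = pvec x' y') :
    x = x' ∧ y = y' := by
  have := cvec_injective h
  exact ⟨PiLp.ext fun i => congrFun this (Sum.inl i), PiLp.ext fun i => congrFun this (Sum.inr i)⟩

lemma im_star_pvec_dotProduct (x y x' y' : EuclideanSpace ℝ (Fin n)) :
    (star (pvec x y) ⬝ᵥ pvec x' y').im = inner ℝ x y' - inner ℝ y x' := by
  simp only [pvec, cvec, dotProduct, Complex.im_sum, PiLp.inner_apply, RCLike.inner_apply,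
    conj_trivial, Pi.star_apply, ← Finset.sum_sub_distrib]
  refine Finset.sum_congr rfl fun i _ => ?_
  simp
  ring

lemma inner_reOp_imOp_sub (M N : Matrix (Fin n) (Fin n) ℂ) (c c' : EuclideanSpace ℝ (Fin n)) :
    inner ℝ (reOp M c) (imOp N c') - inner ℝ (imOp M c) (reOp N c') =
      (rvec (WithLp.ofLp c) ⬝ᵥ (Mᴴ * N) *ᵥ rvec (WithLp.ofLp c')).im := by
  rw [← im_star_pvec_dotProduct, ← mulVec_rvec, ← mulVec_rvec, Matrix.star_mulVec, star_rvec,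
    ← Matrix.dotProduct_mulVec, Matrix.mulVec_mulVec]

/-- The complex kernel of a real matrix is the complexification of the real one. Both sides are
compared through real dimensions, each doubled. -/
lemma finrank_ker_map_ofReal (N : Matrix (Fin n) (Fin n) ℝ) :
    finrank ℂ (LinearMap.ker (Matrix.toLin' (N.map Complex.ofReal))) =
      finrank ℝ (LinearMap.ker (Matrix.toEuclideanLin N)) := by
  set S := LinearMap.ker (Matrix.toLin' (N.map Complex.ofReal))
  set R := LinearMap.ker (Matrix.toEuclideanLin N)
  have key : ∀ x y : EuclideanSpace ℝ (Fin n), pvec x y ∈ S ↔ x ∈ R ∧ y ∈ R := by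
    intro x y
    have : N.map Complex.ofReal *ᵥ pvec x y =
        pvec (Matrix.toEuclideanLin N x) (Matrix.toEuclideanLin N y) := by
      ext i
      apply Complex.ext
      · change _ = (N *ᵥ WithLp.ofLp x) i
        simp [Matrix.mulVec, dotProduct, pvec, cvec]
      · change _ = (N *ᵥ WithLp.ofLp y) i
        simp [Matrix.mulVec, dotProduct, pvec, cvec]
    rw [LinearMap.mem_ker, LinearMap.mem_ker, LinearMap.mem_ker, Matrix.toLin'_apply, this]
    constructor
    · intro h
      exact pvec_injective (x' := 0) (y' := 0) h
    · rintro ⟨h1, h2⟩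
      rw [h1, h2]
      rfl
  let f : (R × R) →ₗ[ℝ] S :=
    { toFun := fun p => ⟨pvec p.1 p.2, (key _ _).2 ⟨p.1.2, p.2.2⟩⟩
      map_add' := fun p q => rfl
      map_smul' := fun r p => Subtype.ext (by
        ext i
        apply Complex.ext <;> simp [pvec, cvec]) }
  have hf : Function.Bijective f := by
    constructor
    · intro p q h
      obtain ⟨h1, h2⟩ := pvec_injective (congrArg Subtype.val h)
      exact Prod.ext (Subtype.ext h1) (Subtype.ext h2)
    · rintro ⟨v, hv⟩
      have hv' : pvec (WithLp.toLp 2 fun i => (v i).re) (WithLp.toLp 2 fun i => (v i).im) = v := rfl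
      rw [← hv'] at hv
      exact ⟨(⟨_, ((key _ _).1 hv).1⟩, ⟨_, ((key _ _).1 hv).2⟩), rfl⟩
  have h1 := (LinearEquiv.ofBijective f hf).finrank_eq
  rw [finrank_prod, finrank_real_of_complex] at h1
  omega

lemma finrank_ker_toLin'_eq {A B X Y : Matrix (Fin n) (Fin n) ℂ} (hX : IsUnit X) (hY : IsUnit Y)
    (h : A * Y = X * B) :
    finrank ℂ (LinearMap.ker (Matrix.toLin' A)) = finrank ℂ (LinearMap.ker (Matrix.toLin' B)) := by
  have hYi : Function.Injective (Matrix.toLin' Y) := Matrix.mulVec_injective_iff_isUnit.2 hY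
  have hXi := Matrix.mulVec_injective_iff_isUnit.2 hX
  rw [(Submodule.equivMapOfInjective _ hYi (LinearMap.ker (Matrix.toLin' B))).finrank_eq]
  suffices hk : LinearMap.ker (Matrix.toLin' A) =
      (LinearMap.ker (Matrix.toLin' B)).map (Matrix.toLin' Y) by rw [hk]
  have hv : ∀ v, A *ᵥ (Y *ᵥ v) = X *ᵥ (B *ᵥ v) := fun v => by
    rw [Matrix.mulVec_mulVec, h, ← Matrix.mulVec_mulVec]
  ext v
  simp only [Submodule.mem_map, LinearMap.mem_ker, Matrix.toLin'_apply]
  constructor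
  · intro hvA
    obtain ⟨w, rfl⟩ := Matrix.mulVec_surjective_iff_isUnit.2 hY v
    refine ⟨w, hXi ?_, rfl⟩
    rw [← hv, hvA, Matrix.mulVec_zero]
  · rintro ⟨w, hw, rfl⟩
    rw [hv, hw, Matrix.mulVec_zero]

/-- The operator whose kernel corresponds to the eigenvalue `e^{i(π + 2x)}`. -/
def arcOp (M : Matrix (Fin n) (Fin n) ℂ) (x : ℝ) :
    EuclideanSpace ℝ (Fin n) →L[ℝ] EuclideanSpace ℝ (Fin n) :=
  Real.cos x • imOp M - Real.sin x • reOp M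

/-- With `w = e^{iθ/2}` and `z = -w²` one has `-M - z M̄ = -2 i w (cos (θ/2) Im M - sin (θ/2) Re
M)`. Since `(W - z) G M̄ = G (-M - z M̄)`, the eigenspace is the kernel of a real matrix up to
invertible factors. -/
lemma finrank_eigenspace_eq {W G M : Matrix (Fin n) (Fin n) ℂ} (hG : IsUnit G) (hM : IsUnit M)
    (h : W * (G * Mᴴᵀ) = -(G * M)) (θ : ℝ) :
    finrank ℂ (End.eigenspace (Matrix.toLin' W)
      (Complex.exp (Complex.I * ((Real.pi + θ : ℝ) : ℂ)))) =
    finrank ℝ (LinearMap.ker (arcOp M (θ / 2)).toLinearMap) := by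
  set z := Complex.exp (Complex.I * ((Real.pi + θ : ℝ) : ℂ)) with hz
  set N : Matrix (Fin n) (Fin n) ℝ :=
    Real.cos (θ / 2) • M.map Complex.im - Real.sin (θ / 2) • M.map Complex.re with hN
  set w := Complex.exp (Complex.I * ((θ / 2 : ℝ) : ℂ)) with hw
  have hzw : z = -w ^ 2 := by
    rw [hz, hw, ← Complex.exp_nat_mul, ← neg_one_mul, ← Complex.exp_pi_mul_I, ← Complex.exp_add]
    congr 1
    push_cast
    ring
  have hwcs : w = Complex.cos ((θ / 2 : ℝ) : ℂ) + Complex.sin ((θ / 2 : ℝ) : ℂ) * Complex.I := by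
    rw [hw, mul_comm, Complex.exp_mul_I]
  have hcs := Complex.cos_sq_add_sin_sq ((θ / 2 : ℝ) : ℂ)
  have hu : -2 * Complex.I * w ≠ 0 := by
    simp [hw, Complex.exp_ne_zero, Complex.I_ne_zero]
  have hNM : -M - z • Mᴴᵀ = (-2 * Complex.I * w) • N.map Complex.ofReal := by
    ext i j
    have hM : M i j = (M i j).re + (M i j).im * Complex.I := (Complex.re_add_im _).symm
    have hMc : Mᴴᵀ i j = (M i j).re - (M i j).im * Complex.I := by
      rw [Matrix.transpose_apply, Matrix.conjTranspose_apply]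
      apply Complex.ext <;> simp
    rw [Matrix.sub_apply, Matrix.neg_apply, Matrix.smul_apply, hMc, Matrix.smul_apply,
      Matrix.map_apply, hN]
    simp only [Matrix.sub_apply, Matrix.smul_apply, Matrix.map_apply, smul_eq_mul]
    push_cast
    rw [hzw, hwcs]
    push_cast at hcs ⊢
    linear_combination (-1 : ℂ) * hM + ((M i j).re + Complex.I * (M i j).im : ℂ) * hcs +
      (-(Complex.sin (θ / 2)) ^ 2 * (M i j).re -
        (M i j).im * (Complex.sin (θ / 2)) ^ 2 * Complex.I : ℂ) * Complex.I_sq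
  have hMc : IsUnit Mᴴᵀ := by
    rw [Matrix.isUnit_transpose, Matrix.isUnit_conjTranspose]
    exact hM
  have hker : LinearMap.ker (arcOp M (θ / 2)).toLinearMap =
      LinearMap.ker (Matrix.toEuclideanLin N) := by
    congr 1
    rw [hN, map_sub, map_smul, map_smul]
    rfl
  rw [hker, ← finrank_ker_map_ofReal]
  have heig : End.eigenspace (Matrix.toLin' W) z = LinearMap.ker (Matrix.toLin' (W - z • 1)) := by
    rw [End.eigenspace_def, map_sub, map_smul, Matrix.toLin'_one]
    rfl
  rw [heig]
  have hsmul : LinearMap.ker (Matrix.toLin' (N.map Complex.ofReal)) =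
      LinearMap.ker (Matrix.toLin' ((-2 * Complex.I * w) • N.map Complex.ofReal)) := by
    rw [map_smul, LinearMap.ker_smul _ _ hu]
  rw [hsmul]
  refine finrank_ker_toLin'_eq (X := G) (Y := G * Mᴴᵀ) hG (hG.mul hMc) ?_
  rw [Matrix.sub_mul, h, Matrix.smul_mul, Matrix.one_mul, ← hNM, Matrix.mul_sub, Matrix.mul_neg,
    Matrix.mul_smul]

/-- This is the change of variable from half-angles on the arc to nonnegative eigenvalues in the
chart. Injectivity follows from `sin x sin (e - y) - sin y sin (e - x) = sin e sin (x - y)`,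
surjectivity from the intermediate value theorem. -/
lemma bijOn_sin_div_sin {e : ℝ} (he : 0 < e) (he' : e < Real.pi) :
    Set.BijOn (fun x => Real.sin x / Real.sin (e - x)) (Set.Ico 0 e) (Set.Ici 0) := by
  have hpos : ∀ x ∈ Set.Ico 0 e, 0 < Real.sin (e - x) := fun x hx =>
    Real.sin_pos_of_pos_of_lt_pi (by linarith [hx.2]) (by linarith [hx.1])
  refine ⟨fun x hx => ?_, fun x hx y hy h => ?_, fun a ha => ?_⟩
  · exact div_nonneg (Real.sin_nonneg_of_nonneg_of_le_pi hx.1 (by linarith [hx.2])) (hpos x hx).le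
  · simp only at h
    rw [div_eq_div_iff (hpos x hx).ne' (hpos y hy).ne'] at h
    have h1 : Real.sin e * Real.sin (x - y) = 0 := by
      have : Real.sin x * Real.sin (e - y) - Real.sin y * Real.sin (e - x) =
          Real.sin e * Real.sin (x - y) := by
        simp only [Real.sin_sub]
        ring
      rw [← this, h, sub_self]
    have h2 := (mul_eq_zero.1 h1).resolve_left (Real.sin_pos_of_pos_of_lt_pi he he').ne'
    have h3 := (Real.sin_eq_zero_iff_of_lt_of_lt (by linarith [hx.1, hy.2])
      (by linarith [hx.2, hy.1])).1 h2
    linarith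
  · have hcont : ContinuousOn (fun x => Real.sin x - a * Real.sin (e - x)) (Set.Icc 0 e) := by
      fun_prop
    have hse := Real.sin_pos_of_pos_of_lt_pi he he'
    obtain ⟨x, hx, hx0⟩ := intermediate_value_Icc he.le hcont (show (0 : ℝ) ∈ Set.Icc _ _ from by
      have : 0 ≤ a * Real.sin e := mul_nonneg ha hse.le
      constructor <;> simp <;> linarith)
    simp only at hx0
    have hxe : x ≠ e := by
      rintro rfl
      rw [sub_self, Real.sin_zero, mul_zero, sub_zero] at hx0
      exact hse.ne' hx0
    have hx' : x ∈ Set.Ico 0 e := ⟨hx.1, lt_of_le_of_ne hx.2 hxe⟩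
    refine ⟨x, hx', ?_⟩
    simp only
    rw [div_eq_iff (hpos x hx').ne']
    linarith

lemma eigenspace_toLin'_eq_bot {W : Matrix (Fin n) (Fin n) ℂ} {z : ℂ} (hz : z ∉ spectrum ℂ W) :
    End.eigenspace (Matrix.toLin' W) z = ⊥ := by
  by_contra h
  exact hz (by
    rw [← Matrix.spectrum_toLin']
    exact End.hasEigenvalue_iff_mem_spectrum.1 h)

/-- The number of eigenvalues on an arc in terms of a symmetric operator. -/
lemma arcCount_add_sigNeg {W G M : Matrix (Fin n) (Fin n) ℂ} (hG : IsUnit G) (hM : IsUnit M)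
    (h : W * (G * Mᴴᵀ) = -(G * M))
    (hsymm : ∀ c c', inner ℝ (imOp M c) (reOp M c') = inner ℝ (reOp M c) (imOp M c'))
    {ε : ℝ} (hε : 0 < ε) (hε' : ε < Real.pi)
    (hspec : Complex.exp (Complex.I * ((Real.pi + ε : ℝ) : ℂ)) ∉ spectrum ℂ W) :
    IsUnit (arcOp M (ε / 2)) ∧
      arcCount W ε + sigNeg (chartForm (arcOp M (ε / 2)) (-imOp M) ⊤) = n := by
  set e := ε / 2 with he
  have he0 : 0 < e := by positivity
  have heπ : e < Real.pi := by linarith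
  set T := arcOp M e with hT
  have hTu : IsUnit T := by
    have h0 := finrank_eigenspace_eq hG hM h ε
    rw [eigenspace_toLin'_eq_bot hspec, finrank_bot, eq_comm, Submodule.finrank_eq_zero,
      LinearMap.ker_eq_bot'] at h0
    exact isUnit_of_injective h0
  refine ⟨hTu, ?_⟩
  have hs : ∀ w w', inner ℝ ((-imOp M) w) (T w') = inner ℝ (T w) ((-imOp M) w') := fun w w' => by
    simp only [hT, arcOp, neg_apply, sub_apply, smul_apply, inner_neg_left, inner_neg_right,
      inner_sub_left, inner_sub_right, inner_smul_left, inner_smul_right, conj_trivial, hsymm]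
    ring
  have hA := isSymmetric_mul_inverse hTu hs
  set A := (-imOp M * Ring.inverse T).toLinearMap with hAdef
  have hAT : ∀ c, A (T c) = -imOp M c := fun c => by
    change (-imOp M) (Ring.inverse T (T c)) = _
    rw [inverse_apply_apply hTu]
    rfl
  have hsig : sigNeg (chartForm T (-imOp M) ⊤) = sigNeg (opForm A) :=
    QuadraticMap.Equivalent.sigNeg_eq ⟨⟨Submodule.topEquiv, fun _ => rfl⟩⟩
  have hsum := finsum_finrank_eigenspace_nonneg hA
  rw [finrank_euclideanSpace_fin] at hsum
  rw [hsig]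
  refine Eq.trans ?_ hsum
  congr 1
  have hse := Real.sin_pos_of_pos_of_lt_pi he0 heπ
  rw [arcCount]
  refine finsum_mem_eq_of_bijOn (fun θ => Real.sin (θ / 2) / Real.sin (e - θ / 2))
    ((bijOn_sin_div_sin he0 heπ).comp (f := fun θ => θ / 2) (s := Set.Ico 0 ε)
      ⟨fun θ hθ => ?_, fun a _ b _ hab => ?_, fun x hx => ?_⟩) fun θ hθ => ?_
  · exact ⟨by linarith [hθ.1], by linarith [hθ.2]⟩
  · simp only at hab
    linarith
  · exact ⟨2 * x, ⟨by linarith [hx.1], by linarith [hx.2]⟩, by simp⟩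
  · rw [finrank_eigenspace_eq hG hM h]
    set x := θ / 2 with hx
    have hx1 : 0 < Real.sin (e - x) :=
      Real.sin_pos_of_pos_of_lt_pi (by linarith [hθ.2]) (by linarith [hθ.1])
    have hTi : Function.Injective T.toLinearMap := fun c c' hc => by
      rw [← inverse_apply_apply hTu c, ← inverse_apply_apply hTu c']
      exact congrArg _ hc
    rw [(Submodule.equivMapOfInjective _ hTi _).finrank_eq]
    suffices hk : (LinearMap.ker (arcOp M x).toLinearMap).map T.toLinearMap =
        End.eigenspace A (Real.sin x / Real.sin (e - x)) by rw [hk]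
    -- Each `arcOp M x` is a combination of `imOp M` and `T = arcOp M e`, so its kernel is the
    -- eigenspace of `-imOp M ∘ T⁻¹` for `sin x / sin (e - x)`, transported by `T`.
    have key : ∀ c, Real.sin e • arcOp M x c =
        Real.sin (e - x) • imOp M c + Real.sin x • T c := fun c => by
      simp only [hT, arcOp, sub_apply, smul_apply, Real.sin_sub]
      module
    have key2 : ∀ c, arcOp M x c = 0 ↔ A (T c) = (Real.sin x / Real.sin (e - x)) • T c := fun c => by
      rw [← smul_right_injective _ hse.ne' |>.eq_iff, smul_zero, key, hAT]
      have : (Real.sin x / Real.sin (e - x)) • T c =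
          (Real.sin (e - x))⁻¹ • (Real.sin x • T c) := by
        rw [smul_smul, div_eq_inv_mul]
      rw [this, eq_inv_smul_iff₀ hx1.ne', smul_neg, neg_eq_iff_add_eq_zero]
    ext y
    simp only [Submodule.mem_map, LinearMap.mem_ker, End.mem_eigenspace_iff]
    constructor
    · rintro ⟨c, hc, rfl⟩
      exact (key2 c).1 hc
    · intro hy
      rw [← apply_inverse_apply hTu y] at hy
      exact ⟨_, (key2 _).2 hy, apply_inverse_apply hTu y⟩

end ArcCount

end

end MaslovMorse

namespace MaslovMorse

noncomputable section

open Topology Filter Module QuadraticForm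

/-! ### The unitary matrices along a parametrized path of Lagrangian subspaces. -/

section LagrangianPath

variable {n : ℕ}

/-- The complex matrix with real part `P` and imaginary part `Q`. -/
def pairMat (P Q : EuclideanSpace ℝ (Fin n) →L[ℝ] EuclideanSpace ℝ (Fin n)) :
    Matrix (Fin n) (Fin n) ℂ :=
  (Matrix.toEuclideanLin.symm P.toLinearMap).map Complex.ofReal +
    Complex.I • (Matrix.toEuclideanLin.symm Q.toLinearMap).map Complex.ofReal

lemma reOp_pairMat (P Q : EuclideanSpace ℝ (Fin n) →L[ℝ] EuclideanSpace ℝ (Fin n)) :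
    reOp (pairMat P Q) = P := by
  have h : (pairMat P Q).map Complex.re = Matrix.toEuclideanLin.symm P.toLinearMap := by
    ext i j
    simp [pairMat]
  ext1 c
  change Matrix.toEuclideanLin ((pairMat P Q).map Complex.re) c = P c
  rw [h, LinearEquiv.apply_symm_apply]
  rfl

lemma imOp_pairMat (P Q : EuclideanSpace ℝ (Fin n) →L[ℝ] EuclideanSpace ℝ (Fin n)) :
    imOp (pairMat P Q) = Q := by
  have h : (pairMat P Q).map Complex.im = Matrix.toEuclideanLin.symm Q.toLinearMap := by
    ext i j
    simp [pairMat]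
  ext1 c
  change Matrix.toEuclideanLin ((pairMat P Q).map Complex.im) c = Q c
  rw [h, LinearEquiv.apply_symm_apply]
  rfl

lemma pairMat_mulVec_rvec (P Q : EuclideanSpace ℝ (Fin n) →L[ℝ] EuclideanSpace ℝ (Fin n))
    (c : EuclideanSpace ℝ (Fin n)) :
    pairMat P Q *ᵥ rvec (WithLp.ofLp c) = pvec (P c) (Q c) := by
  rw [mulVec_rvec, reOp_pairMat, imOp_pairMat]

lemma continuous_pairMat
    {P Q : ℝ → EuclideanSpace ℝ (Fin n) →L[ℝ] EuclideanSpace ℝ (Fin n)}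
    (hP : Continuous P) (hQ : Continuous Q) : Continuous fun t => pairMat (P t) (Q t) := by
  let f : (EuclideanSpace ℝ (Fin n) →L[ℝ] EuclideanSpace ℝ (Fin n)) →ₗ[ℝ] Matrix (Fin n) (Fin n) ℝ :=
    Matrix.toEuclideanLin.symm.toLinearMap ∘ₗ ContinuousLinearMap.coeLM ℝ
  have h : Continuous f := LinearMap.continuous_of_finiteDimensional f
  exact ((h.comp hP).matrix_map Complex.continuous_ofReal).add
    (((h.comp hQ).matrix_map Complex.continuous_ofReal).const_smul Complex.I)

lemma sumElim_eq_zero {x y : EuclideanSpace ℝ (Fin n)}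
    (h : Sum.elim (WithLp.ofLp x) (WithLp.ofLp y) = 0) : x = 0 ∧ y = 0 :=
  ⟨PiLp.ext fun i => congrFun h (Sum.inl i), PiLp.ext fun i => congrFun h (Sum.inr i)⟩

lemma isLagrangian_of_param {ℓ : Submodule ℝ (Fin n ⊕ Fin n → ℝ)}
    {P Q : EuclideanSpace ℝ (Fin n) →L[ℝ] EuclideanSpace ℝ (Fin n)}
    (hmem : ∀ z, z ∈ ℓ ↔ ∃ c, z = Sum.elim (WithLp.ofLp (P c)) (WithLp.ofLp (Q c)))
    (hinj : ∀ c, P c = 0 → Q c = 0 → c = 0)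
    (hsymm : ∀ c c', inner ℝ (Q c) (P c') = inner ℝ (P c) (Q c')) : IsLagrangian ℓ := by
  let φ : EuclideanSpace ℝ (Fin n) →ₗ[ℝ] (Fin n ⊕ Fin n → ℝ) :=
    { toFun := fun c => Sum.elim (WithLp.ofLp (P c)) (WithLp.ofLp (Q c))
      map_add' := fun c c' => by ext i; rcases i with i | i <;> simp
      map_smul' := fun r c => by ext i; rcases i with i | i <;> simp }
  have hφ : Function.Injective φ := (injective_iff_map_eq_zero φ).2 fun c hc =>
    hinj c (sumElim_eq_zero hc).1 (sumElim_eq_zero hc).2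
  have hℓ : ℓ = LinearMap.range φ := by
    ext z
    rw [hmem, LinearMap.mem_range]
    exact exists_congr fun c => eq_comm
  refine ⟨?_, fun x hx y hy => ?_⟩
  · rw [hℓ, LinearMap.finrank_range_of_inj hφ, finrank_euclideanSpace_fin]
  · obtain ⟨c, rfl⟩ := (hmem x).1 hx
    obtain ⟨c', rfl⟩ := (hmem y).1 hy
    rw [← im_star_cvec_dotProduct]
    refine (im_star_pvec_dotProduct _ _ _ _).trans ?_
    rw [hsymm, sub_self]

/-- The columns of `Z = P + i Q` lie in `ℓ`, so `Z = F R` with `R` real and invertible, and `F Fᵀ Z̄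
= F (Fᵀ F̄) R = Z`. Thus `F Fᵀ = Z Z̄⁻¹` is independent of the frame and depends continuously on
`Z`, although frames are chosen separately for each parameter. -/
lemma IsFrame.mul_transpose_mul {ℓ : Submodule ℝ (Fin n ⊕ Fin n → ℝ)}
    {F : Matrix (Fin n) (Fin n) ℂ} (hF : IsFrame ℓ F)
    {P Q : EuclideanSpace ℝ (Fin n) →L[ℝ] EuclideanSpace ℝ (Fin n)}
    (hmem : ∀ z, z ∈ ℓ ↔ ∃ c, z = Sum.elim (WithLp.ofLp (P c)) (WithLp.ofLp (Q c)))
    (hinj : ∀ c, P c = 0 → Q c = 0 → c = 0) :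
    IsUnit (pairMat P Q) ∧ F * Fᵀ * (pairMat P Q)ᴴᵀ = pairMat P Q := by
  set Z := pairMat P Q with hZ
  set R : Matrix (Fin n) (Fin n) ℝ := (Fᴴ * Z).map Complex.re with hR
  have hreal : ∀ c : EuclideanSpace ℝ (Fin n), ∃ c', Z *ᵥ rvec (WithLp.ofLp c) = F *ᵥ rvec c' :=
    fun c => by
      rw [hZ, pairMat_mulVec_rvec]
      exact (hF.mem_iff _).1 ((hmem _).2 ⟨c, rfl⟩)
  have hS : Fᴴ * Z = R.map Complex.ofReal := by
    ext i j
    obtain ⟨c', hc'⟩ := hreal (EuclideanSpace.single j 1)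
    have h1 : rvec (WithLp.ofLp (EuclideanSpace.single j (1 : ℝ))) = Pi.single j (1 : ℂ) := by
      ext k
      by_cases hk : k = j <;> simp [rvec, hk]
    have h2 := congrFun (congrArg (Fᴴ *ᵥ ·) hc') i
    simp only [Matrix.mulVec_mulVec, hF.unitary, Matrix.one_mulVec] at h2
    rw [h1, Matrix.mulVec_single_one] at h2
    have h3 : (Fᴴ * Z) i j = (c' i : ℂ) := h2
    rw [Matrix.map_apply, hR, Matrix.map_apply, h3, Complex.ofReal_re]
  have hZF : Z = F * R.map Complex.ofReal := by
    rw [← hS, ← Matrix.mul_assoc, hF.unitary', Matrix.one_mul]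
  have hRu : IsUnit R := by
    rw [← Matrix.mulVec_injective_iff_isUnit]
    refine (injective_iff_map_eq_zero R.mulVecLin).2 fun v hv => ?_
    rw [Matrix.mulVecLin_apply] at hv
    have h1 : R.map Complex.ofReal *ᵥ rvec v = 0 := by
      have : R.map Complex.ofReal *ᵥ rvec v = rvec (R *ᵥ v) := by
        ext i
        simp [Matrix.mulVec, dotProduct, rvec]
      rw [this, hv]
      ext i
      simp [rvec]
    have h2 : Z *ᵥ rvec v = 0 := by
      rw [hZF, ← Matrix.mulVec_mulVec, h1, Matrix.mulVec_zero]
    have h3 := pairMat_mulVec_rvec P Q (WithLp.toLp 2 v)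
    rw [← hZ, WithLp.ofLp_toLp, h2] at h3
    have h4 : pvec (0 : EuclideanSpace ℝ (Fin n)) 0 = 0 := rfl
    rw [← h4] at h3
    obtain ⟨h5, h6⟩ := pvec_injective h3
    exact congrArg WithLp.ofLp (hinj _ h5.symm h6.symm)
  have hSu : IsUnit (R.map Complex.ofReal) := hRu.map Complex.ofRealHom.mapMatrix
  have hFu : IsUnit F := IsUnit.of_mul_eq_one _ hF.unitary'
  refine ⟨hZF ▸ hFu.mul hSu, ?_⟩
  have h1 : Zᴴᵀ = Fᴴᵀ * R.map Complex.ofReal := by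
    rw [hZF, Matrix.conjTranspose_mul, Matrix.transpose_mul]
    congr 1
    ext i j
    simp
  have h2 : Fᵀ * Fᴴᵀ = 1 := by rw [← Matrix.transpose_mul, hF.unitary, Matrix.transpose_one]
  rw [h1, Matrix.mul_assoc, ← Matrix.mul_assoc Fᵀ, h2, Matrix.one_mul, ← hZF]

/-- The complex matrix associated with the Lagrangian subspace of the pairs `(P c, Q c)` and a frame
of the target. -/
def souriau (G Z : Matrix (Fin n) (Fin n) ℂ) : Matrix (Fin n) (Fin n) ℂ :=
  -(Z * (Zᴴᵀ)⁻¹ * (Gᴴᵀ * Gᴴ))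

lemma isUnit_det_conj {Z : Matrix (Fin n) (Fin n) ℂ} (hZ : IsUnit Z) : IsUnit (Zᴴᵀ).det := by
  rw [← Matrix.isUnit_iff_isUnit_det, Matrix.isUnit_transpose, Matrix.isUnit_conjTranspose]
  exact hZ

lemma isSouriau_souriau {ℓ ℓ₁ : Submodule ℝ (Fin n ⊕ Fin n → ℝ)}
    {F G Z : Matrix (Fin n) (Fin n) ℂ} (hF : IsFrame ℓ F) (hG : IsFrame ℓ₁ G) (hZ : IsUnit Z)
    (h : F * Fᵀ * Zᴴᵀ = Z) : IsSouriau ℓ ℓ₁ (souriau G Z) := by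
  have h1 : Z * (Zᴴᵀ)⁻¹ = F * Fᵀ := by
    nth_rewrite 1 [← h]
    rw [Matrix.mul_nonsing_inv_cancel_right _ _ (isUnit_det_conj hZ)]
  rw [souriau, h1]
  exact hF.isSouriau hG

lemma continuousAt_souriau (G : Matrix (Fin n) (Fin n) ℂ) {Z : ℝ → Matrix (Fin n) (Fin n) ℂ}
    (hZ : Continuous Z) {t : ℝ} (hu : IsUnit (Z t)) :
    ContinuousAt (fun t => souriau G (Z t)) t := by
  have h1 : Continuous fun t => (Z t)ᴴᵀ := hZ.matrix_conjTranspose.matrix_transpose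
  have h2 : ContinuousAt (fun t => ((Z t)ᴴᵀ)⁻¹) t := by
    simp only [Matrix.inv_def, Ring.inverse_eq_inv']
    exact (h1.matrix_det.continuousAt.inv₀ (isUnit_det_conj hu).ne_zero).smul
      h1.matrix_adjugate.continuousAt
  have h3 : ContinuousAt (fun t => Z t * ((Z t)ᴴᵀ)⁻¹ * (Gᴴᵀ * Gᴴ)) t :=
    (hZ.continuousAt.mul h2).mul continuousAt_const
  exact h3.neg

/-- In the coordinates `M = Gᴴ Z` adapted to the target, the unitary matrix is conjugate to `-M
M̄⁻¹`, the shape required for counting on arcs. -/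
lemma souriau_mul {ℓ₁ : Submodule ℝ (Fin n ⊕ Fin n → ℝ)} {G Z : Matrix (Fin n) (Fin n) ℂ}
    (hG : IsFrame ℓ₁ G) (hZ : IsUnit Z) :
    souriau G Z * (G * (Gᴴ * Z)ᴴᵀ) = -(G * (Gᴴ * Z)) := by
  have h1 : Gᴴᵀ * Gᵀ = 1 := by rw [← Matrix.transpose_mul, hG.unitary', Matrix.transpose_one]
  rw [← Matrix.mul_assoc G, hG.unitary', Matrix.one_mul, souriau, Matrix.conjTranspose_mul,
    Matrix.conjTranspose_conjTranspose, Matrix.transpose_mul, neg_mul]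
  congr 1
  calc Z * (Zᴴᵀ)⁻¹ * (Gᴴᵀ * Gᴴ) * (G * (Gᵀ * Zᴴᵀ))
      = Z * ((Zᴴᵀ)⁻¹ * (Gᴴᵀ * ((Gᴴ * G) * (Gᵀ * Zᴴᵀ)))) := by simp only [Matrix.mul_assoc]
    _ = Z * ((Zᴴᵀ)⁻¹ * ((Gᴴᵀ * Gᵀ) * Zᴴᵀ)) := by
        rw [hG.unitary, Matrix.one_mul, Matrix.mul_assoc Gᴴᵀ]
    _ = Z := by
        rw [h1, Matrix.one_mul, Matrix.nonsing_inv_mul _ (isUnit_det_conj hZ), Matrix.mul_one]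

/-- The left side is the symplectic form, which the unitary matrix `Gᴴ` preserves. Hence the
Lagrange identity holds unchanged in coordinates adapted to the target. -/
lemma inner_reOp_imOp_sub_frame {ℓ₁ : Submodule ℝ (Fin n ⊕ Fin n → ℝ)}
    {G : Matrix (Fin n) (Fin n) ℂ} (hG : IsFrame ℓ₁ G)
    (P Q P' Q' : EuclideanSpace ℝ (Fin n) →L[ℝ] EuclideanSpace ℝ (Fin n))
    (c c' : EuclideanSpace ℝ (Fin n)) :
    inner ℝ (reOp (Gᴴ * pairMat P Q) c) (imOp (Gᴴ * pairMat P' Q') c') -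
        inner ℝ (imOp (Gᴴ * pairMat P Q) c) (reOp (Gᴴ * pairMat P' Q') c') =
      inner ℝ (P c) (Q' c') - inner ℝ (Q c) (P' c') := by
  have h : (Gᴴ * pairMat P Q)ᴴ * (Gᴴ * pairMat P' Q') = (pairMat P Q)ᴴ * pairMat P' Q' := by
    rw [Matrix.conjTranspose_mul, Matrix.conjTranspose_conjTranspose, Matrix.mul_assoc,
      ← Matrix.mul_assoc G, hG.unitary', Matrix.one_mul]
  rw [inner_reOp_imOp_sub, h, ← inner_reOp_imOp_sub]
  simp only [reOp_pairMat, imOp_pairMat]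

/-- In coordinates adapted to the target, membership in `ℓ₁` means being a real vector. -/
lemma imOp_eq_zero_iff {ℓ₁ : Submodule ℝ (Fin n ⊕ Fin n → ℝ)}
    {G : Matrix (Fin n) (Fin n) ℂ} (hG : IsFrame ℓ₁ G)
    (P Q : EuclideanSpace ℝ (Fin n) →L[ℝ] EuclideanSpace ℝ (Fin n))
    (c : EuclideanSpace ℝ (Fin n)) :
    imOp (Gᴴ * pairMat P Q) c = 0 ↔ Sum.elim (WithLp.ofLp (P c)) (WithLp.ofLp (Q c)) ∈ ℓ₁ := by
  have h1 := mulVec_rvec (Gᴴ * pairMat P Q) c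
  rw [← Matrix.mulVec_mulVec, pairMat_mulVec_rvec] at h1
  rw [hG.mem_iff]
  constructor
  · intro h
    refine ⟨WithLp.ofLp (reOp (Gᴴ * pairMat P Q) c), ?_⟩
    have h2 : pvec (reOp (Gᴴ * pairMat P Q) c) (imOp (Gᴴ * pairMat P Q) c) =
        rvec (WithLp.ofLp (reOp (Gᴴ * pairMat P Q) c)) := by
      rw [h]
      ext i
      apply Complex.ext <;> simp [pvec, cvec, rvec]
    rw [← h2, ← h1, Matrix.mulVec_mulVec, hG.unitary', Matrix.one_mulVec]
    rfl
  · rintro ⟨v, hv⟩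
    have hv' : pvec (P c) (Q c) = G *ᵥ rvec v := hv
    rw [hv', Matrix.mulVec_mulVec, hG.unitary, Matrix.one_mulVec] at h1
    ext i
    have h2 := congrArg Complex.im (congrFun h1 i)
    simpa [rvec, pvec, cvec] using h2.symm

end LagrangianPath

end

end MaslovMorse

namespace MaslovMorse

noncomputable section

open Topology Filter Module QuadraticForm

/-! ### Admissible partitions and the Maslov index of a monotone path. -/

section MaslovIndex

variable {n : ℕ}

lemma injOn_exp_I {a b : ℝ} (hab : b - a ≤ 2 * Real.pi) :
    Set.InjOn (fun x : ℝ => Complex.exp (Complex.I * (x : ℂ))) (Set.Ioo a b) := by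
  intro x hx y hy h
  simp only at h
  rw [Complex.exp_eq_exp_iff_exists_int] at h
  obtain ⟨k, hk⟩ := h
  have h1 : (x : ℂ) = ((y + k * (2 * Real.pi) : ℝ) : ℂ) := by
    have : Complex.I * (x : ℂ) = Complex.I * ((y + k * (2 * Real.pi) : ℝ) : ℂ) := by
      rw [hk]
      push_cast
      ring
    exact mul_left_cancel₀ Complex.I_ne_zero this
  have h2 : x = y + k * (2 * Real.pi) := Complex.ofReal_injective h1
  have hpi := Real.pi_pos
  have h3 : (k : ℝ) < 1 := by
    by_contra! hc
    nlinarith [hx.2, hy.1]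
  have h4 : (-1 : ℝ) < k := by
    by_contra! hc
    nlinarith [hx.1, hy.2]
  have h5 : k = 0 := by
    have h3' : k < 1 := by exact_mod_cast h3
    have h4' : -1 < k := by exact_mod_cast h4
    omega
  rw [h2, h5]
  simp

/-- The spectrum is finite, and each eigenvalue excludes at most one `ε` for each of the two signs.
-/
lemma exists_gap (W : Matrix (Fin n) (Fin n) ℂ) : ∃ ε, 0 < ε ∧ ε < Real.pi ∧
    Complex.exp (Complex.I * ((Real.pi + ε : ℝ) : ℂ)) ∉ spectrum ℂ W ∧
    Complex.exp (Complex.I * ((Real.pi - ε : ℝ) : ℂ)) ∉ spectrum ℂ W := by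
  have hfin : (spectrum ℂ W).Finite := Matrix.finite_spectrum W
  have hpi := Real.pi_pos
  have h1 : {ε | ε ∈ Set.Ioo 0 Real.pi ∧
      Complex.exp (Complex.I * ((Real.pi + ε : ℝ) : ℂ)) ∈ spectrum ℂ W}.Finite := by
    refine Set.Finite.of_finite_image (f := fun ε : ℝ =>
      Complex.exp (Complex.I * ((Real.pi + ε : ℝ) : ℂ))) (hfin.subset ?_) fun x hx y hy h => ?_
    · rintro _ ⟨ε, hε, rfl⟩
      exact hε.2
    · have := injOn_exp_I (a := 0) (b := 2 * Real.pi) (by linarith)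
        (x₁ := Real.pi + x) (x₂ := Real.pi + y)
        ⟨by linarith [hx.1.1], by linarith [hx.1.2]⟩ ⟨by linarith [hy.1.1], by linarith [hy.1.2]⟩ h
      linarith
  have h2 : {ε | ε ∈ Set.Ioo 0 Real.pi ∧
      Complex.exp (Complex.I * ((Real.pi - ε : ℝ) : ℂ)) ∈ spectrum ℂ W}.Finite := by
    refine Set.Finite.of_finite_image (f := fun ε : ℝ =>
      Complex.exp (Complex.I * ((Real.pi - ε : ℝ) : ℂ))) (hfin.subset ?_) fun x hx y hy h => ?_
    · rintro _ ⟨ε, hε, rfl⟩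
      exact hε.2
    · have := injOn_exp_I (a := 0) (b := 2 * Real.pi) (by linarith)
        (x₁ := Real.pi - x) (x₂ := Real.pi - y)
        ⟨by linarith [hx.1.2], by linarith [hx.1.1]⟩ ⟨by linarith [hy.1.2], by linarith [hy.1.1]⟩ h
      linarith
  obtain ⟨ε, hε, hne⟩ := (Set.Ioo_infinite hpi).exists_notMem_finite (h1.union h2)
  exact ⟨ε, hε.1, hε.2, fun h => hne (Or.inl ⟨hε, h⟩), fun h => hne (Or.inr ⟨hε, h⟩)⟩

lemma eventually_notMem_spectrum {W : ℝ → Matrix (Fin n) (Fin n) ℂ} {I : Set ℝ}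
    {t : ℝ} (hW : ContinuousWithinAt W I t) {z : ℂ} (hz : z ∉ spectrum ℂ (W t)) :
    ∀ᶠ r in 𝓝[I] t, z ∉ spectrum ℂ (W r) := by
  have key : ∀ A : Matrix (Fin n) (Fin n) ℂ, z ∉ spectrum ℂ A ↔
      (algebraMap ℂ (Matrix (Fin n) (Fin n) ℂ) z - A).det ≠ 0 := fun A => by
    rw [spectrum.notMem_iff, Matrix.isUnit_iff_isUnit_det, isUnit_iff_ne_zero]
  simp only [key] at hz ⊢
  have hdet : Continuous fun A : Matrix (Fin n) (Fin n) ℂ =>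
      (algebraMap ℂ (Matrix (Fin n) (Fin n) ℂ) z - A).det :=
    (continuous_const.sub continuous_id).matrix_det
  exact (hdet.continuousAt.comp_continuousWithinAt hW).eventually_ne hz

lemma exists_isAdmissible {W : ℝ → Matrix (Fin n) (Fin n) ℂ} {a b : ℝ} (hab : a < b)
    (hW : ContinuousOn W (Set.Icc a b)) : ∃ N t ε, IsAdmissible W a b N t ε := by
  let P : ℝ → ℝ → Prop := fun ε r =>
    Complex.exp (Complex.I * ((Real.pi + ε : ℝ) : ℂ)) ∉ spectrum ℂ (W r) ∧
      Complex.exp (Complex.I * ((Real.pi - ε : ℝ) : ℂ)) ∉ spectrum ℂ (W r)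
  have hloc : ∀ t ∈ Set.Icc a b, ∃ ε ∈ Set.Ioo 0 Real.pi, ∃ δ > 0,
      ∀ r ∈ Set.Icc a b, |r - t| < δ → P ε r := fun t ht => by
    obtain ⟨ε, h0, h1, h2, h3⟩ := exists_gap (W t)
    have hev := (eventually_notMem_spectrum (hW t ht) h2).and
      (eventually_notMem_spectrum (hW t ht) h3)
    rw [eventually_nhdsWithin_iff, Metric.eventually_nhds_iff] at hev
    obtain ⟨δ, hδ, h⟩ := hev
    exact ⟨ε, ⟨h0, h1⟩, δ, hδ, fun r hr hrt => h hrt hr⟩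
  choose! ε hε δ hδ hP using hloc
  -- Each gap persists near its point; a uniform partition finer than the Lebesgue number of these
  -- neighbourhoods puts every piece inside one of them.
  obtain ⟨η, hη, hL⟩ := lebesgue_number_lemma_of_metric (isCompact_Icc (a := a) (b := b))
    (c := fun t : Set.Icc a b => Metric.ball (t : ℝ) (δ t)) (fun t => Metric.isOpen_ball)
    fun t ht => Set.mem_iUnion.2 ⟨⟨t, ht⟩, Metric.mem_ball_self (hδ t ht)⟩
  obtain ⟨N, hN⟩ := exists_nat_gt ((b - a) / η)
  have hN0 : (0 : ℝ) < N := lt_of_le_of_lt (div_nonneg (by linarith) hη.le) hN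
  set h := (b - a) / N with hh
  have hh0 : 0 < h := div_pos (by linarith) hN0
  have hhη : h < η := by
    rw [div_lt_iff₀ hη] at hN
    rw [hh, div_lt_iff₀ hN0]
    linarith
  have hNh : N * h = b - a := mul_div_cancel₀ _ hN0.ne'
  have hmem : ∀ j < N, a + j * h ∈ Set.Icc a b ∧ a + (j + 1 : ℕ) * h ≤ b := fun j hj => by
    have h1 : ((j + 1 : ℕ) : ℝ) ≤ N := by exact_mod_cast hj
    have h2 : a + (j + 1 : ℕ) * h ≤ b := by nlinarith
    refine ⟨⟨le_add_of_nonneg_right (by positivity), ?_⟩, h2⟩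
    push_cast at h2
    linarith
  have : Nonempty (Set.Icc a b) := ⟨⟨a, Set.left_mem_Icc.2 hab.le⟩⟩
  choose! c hc using hL
  refine ⟨N, fun j => a + j * h, fun j => ε (c (a + j * h)), by simp, by linarith, fun j _ => ?_,
    fun j hj => (hε _ (c (a + j * h)).2).1, fun j hj => (hε _ (c (a + j * h)).2).2, ?_, ?_⟩
  · push_cast
    linarith
  all_goals
    intro j hj r hr
    have hjm := hmem j hj
    have hr' : r ∈ Metric.ball (a + j * h) η := by
      have := hr.2
      push_cast at this
      rw [Metric.mem_ball, Real.dist_eq, abs_lt]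
      constructor <;> linarith [hr.1]
    have hrδ := hc _ hjm.1 hr'
    rw [Metric.mem_ball, Real.dist_eq] at hrδ
    have := hP _ (c (a + j * h)).2 r ⟨hjm.1.1.trans hr.1, hr.2.trans hjm.2⟩ hrδ
  · exact this.1
  · exact this.2

lemma IsAdmissible.mem_Icc {W : ℝ → Matrix (Fin n) (Fin n) ℂ} {a b : ℝ} {N : ℕ} {t ε : ℕ → ℝ}
    (h : IsAdmissible W a b N t ε) {j : ℕ} (hj : j ≤ N) : t j ∈ Set.Icc a b := by
  constructor
  · rw [← h.left]
    induction j with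
    | zero => rfl
    | succ k ih => exact (ih (by omega)).trans (h.lt k (by omega)).le
  · rw [← h.right]
    induction hj using Nat.decreasingInduction with
    | self => rfl
    | of_succ k hk ih => exact (h.lt k hk).le.trans ih

lemma continuous_reOp {M : ℝ → Matrix (Fin n) (Fin n) ℂ} (hM : Continuous M) :
    Continuous fun t => reOp (M t) := by
  let f : Matrix (Fin n) (Fin n) ℝ →ₗ[ℝ] (EuclideanSpace ℝ (Fin n) →L[ℝ] EuclideanSpace ℝ (Fin n)) :=
    LinearMap.toContinuousLinearMap.toLinearMap ∘ₗ Matrix.toEuclideanLin.toLinearMap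
  exact (LinearMap.continuous_of_finiteDimensional f).comp (hM.matrix_map Complex.continuous_re)

lemma continuous_imOp {M : ℝ → Matrix (Fin n) (Fin n) ℂ} (hM : Continuous M) :
    Continuous fun t => imOp (M t) := by
  let f : Matrix (Fin n) (Fin n) ℝ →ₗ[ℝ] (EuclideanSpace ℝ (Fin n) →L[ℝ] EuclideanSpace ℝ (Fin n)) :=
    LinearMap.toContinuousLinearMap.toLinearMap ∘ₗ Matrix.toEuclideanLin.toLinearMap
  exact (LinearMap.continuous_of_finiteDimensional f).comp (hM.matrix_map Complex.continuous_im)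

lemma inner_imOp_arcOp {M : Matrix (Fin n) (Fin n) ℂ}
    (hs : ∀ c c', inner ℝ (imOp M c) (reOp M c') = inner ℝ (reOp M c) (imOp M c')) (x : ℝ)
    (w w' : EuclideanSpace ℝ (Fin n)) :
    inner ℝ ((-imOp M) w) (arcOp M x w') = inner ℝ (arcOp M x w) ((-imOp M) w') := by
  simp only [arcOp, neg_apply, sub_apply, smul_apply, inner_neg_left, inner_neg_right,
    inner_sub_left, inner_sub_right, inner_smul_left, inner_smul_right, conj_trivial, hs]
  ring

/-- When the two values of `arcOp` agree, the terms with `cos x` cancel, leaving `sin x` times the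
symplectic pairing. Because `sin (ε / 2) > 0`, the chart form on an arc is monotone in the same
direction as the form of the boundary value problem. -/
lemma inner_imOp_arcOp_sub {M M' : Matrix (Fin n) (Fin n) ℂ} {x : ℝ}
    {w w' : EuclideanSpace ℝ (Fin n)} (h : arcOp M x w = arcOp M' x w') :
    inner ℝ ((-imOp M') w') (arcOp M' x w') - inner ℝ ((-imOp M) w) (arcOp M x w) =
      Real.sin x * (inner ℝ (reOp M w) (imOp M' w') - inner ℝ (imOp M w) (reOp M' w')) := by
  rw [← h]
  nth_rewrite 2 [h]
  simp only [arcOp, neg_apply, sub_apply, smul_apply, inner_neg_left, inner_sub_right,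
    inner_smul_right]
  rw [real_inner_comm (imOp M w) (imOp M' w'), real_inner_comm (reOp M w) (imOp M' w')]
  ring

lemma crossSpace_arcOp (M : Matrix (Fin n) (Fin n) ℂ) (x : ℝ) :
    crossSpace (arcOp M x) (-imOp M) ⊤ = LinearMap.ker (imOp M).toLinearMap := by
  ext c
  rw [mem_crossSpace, LinearMap.mem_ker]
  refine ⟨fun h => ?_, fun h => ⟨trivial, fun k _ => ?_⟩⟩
  · have := h.2 _ (Submodule.mem_top (x := (-imOp M) c))
    rw [inner_self_eq_zero, neg_apply, neg_eq_zero] at this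
    exact this
  · have h' : imOp M c = 0 := h
    rw [neg_apply, h', neg_zero, inner_zero_left]

/-- The number of eigenvalues on an arc decreases along a monotone path by the dimensions of the
intersections. -/
lemma arcCount_add_finsum {W M : ℝ → Matrix (Fin n) (Fin n) ℂ} {G : Matrix (Fin n) (Fin n) ℂ}
    {H : ℝ → ℝ → LinearMap.BilinForm ℝ (EuclideanSpace ℝ (Fin n))} (hG : IsUnit G)
    (hMu : ∀ t, IsUnit (M t)) (hMc : Continuous M)
    (hWM : ∀ t, W t * (G * (M t)ᴴᵀ) = -(G * M t))
    (hM : ∀ t₁ t₂ c c', inner ℝ (reOp (M t₁) c) (imOp (M t₂) c') -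
      inner ℝ (imOp (M t₁) c) (reOp (M t₂) c') = (t₁ - t₂) * H t₁ t₂ c c')
    (hH : ∀ t₁ c c', Continuous fun t₂ => H t₁ t₂ c c') (hHpos : ∀ t c, c ≠ 0 → 0 < H t t c c)
    {a b ε : ℝ} (hab : a ≤ b) (hε : 0 < ε) (hε' : ε < Real.pi)
    (hgap : ∀ r ∈ Set.Icc a b,
      Complex.exp (Complex.I * ((Real.pi + ε : ℝ) : ℂ)) ∉ spectrum ℂ (W r)) :
    arcCount (W b) ε + ∑ᶠ t ∈ Set.Ico a b, finrank ℝ (LinearMap.ker (imOp (M t)).toLinearMap) =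
      arcCount (W a) ε := by
  have hMs : ∀ t c c', inner ℝ (imOp (M t) c) (reOp (M t) c') =
      inner ℝ (reOp (M t) c) (imOp (M t) c') := fun t c c' => by
    have := hM t t c c'
    rw [sub_self, zero_mul] at this
    linarith
  have harc := fun x (hx : x ∈ Set.Icc a b) => arcCount_add_sigNeg hG (hMu x) (hWM x) (hMs x) hε
    hε' (hgap x hx)
  let T : ℝ → EuclideanSpace ℝ (Fin n) →L[ℝ] EuclideanSpace ℝ (Fin n) := fun x =>
    arcOp (M x) (ε / 2)
  let D : ℝ → EuclideanSpace ℝ (Fin n) →L[ℝ] EuclideanSpace ℝ (Fin n) := fun x => -imOp (M x)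
  have hTc : Continuous T := by
    have h1 := continuous_imOp hMc
    have h2 := continuous_reOp hMc
    simp only [T, arcOp]
    fun_prop
  have hTD : ∀ t w w', inner ℝ (D t w) (T t w') = inner ℝ (T t w) (D t w') := fun t =>
    inner_imOp_arcOp (hMs t) _
  have hid : ∀ t₁ t₂ w₁ w₂, T t₁ w₁ = T t₂ w₂ → inner ℝ (D t₂ w₂) (T t₂ w₂) -
      inner ℝ (D t₁ w₁) (T t₁ w₁) = Real.sin (ε / 2) * ((t₁ - t₂) * H t₁ t₂ w₁ w₂) :=
    fun t₁ t₂ w₁ w₂ h => (inner_imOp_arcOp_sub h).trans (by rw [hM])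
  have hsin : 0 < Real.sin (ε / 2) := Real.sin_pos_of_pos_of_lt_pi (half_pos hε) (by linarith)
  have hcross : ∀ t, crossSpace (T t) (D t) ⊤ = LinearMap.ker (imOp (M t)).toLinearMap := fun t =>
    crossSpace_arcOp _ _
  have hev : ∀ t₀ ∈ Set.Icc a b, ∀ᶠ t in 𝓝[Set.Icc a b] t₀,
      (t ≤ t₀ → sigNeg (chartForm (T t) (D t) ⊤) = sigNeg (chartForm (T t₀) (D t₀) ⊤)) ∧
      (t₀ < t → sigNeg (chartForm (T t) (D t) ⊤) = sigNeg (chartForm (T t₀) (D t₀) ⊤) +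
        finrank ℝ (LinearMap.ker (imOp (M t₀)).toLinearMap)) := fun t₀ ht₀ => by
    have := eventually_sigNeg_chartForm (K := ⊤) hsin
      hTc.continuousOn (fun x hx => (harc x hx).1) hTD hH hHpos hid ht₀
    rw [hcross t₀] at this
    exact this
  have h1 := (step_function_sum hab hev).2
  have ha := (harc _ (Set.left_mem_Icc.2 hab)).2
  have hb := (harc _ (Set.right_mem_Icc.2 hab)).2
  change sigNeg (chartForm (arcOp (M a) (ε / 2)) (-imOp (M a)) ⊤) + _ =
    sigNeg (chartForm (arcOp (M b) (ε / 2)) (-imOp (M b)) ⊤) at h1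
  omega

/-- The Maslov index of a path of Lagrangian subspaces that is monotone with respect to the target,
in terms of a function that jumps by the dimensions of the intersections with the target. -/
lemma hasMaslovIndex_of_step {Υ : ℝ → Submodule ℝ (Fin n ⊕ Fin n → ℝ)}
    {ℓ₁ : Submodule ℝ (Fin n ⊕ Fin n → ℝ)} (hℓ₁ : IsLagrangian ℓ₁)
    {P Q : ℝ → EuclideanSpace ℝ (Fin n) →L[ℝ] EuclideanSpace ℝ (Fin n)}
    {H : ℝ → ℝ → LinearMap.BilinForm ℝ (EuclideanSpace ℝ (Fin n))}
    {C : ℝ → Submodule ℝ (EuclideanSpace ℝ (Fin n))} {r : ℝ → ℕ} {a b : ℝ} (hab : a < b)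
    (hmem : ∀ t z, z ∈ Υ t ↔ ∃ c, z = Sum.elim (WithLp.ofLp (P t c)) (WithLp.ofLp (Q t c)))
    (hinj : ∀ t c, P t c = 0 → Q t c = 0 → c = 0)
    (hP : Continuous P) (hQ : Continuous Q)
    (hid : ∀ t₁ t₂ c c', inner ℝ (P t₁ c) (Q t₂ c') - inner ℝ (Q t₁ c) (P t₂ c') =
      (t₁ - t₂) * H t₁ t₂ c c')
    (hH : ∀ t₁ c c', Continuous fun t₂ => H t₁ t₂ c c') (hHpos : ∀ t c, c ≠ 0 → 0 < H t t c c)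
    (hC : ∀ t c, c ∈ C t ↔ Sum.elim (WithLp.ofLp (P t c)) (WithLp.ofLp (Q t c)) ∈ ℓ₁)
    (hr : ∀ t₀ ∈ Set.Icc a b, ∀ᶠ t in 𝓝[Set.Icc a b] t₀,
      (t ≤ t₀ → r t = r t₀) ∧ (t₀ < t → r t = r t₀ + finrank ℝ (C t₀))) :
    HasMaslovIndex Υ ℓ₁ a b ((r a : ℤ) - r b) := by
  obtain ⟨G, hG⟩ := hℓ₁.exists_frame
  have hsymm : ∀ t c c', inner ℝ (Q t c) (P t c') = inner ℝ (P t c) (Q t c') := fun t c c' => by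
    have := hid t t c c'
    rw [sub_self, zero_mul] at this
    linarith
  have hL : ∀ t, IsLagrangian (Υ t) := fun t => isLagrangian_of_param (hmem t) (hinj t) (hsymm t)
  choose F hF using fun t => (hL t).exists_frame
  let Z : ℝ → Matrix (Fin n) (Fin n) ℂ := fun t => pairMat (P t) (Q t)
  have hZ : Continuous Z := continuous_pairMat hP hQ
  have hZF := fun t => (hF t).mul_transpose_mul (hmem t) (hinj t)
  have hGu : IsUnit G := IsUnit.of_mul_eq_one _ hG.unitary'
  have hGhu : IsUnit Gᴴ := IsUnit.of_mul_eq_one _ hG.unitary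
  let M : ℝ → Matrix (Fin n) (Fin n) ℂ := fun t => Gᴴ * Z t
  have hMu : ∀ t, IsUnit (M t) := fun t => hGhu.mul (hZF t).1
  have hM : ∀ t₁ t₂ c c', inner ℝ (reOp (M t₁) c) (imOp (M t₂) c') -
      inner ℝ (imOp (M t₁) c) (reOp (M t₂) c') = (t₁ - t₂) * H t₁ t₂ c c' := fun t₁ t₂ c c' =>
    (inner_reOp_imOp_sub_frame hG _ _ _ _ c c').trans (hid t₁ t₂ c c')
  have hker : ∀ t, LinearMap.ker (imOp (M t)).toLinearMap = C t := fun t => by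
    ext c
    rw [hC, ← imOp_eq_zero_iff hG]
    rfl
  have hW : Continuous fun t => souriau G (Z t) :=
    continuous_iff_continuousAt.2 fun t => continuousAt_souriau G hZ (hZF t).1
  refine ⟨hℓ₁, fun t _ => hL t, fun t => souriau G (Z t), fun t _ =>
    isSouriau_souriau (hF t) hG (hZF t).1 (hZF t).2, hW.continuousOn,
    exists_isAdmissible hab hW.continuousOn, fun N t ε hadm => ?_⟩
  -- On each piece, whatever `ε j` is, the arc count falls by the sum of the dimensions of `C` over
  -- the half-open interval, and `r` rises by the same sum; the differences then telescope.
  have hstep : ∀ j < N, (arcCount (souriau G (Z (t (j + 1)))) (ε j) : ℤ) -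
      arcCount (souriau G (Z (t j))) (ε j) = -(r (t (j + 1)) : ℤ) - -(r (t j) : ℤ) := by
    intro j hj
    have hlt := hadm.lt j hj
    have hsub : Set.Icc (t j) (t (j + 1)) ⊆ Set.Icc a b :=
      Set.Icc_subset_Icc (hadm.mem_Icc hj.le).1 (hadm.mem_Icc hj).2
    have h1 : arcCount (souriau G (Z (t (j + 1)))) (ε j) +
        ∑ᶠ x ∈ Set.Ico (t j) (t (j + 1)), finrank ℝ (C x) =
          arcCount (souriau G (Z (t j))) (ε j) := by
      rw [finsum_mem_congr (g := fun x => finrank ℝ (LinearMap.ker (imOp (M x)).toLinearMap)) rfl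
        fun x _ => by rw [hker x]]
      exact arcCount_add_finsum (W := fun x => souriau G (Z x)) hGu hMu (continuous_const.mul hZ)
        (fun x => souriau_mul hG (hZF x).1) hM hH hHpos hlt.le (hadm.pos j hj) (hadm.lt_pi j hj)
        (hadm.gap_add j hj)
    have h2 := (step_function_sum hlt.le (d := fun x => finrank ℝ (C x)) (f := r)
      fun t₀ ht₀ => (hr t₀ (hsub ht₀)).filter_mono (nhdsWithin_mono _ hsub)).2
    omega
  rw [Finset.sum_congr rfl fun j hj => hstep j (Finset.mem_range.1 hj),
    Finset.sum_range_sub (fun j => -(r (t j) : ℤ)), hadm.left, hadm.right]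
  ring

end MaslovIndex

end

end MaslovMorse

namespace MaslovMorse

noncomputable section

open Topology Filter Module QuadraticForm

/-! ### The shooting plane, its target and their Maslov index. -/

section Planes

variable {n : ℕ} {V : ℝ → Matrix (Fin n) (Fin n) ℝ} {α₁ α₂ β₁ β₂ : Matrix (Fin n) (Fin n) ℝ}

lemma sumElim_mem_targetPlane (hβ : IsSelfAdjointBC β₁ β₂) {y y' : EuclideanSpace ℝ (Fin n)} :
    Sum.elim (WithLp.ofLp y) (WithLp.ofLp y') ∈ targetPlane β₁ β₂ ↔ hβ.toRobin.Holds y y' := by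
  rw [targetPlane, LinearMap.mem_ker, Matrix.mulVecLin_apply, Matrix.fromCols_mulVec_sumElim,
    hβ.holds_iff]

lemma isLagrangian_targetPlane (hβ : IsSelfAdjointBC β₁ β₂) : IsLagrangian (targetPlane β₁ β₂) := by
  refine isLagrangian_of_param (P := hβ.toRobin.fst) (Q := hβ.toRobin.snd) (fun z => ⟨fun h => ?_, ?_⟩)
    (fun c => hβ.toRobin.param_injective) fun c c' => ?_
  · have hz : z = Sum.elim (WithLp.ofLp (WithLp.toLp 2 (z ∘ Sum.inl)))
        (WithLp.ofLp (WithLp.toLp 2 (z ∘ Sum.inr))) := (Sum.elim_comp_inl_inr z).symm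
    rw [hz, sumElim_mem_targetPlane hβ] at h
    obtain ⟨c, h1, h2⟩ := h.exists_param
    exact ⟨c, by rw [h1, h2, ← hz]⟩
  · rintro ⟨c, rfl⟩
    exact (sumElim_mem_targetPlane hβ).2 (hβ.toRobin.holds_param c)
  · have := (hβ.toRobin.holds_param c).isotropic (hβ.toRobin.holds_param c')
    linarith

lemma toLp_mulVec_sub_smul (A : Matrix (Fin n) (Fin n) ℝ) (lam : ℝ) (y : Fin n → ℝ) :
    WithLp.toLp 2 ((A - lam • (1 : Matrix (Fin n) (Fin n) ℝ)) *ᵥ y) =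
      toCLM A (WithLp.toLp 2 y) - lam • WithLp.toLp 2 y := by
  rw [Matrix.sub_mulVec, Matrix.smul_mulVec, Matrix.one_mulVec]
  rfl

lemma mem_shootingPlane (hVc : ContinuousOn V (Set.Icc (0 : ℝ) 1)) (hα : IsSelfAdjointBC α₁ α₂)
    {s : ℝ} (hs : s ∈ Set.Ioc (0 : ℝ) 1) (lam : ℝ) (z : Fin n ⊕ Fin n → ℝ) :
    z ∈ shootingPlane V α₁ α₂ s lam ↔ ∃ c,
      z = Sum.elim (WithLp.ofLp (solP (extendPotential V hVc) hα.toRobin lam s c))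
        (WithLp.ofLp (solQ (extendPotential V hVc) hα.toRobin lam s c)) := by
  have hx1 : ∀ {x}, x ∈ Set.Icc 0 s → x ∈ Set.Icc (0 : ℝ) 1 := fun h => ⟨h.1, h.2.trans hs.2⟩
  let e := PiLp.continuousLinearEquiv 2 ℝ (fun _ : Fin n => ℝ)
  constructor
  · rintro ⟨p, q, h, rfl⟩
    obtain ⟨c, hc⟩ := exists_eq_sol (extendPotential V hVc) hα.toRobin (s := s) (lam := lam) hs.2
      (p := fun x => WithLp.toLp 2 (p x)) (q := fun x => WithLp.toLp 2 (q x))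
      (fun x hx => e.symm.hasFDerivAt.comp_hasDerivWithinAt x (h.deriv_p x hx))
      (fun x hx => by
        rw [extendPotential_apply hVc (hx1 hx), ← toLp_mulVec_sub_smul]
        exact e.symm.hasFDerivAt.comp_hasDerivWithinAt x (h.deriv_q x hx))
      (hα.holds_iff.2 h.init)
    have := hc s ⟨hs.1.le, le_rfl⟩
    exact ⟨c, by rw [← this.1, ← this.2]⟩
  · rintro ⟨c, rfl⟩
    refine ⟨fun x => WithLp.ofLp (solP (extendPotential V hVc) hα.toRobin lam x c),
      fun x => WithLp.ofLp (solQ (extendPotential V hVc) hα.toRobin lam x c),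
      ⟨fun x hx => ?_, fun x hx => ?_, ?_⟩, rfl⟩
    · exact (e.hasFDerivAt.comp_hasDerivAt x
        (hasDerivAt_solP (extendPotential V hVc) hα.toRobin lam c (hx1 hx))).hasDerivWithinAt
    · have h1 := e.hasFDerivAt.comp_hasDerivAt x
        (hasDerivAt_solQ (extendPotential V hVc) hα.toRobin lam c (hx1 hx))
      rw [extendPotential_apply hVc (hx1 hx), ← WithLp.toLp_ofLp (p := 2)
        (solP (extendPotential V hVc) hα.toRobin lam x c), ← toLp_mulVec_sub_smul] at h1
      exact h1.hasDerivWithinAt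
    · rw [← hα.holds_iff, solP_zero, solQ_zero]
      exact hα.toRobin.holds_param c

/-- The Maslov index in terms of the negative indices of the forms at the end points. -/
lemma hasMaslovIndex_shootingPlane (hVc : ContinuousOn V (Set.Icc (0 : ℝ) 1))
    (hVs : ∀ x ∈ Set.Icc (0 : ℝ) 1, (V x).IsSymm) (hα : IsSelfAdjointBC α₁ α₂)
    (hβ : IsSelfAdjointBC β₁ β₂) {s : ℝ} (hs : s ∈ Set.Ioc (0 : ℝ) 1) {a b : ℝ} (hab : a < b)
    (hu : ∀ lam ∈ Set.Icc a b, IsUnit (solP (extendPotential V hVc) hα.toRobin lam s)) :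
    HasMaslovIndex (fun lam => shootingPlane V α₁ α₂ s lam) (targetPlane β₁ β₂) a b
      ((sigNeg (shotForm (extendPotential V hVc) hα.toRobin hβ.toRobin s a) : ℤ) -
        sigNeg (shotForm (extendPotential V hVc) hα.toRobin hβ.toRobin s b)) := by
  have hV := extendPotential_symm hVc hVs
  have hs01 : s ∈ Set.Icc (0 : ℝ) 1 := ⟨hs.1.le, hs.2⟩
  exact hasMaslovIndex_of_step (isLagrangian_targetPlane hβ)
    (H := fun l₁ l₂ => solPairing (extendPotential V hVc) hα.toRobin hs l₁ l₂)
    (C := fun lam => shotCross (extendPotential V hVc) hα.toRobin hβ.toRobin s lam)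
    (r := fun lam => sigNeg (shotForm (extendPotential V hVc) hα.toRobin hβ.toRobin s lam)) hab
    (mem_shootingPlane hVc hα hs) (fun lam c => sol_injective hα.toRobin hV hs lam)
    (continuous_solP _ _ hs01) (continuous_solQ _ _ hs01)
    (lagrange_identity_sol hα.toRobin hV hs) (continuous_solPairing _ _ hs)
    (fun lam c => solPairing_self_pos _ _ hs lam)
    (fun lam c => mem_shotCross.trans (sumElim_mem_targetPlane hβ).symm)
    fun lam h => eventually_sigNeg_shotForm _ _ hV hs hu h

end Planes

end

end MaslovMorse

theorem mainTheorem2 {n : ℕ} (V : ℝ → Matrix (Fin n) (Fin n) ℝ)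
    (hVcont : ContinuousOn V (Set.Icc (0 : ℝ) 1))
    (hVsymm : ∀ x ∈ Set.Icc (0 : ℝ) 1, (V x).IsSymm)
    (α₁ α₂ β₁ β₂ : Matrix (Fin n) (Fin n) ℝ)
    (hα : IsSelfAdjointBC α₁ α₂) (hβ : IsSelfAdjointBC β₁ β₂)
    (hB : ∀ p ∈ kerB α₁ α₂ β₁ β₂,
      Matrix.toEuclideanLin (robin α₁ α₂ - robin β₁ β₂) p = 0)
    (hnd : (0 : ℝ) ∉ spectrum ℝ (opQ α₁ α₂ β₁ β₂ (V 0))) :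
    ∃ s₁ ∈ Set.Ioc (0 : ℝ) 1, ∀ s ∈ Set.Ioc (0 : ℝ) s₁,
      HasMorseIndex (opH V α₁ α₂ β₁ β₂ s)
        (mor (opB α₁ α₂ β₁ β₂) + mor (opQ α₁ α₂ β₁ β₂ (V 0))) ∧
      ∃ lam₀ > (0 : ℝ), ∀ lamInf ≥ lam₀,
        HasMaslovIndex (fun lam => shootingPlane V α₁ α₂ s lam) (targetPlane β₁ β₂)
          (-lamInf) 0
          (-((mor (opB α₁ α₂ β₁ β₂) : ℤ) + (mor (opQ α₁ α₂ β₁ β₂ (V 0)) : ℤ))) := by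
  obtain ⟨s₁, hs₁, h1⟩ := exists_forall_finsum_shotCross hα.toRobin hβ.toRobin
    (extendPotential_symm hVcont hVsymm)
  obtain ⟨s₂, hs₂, h2⟩ := exists_forall_sigNeg_shotForm_matrix hVcont hVsymm hα hβ hB hnd
  refine ⟨min 1 (min s₁ s₂), ⟨by positivity, min_le_left _ _⟩, fun s hs => ?_⟩
  have hs01 : s ∈ Set.Ioc (0 : ℝ) 1 := ⟨hs.1, hs.2.trans (min_le_left _ _)⟩
  have hmin := hs.2.trans (min_le_right _ _)
  obtain ⟨hu, ⟨lam₀, hlam₀, hneg⟩, hfin, hsum⟩ := h1 s hs01 (hmin.trans (min_le_left _ _))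
  have h3 := h2 s hs01 (hmin.trans (min_le_right _ _))
  -- The added 1 makes `-lamInf` strictly less than `-lam₀`, where the negative index vanishes; only
  -- the index at λ = 0 then contributes to the Maslov index.
  refine ⟨hasMorseIndex_opH hVcont hα hβ hs01 hfin (hsum.trans h3), lam₀ + 1, by linarith,
    fun lamInf hl => ?_⟩
  have h4 := hasMaslovIndex_shootingPlane hVcont hVsymm hα hβ hs01
    (show -lamInf < 0 by linarith) fun lam h => hu lam h.2
  rw [hneg (-lamInf) (by linarith), h3] at h4
  push_cast at h4
  rw [zero_sub] at h4
  exact h4
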